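/- Let $\mathcal V$ be a symmetric monoidal closed category whose underlying (locally small) category is complete and cocomplete. All categories, functors, natural transformations, adjunctions, limits and colimits are $\mathcal V$-enriched; a $\mathcal V$-category is small if it has a small set of objects. For a $\mathcal V$-category $\mathcal D$, a presheaf $F:\mathcal D^{\mathrm{op}}\to\mathcal V$ is *small* if it is a small colimit of representables, that is, $F\cong\mathrm{Lan}_{J^{\mathrm{op}}}F_0$ for some $\mathcal V$-functor $J:\mathcal C\to\mathcal D$ with $\mathcal C$ small and some $F_0:\mathcal C^{\mathrm{op}}\to\mathcal V$. The $\mathcal V$-category of small presheaves on $\mathcal D$ is denoted $\mathcal P\mathcal D$. A *weight* is a small presheaf on a possibly large $\mathcal V$-category. Let $\Phi$ be a class of weights. For a weight $F:\mathcal D^{\mathrm{op}}\to\mathcal V$ and $S:\mathcal D^{\mathrm{op}}\to\mathcal K$, the weighted limit $\{F,S\}$ is defined by a natural isomorphism $\mathcal K(X,\{F,S\})\cong[\mathcal D^{\mathrm{op}},\mathcal V](F,\mathcal K(X,S-))$. A $\mathcal V$-category is *$\Phi$-complete* if it has all limits $\{F,S\}$ with $F\in\Phi$; a $\mathcal V$-functor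 is *$\Phi$-continuous* if its domain is $\Phi$-complete and it preserves these limits. Left Kan extensions are pointwise: $\mathrm{Lan}_GM$ at $b$ is the colimit of $M$ weighted by $\mathcal B(G-,b)$. Assume *Axiom A*: for every small $\Phi$-complete $\mathcal V$-category $\mathcal A$ and every $\Phi$-continuous $F:\mathcal A\to\mathcal V$, the $\mathcal V$-functor $F*-=\mathrm{Lan}_YF:[\mathcal A^{\mathrm{op}},\mathcal V]\to\mathcal V$ (with $Y$ the Yoneda embedding) is $\Phi$-continuous. Let $\mathcal K$ be a $\mathcal V$-category satisfying *Axiom B2*: $\mathcal K$ is $\Phi$-complete and the Yoneda embedding $\mathcal K\to\mathcal P\mathcal K$ has a $\Phi$-continuous left adjoint. Let $\mathcal A,\mathcal B$ be small $\Phi$-complete $\mathcal V$-categories and $G:\mathcal A\to\mathcal B$ an arbitrary $\mathcal V$-functor. Then: 1. for every $\Phi$-continuous $M:\mathcal A\to\mathcal V$, the left Kan extension $\mathrm{Lan}_GM:\mathcal B\to\mathcal V$ exists and is $\Phi$-continuous; 2. for every $\Phi$-continuous $M:\mathcal A\to\mathcal K$, the left Kan extension $\mathrm{Lan}_GM:\mathcal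 B\to\mathcal K$ exists and is $\Phi$-continuous; 3. if moreover $G$ is $\Phi$-continuous then, writing $\Phi\text{-}\mathrm{Cts}(\mathcal A,\mathcal L)$ for the full sub-$\mathcal V$-category of $[\mathcal A,\mathcal L]$ consisting of the $\Phi$-continuous $\mathcal V$-functors, both for $\mathcal L=\mathcal V$ and for $\mathcal L=\mathcal K$ the algebraic $\mathcal V$-functor $G^*:\Phi\text{-}\mathrm{Cts}(\mathcal B,\mathcal L)\to\Phi\text{-}\mathrm{Cts}(\mathcal A,\mathcal L)$ given by composition with $G$ has a left $\mathcal V$-adjoint, whose value at $M$, together with the unit of the adjunction, is the left Kan extension $\mathrm{Lan}_GM$. -/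

import Mathlib

open CategoryTheory MonoidalCategory BraidedCategory Limits
open scoped MonoidalClosed

universe u w k u₁ u₂ u₃ u₄ a

namespace EnrichedLan

set_option linter.unusedSectionVars false
set_option linter.unusedVariables false

noncomputable section

section Basic

variable {V : Type w} [Category.{u} V] [MonoidalCategory V]
variable {C : Type u₁} [EnrichedCategory V C] {D : Type u₂} [EnrichedCategory V D]

/-- Composition of two generalized elements of hom-objects of a `V`-category. -/
def cmp {E E' : V} {X Y Z : C}
    (f : E ⟶ EnrichedCategory.Hom X Y) (g : E' ⟶ EnrichedCategory.Hom Y Z) :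
    E ⊗ E' ⟶ EnrichedCategory.Hom X Z :=
  (f ⊗ₘ g) ≫ eComp V X Y Z

theorem comp_cmp {E E' A A' : V} {X Y Z : C} (p : A ⟶ E) (q : A' ⟶ E')
    (f : E ⟶ EnrichedCategory.Hom X Y) (g : E' ⟶ EnrichedCategory.Hom Y Z) :
    (p ⊗ₘ q) ≫ cmp f g = cmp (p ≫ f) (q ≫ g) := by
  simp [cmp]

theorem whiskerLeft_cmp {E E' A' : V} {X Y Z : C} (q : A' ⟶ E')
    (f : E ⟶ EnrichedCategory.Hom X Y) (g : E' ⟶ EnrichedCategory.Hom Y Z) :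
    E ◁ q ≫ cmp f g = cmp f (q ≫ g) := by
  rw [← id_tensorHom, comp_cmp, Category.id_comp]

theorem whiskerRight_cmp {E E' A : V} {X Y Z : C} (p : A ⟶ E)
    (f : E ⟶ EnrichedCategory.Hom X Y) (g : E' ⟶ EnrichedCategory.Hom Y Z) :
    p ▷ E' ≫ cmp f g = cmp (p ≫ f) g := by
  rw [← tensorHom_id, comp_cmp, Category.id_comp]

theorem eComp_eq_cmp (X Y Z : C) : eComp V X Y Z = cmp (𝟙 _) (𝟙 _) := by
  simp [cmp]

theorem cmp_assoc {E E' E'' : V} {W X Y Z : C}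
    (f : E ⟶ EnrichedCategory.Hom W X) (g : E' ⟶ EnrichedCategory.Hom X Y)
    (h : E'' ⟶ EnrichedCategory.Hom Y Z) :
    cmp (cmp f g) h = (α_ _ _ _).hom ≫ cmp f (cmp g h) := by
  have h1 : cmp (cmp f g) h = ((f ⊗ₘ g) ⊗ₘ h) ≫ eComp V W X Y ▷ _ ≫ eComp V W Y Z := by
    rw [← tensorHom_id, tensorHom_comp_tensorHom_assoc, Category.comp_id]; rfl
  have h2 : cmp f (cmp g h) = (f ⊗ₘ (g ⊗ₘ h)) ≫ _ ◁ eComp V X Y Z ≫ eComp V W X Z := by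
    rw [← id_tensorHom, tensorHom_comp_tensorHom_assoc, Category.comp_id]; rfl
  rw [h1, h2, ← e_assoc', associator_naturality_assoc]

theorem cmp_assoc' {E E' E'' : V} {W X Y Z : C}
    (f : E ⟶ EnrichedCategory.Hom W X) (g : E' ⟶ EnrichedCategory.Hom X Y)
    (h : E'' ⟶ EnrichedCategory.Hom Y Z) :
    cmp f (cmp g h) = (α_ _ _ _).inv ≫ cmp (cmp f g) h := by
  rw [cmp_assoc, Iso.inv_hom_id_assoc]

theorem cmp_map (F : EnrichedFunctor V C D) {E E' : V} {X Y Z : C}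
    (f : E ⟶ EnrichedCategory.Hom X Y) (g : E' ⟶ EnrichedCategory.Hom Y Z) :
    cmp f g ≫ F.map X Z = cmp (f ≫ F.map X Y) (g ≫ F.map Y Z) := by
  simp [cmp]

theorem id_cmp {E : V} {X Y : C} (f : E ⟶ EnrichedCategory.Hom X Y) :
    cmp (eId V X) f = (λ_ E).hom ≫ f := by
  have h := e_id_comp V X Y
  rw [← cancel_epi (λ_ E).inv, Iso.inv_hom_id_assoc, cmp, tensorHom_def', Category.assoc,
    ← leftUnitor_inv_naturality_assoc, h, Category.comp_id]

theorem cmp_id {E : V} {X Y : C} (f : E ⟶ EnrichedCategory.Hom X Y) :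
    cmp f (eId V Y) = (ρ_ E).hom ≫ f := by
  have h := e_comp_id V X Y
  rw [← cancel_epi (ρ_ E).inv, Iso.inv_hom_id_assoc, cmp, MonoidalCategory.tensorHom_def,
    Category.assoc, ← rightUnitor_inv_naturality_assoc, h, Category.comp_id]

end Basic

section Braided

variable {V : Type w} [Category.{u} V] [MonoidalCategory V] [BraidedCategory V]
variable {C : Type u₁} [EnrichedCategory V C] {D : Type u₂} [EnrichedCategory V D]
  {B : Type u₃} [EnrichedCategory V B]

theorem cmp_op {E E' : V} {X Y Z : Cᵒᵖ}
    (f : E ⟶ EnrichedCategory.Hom X Y) (g : E' ⟶ EnrichedCategory.Hom Y Z) :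
    cmp f g = (β_ E E').hom ≫ cmp (C := C) (X := Z.unop) (Y := Y.unop) (Z := X.unop) g f :=
  tensorHom_eComp_op_eq V f g

/-- The opposite of a `V`-functor. -/
def opFunctor (F : EnrichedFunctor V C D) : EnrichedFunctor V Cᵒᵖ Dᵒᵖ where
  obj X := Opposite.op (F.obj X.unop)
  map X Y := F.map Y.unop X.unop
  map_id X := F.map_id X.unop
  map_comp X Y Z := by
    change _ = cmp (C := Dᵒᵖ) (X := Opposite.op (F.obj X.unop)) (Y := Opposite.op (F.obj Y.unop))
      (Z := Opposite.op (F.obj Z.unop)) _ _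
    rw [cmp_op]
    refine Eq.trans ?_ (congrArg (_ ≫ ·) (F.map_comp _ _ _))
    exact Category.assoc _ _ _

/-- `E`-graded `V`-natural transformations `F ⟶ G`, for an object `E` of `V`: families
`E ⟶ D(F c, G c)` that are `V`-natural in `c`. They are the generalized elements of shape `E` of
the object of `V`-natural transformations from `F` to `G`, whether or not it exists; for `E = 𝟙_ V`
they are the `V`-natural transformations. -/
structure GradedTrans (E : V) (F G : EnrichedFunctor V C D) where
  /-- The components. -/
  app (c : C) : E ⟶ EnrichedCategory.Hom (F.obj c) (G.obj c)
  naturality (c c' : C) :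
    (β_ E (EnrichedCategory.Hom c c')).hom ≫ (F.map c c' ⊗ₘ app c') ≫ eComp V _ _ _ =
      (app c ⊗ₘ G.map c c') ≫ eComp V _ _ _

theorem GradedTrans.nat {E : V} {F G : EnrichedFunctor V C D} (σ : GradedTrans E F G) (c c' : C) :
    (β_ E (EnrichedCategory.Hom c c')).hom ≫ cmp (F.map c c') (σ.app c') =
      cmp (σ.app c) (G.map c c') := σ.naturality c c'

theorem GradedTrans.nat' {E E' : V} {F G : EnrichedFunctor V C D} (σ : GradedTrans E F G)
    {c c' : C} (f : E' ⟶ EnrichedCategory.Hom c c') :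
    cmp (f ≫ F.map c c') (σ.app c') =
      (β_ E E').inv ≫ cmp (σ.app c) (f ≫ G.map c c') := by
  rw [← whiskerLeft_cmp, ← σ.nat, braiding_naturality_right_assoc, Iso.inv_hom_id_assoc,
    whiskerRight_cmp]

/-- The object of `V`-natural transformations from `F` to `G` exists in `V`. -/
class HasNatHom (F G : EnrichedFunctor V C D) : Prop where
  exists_natHom : ∃ (H : V) (π : GradedTrans H F G), ∀ (E : V) (σ : GradedTrans E F G),
    ∃! f : E ⟶ H, ∀ c, f ≫ π.app c = σ.app c

/-- The object of `V`-natural transformations from `F` to `G`, i.e. the end of `D(F c, G c)`. -/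
def natHom (F G : EnrichedFunctor V C D) [h : HasNatHom F G] : V :=
  h.exists_natHom.choose

/-- The universal family `natHom F G ⟶ D(F c, G c)`. -/
def natHomπ (F G : EnrichedFunctor V C D) [h : HasNatHom F G] : GradedTrans (natHom F G) F G :=
  h.exists_natHom.choose_spec.choose

section
variable {F G H K : EnrichedFunctor V C D}

theorem natHom_existsUnique [h : HasNatHom F G] {E : V} (σ : GradedTrans E F G) :
    ∃! f : E ⟶ natHom F G, ∀ c, f ≫ (natHomπ F G).app c = σ.app c :=
  h.exists_natHom.choose_spec.choose_spec E σ

/-- The morphism into the object of `V`-natural transformations classified by a graded family. -/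
def natHomLift [HasNatHom F G] {E : V} (σ : GradedTrans E F G) : E ⟶ natHom F G :=
  (natHom_existsUnique σ).choose

theorem natHomLift_π [HasNatHom F G] {E : V} (σ : GradedTrans E F G) (c : C) :
    natHomLift σ ≫ (natHomπ F G).app c = σ.app c :=
  (natHom_existsUnique σ).choose_spec.1 c

/-- Restriction of a graded transformation along a morphism of the grading objects. -/
def GradedTrans.precomp {E E' : V} (f : E' ⟶ E) (σ : GradedTrans E F G) : GradedTrans E' F G where
  app c := f ≫ σ.app c
  naturality c c' := by
    change _ ≫ cmp _ _ = cmp _ _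
    rw [← whiskerLeft_cmp, ← whiskerRight_cmp, ← σ.nat, braiding_naturality_left_assoc]

theorem natHom_ext [HasNatHom F G] {E : V} {f g : E ⟶ natHom F G}
    (h : ∀ c, f ≫ (natHomπ F G).app c = g ≫ (natHomπ F G).app c) : f = g :=
  (natHom_existsUnique ((natHomπ F G).precomp f)).unique (fun _ => rfl) (fun c => (h c).symm)

/-- The identity transformation. -/
def GradedTrans.id (F : EnrichedFunctor V C D) : GradedTrans (𝟙_ V) F F where
  app c := eId V (F.obj c)
  naturality c c' := by
    change _ ≫ cmp _ _ = cmp _ _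
    rw [id_cmp, cmp_id, braiding_tensorUnit_left_assoc, Iso.inv_hom_id_assoc]

/-- Vertical composition of graded transformations. -/
def GradedTrans.comp {E E' : V} (σ : GradedTrans E F G) (τ : GradedTrans E' G H) :
    GradedTrans (E ⊗ E') F H where
  app c := (σ.app c ⊗ₘ τ.app c) ≫ eComp V _ _ _
  naturality c c' := by
    change _ ≫ cmp _ (cmp _ _) = cmp (cmp _ _) _
    rw [cmp_assoc, ← τ.nat, ← whiskerLeft_cmp, cmp_assoc' (σ.app c), ← σ.nat,
      cmp_assoc' (F.map c c'), ← whiskerRight_cmp]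
    simp only [braiding_tensor_left_hom, Category.assoc, Iso.hom_inv_id_assoc]

end

/-- The `V`-category structure on a family of `V`-functors, the hom-objects being the objects of
`V`-natural transformations. -/
@[reducible]
def enrichedOfFunctors {ι : Type u₃} (P : ι → EnrichedFunctor V C D)
    [∀ i j, HasNatHom (P i) (P j)] : EnrichedCategory V ι where
  Hom i j := natHom (P i) (P j)
  id i := natHomLift (GradedTrans.id (P i))
  comp i j k := natHomLift ((natHomπ (P i) (P j)).comp (natHomπ (P j) (P k)))
  id_comp i j := by
    apply natHom_ext
    intro c
    rw [Category.assoc, Category.assoc, natHomLift_π]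
    change _ ≫ _ ≫ cmp _ _ = _
    rw [whiskerRight_cmp, natHomLift_π]
    change _ ≫ cmp (eId V _) _ = _
    rw [id_cmp, Iso.inv_hom_id_assoc, Category.id_comp]
  comp_id i j := by
    apply natHom_ext
    intro c
    rw [Category.assoc, Category.assoc, natHomLift_π]
    change _ ≫ _ ≫ cmp _ _ = _
    rw [whiskerLeft_cmp, natHomLift_π]
    change _ ≫ cmp _ (eId V _) = _
    rw [cmp_id, Iso.inv_hom_id_assoc, Category.id_comp]
  assoc i j k l := by
    apply natHom_ext
    intro c
    rw [Category.assoc, Category.assoc, natHomLift_π, Category.assoc, natHomLift_π]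
    change _ ≫ _ ≫ cmp _ _ = _ ≫ cmp _ _
    rw [whiskerLeft_cmp, whiskerRight_cmp, natHomLift_π, natHomLift_π]
    change _ ≫ cmp (cmp _ _) _ = cmp _ (cmp _ _)
    rw [cmp_assoc']

end Braided

section Closed

variable {V : Type w} [Category.{u} V] [MonoidalCategory V] [MonoidalClosed V]
variable {C : Type u₁} [EnrichedCategory V C] {D : Type u₂} [EnrichedCategory V D]
  {J : Type u₃} [EnrichedCategory V J]

theorem uncurry_eId (X : V) : MonoidalClosed.uncurry (eId V X) = (ρ_ X).hom :=
  MonoidalClosed.uncurry_curry _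

theorem uncurry_cmp {E E' X Y Z : V} (f : E ⟶ (ihom X).obj Y) (g : E' ⟶ (ihom Y).obj Z) :
    MonoidalClosed.uncurry (A := X) (cmp (C := V) (X := X) (Y := Y) (Z := Z) f g) =
      (α_ X E E').inv ≫ MonoidalClosed.uncurry f ▷ E' ≫ MonoidalClosed.uncurry g := by
  rw [cmp]
  refine (MonoidalClosed.uncurry_natural_left _ _).trans ?_
  have : MonoidalClosed.uncurry (eComp V X Y Z) = MonoidalClosed.compTranspose X Y Z :=
    MonoidalClosed.uncurry_curry _
  erw [this]
  rw [MonoidalClosed.compTranspose_eq, MonoidalClosed.uncurry_eq f, MonoidalClosed.uncurry_eq g,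
    MonoidalCategory.comp_whiskerRight_assoc, ← associator_inv_naturality_middle_assoc,
    ← whisker_exchange_assoc, ← associator_inv_naturality_right_assoc,
    MonoidalCategory.tensorHom_def, MonoidalCategory.whiskerLeft_comp_assoc]
  rfl

/-- The representable `V`-functor `C(X, -) : C → V`. -/
def corep (X : C) : EnrichedFunctor V C V where
  obj Y := EnrichedCategory.Hom X Y
  map Y Z := MonoidalClosed.curry (eComp V X Y Z)
  map_id Y := by
    apply MonoidalClosed.uncurry_injective
    rw [MonoidalClosed.uncurry_natural_left, MonoidalClosed.uncurry_curry, uncurry_eId,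
      ← cancel_epi (ρ_ _).inv, e_comp_id, Iso.inv_hom_id]
  map_comp Y Z W := by
    apply MonoidalClosed.uncurry_injective
    refine Eq.trans ?_ (uncurry_cmp (MonoidalClosed.curry (eComp V X Y Z))
      (MonoidalClosed.curry (eComp V X Z W))).symm
    rw [MonoidalClosed.uncurry_natural_left]
    simp only [MonoidalClosed.uncurry_curry]
    exact (e_assoc V _ _ _ _).symm

/-- `E`-graded cylinders from `X` over `S`, with weight `F : J → V`: families
`E ⊗ F j ⟶ C(X, S j)` that are `V`-natural in `j`. They correspond to the `E`-graded `V`-natural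
transformations `F ⟶ C(X, S -)`, i.e. to the generalized elements of shape `E` of the object
`[J, V](F, C(X, S -))`, whether or not it exists in `V`. The `V`-functor `F` enters through its
action `F j ⊗ J(j, j') ⟶ F j'`. -/
structure Cylinder (E : V) (F : EnrichedFunctor V J V) (S : EnrichedFunctor V J C) (X : C) where
  /-- The components. -/
  app (j : J) : E ⊗ F.obj j ⟶ EnrichedCategory.Hom X (S.obj j)
  naturality (j j' : J) :
    E ◁ MonoidalClosed.uncurry (F.map j j') ≫ app j' =
      (α_ E (F.obj j) (EnrichedCategory.Hom j j')).inv ≫ (app j ⊗ₘ S.map j j') ≫ eComp V _ _ _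

/-- The cylinder `μ : F ⟶ C(L, S -)` exhibits `L` as the limit `{F, S}` of `S : J → C` weighted by
`F : J → V`: it is `V`-natural, and the induced maps `C(X, L) ⟶ [J, V](F, C(X, S -))` are
isomorphisms, i.e. composition with `μ` is a bijection between morphisms `E ⟶ C(X, L)` and
`E`-graded cylinders, for all `E` in `V`. Naturality of that bijection in `E` is automatic. -/
structure IsWeightedLimit (F : EnrichedFunctor V J V) (S : EnrichedFunctor V J C) (L : C)
    (μ : ∀ j, F.obj j ⟶ EnrichedCategory.Hom L (S.obj j)) : Prop where
  naturality (j j' : J) :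
    MonoidalClosed.uncurry (F.map j j') ≫ μ j' = (μ j ⊗ₘ S.map j j') ≫ eComp V _ _ _
  existsUnique (X : C) (E : V) (σ : Cylinder E F S X) :
    ∃! f : E ⟶ EnrichedCategory.Hom X L, ∀ j, (f ⊗ₘ μ j) ≫ eComp V _ _ _ = σ.app j


end Closed

section Colimits

open Opposite

variable {V : Type w} [Category.{u} V] [MonoidalCategory V] [BraidedCategory V] [MonoidalClosed V]
variable {C : Type u₁} [EnrichedCategory V C] {D : Type u₂} [EnrichedCategory V D]
  {J : Type u₃} [EnrichedCategory V J] {A : Type u₁} [EnrichedCategory V A]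
  {B : Type u₂} [EnrichedCategory V B] {K : Type u₄} [EnrichedCategory V K]

instance hasNatHom_of_small {C : Type u} [EnrichedCategory V C] [HasLimits V]
    (F G : EnrichedFunctor V C D) : HasNatHom F G where
  exists_natHom := by
    let P : V := ∏ᶜ fun c => EnrichedCategory.Hom (F.obj c) (G.obj c)
    let p (c : C) : P ⟶ EnrichedCategory.Hom (F.obj c) (G.obj c) :=
      Pi.π (fun c => EnrichedCategory.Hom (F.obj c) (G.obj c)) c
    let l (q : C × C) : P ⟶ (ihom (EnrichedCategory.Hom q.1 q.2 : V)).obj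
        (EnrichedCategory.Hom (F.obj q.1) (G.obj q.2)) :=
      MonoidalClosed.curry (cmp (F.map q.1 q.2) (p q.2))
    let r (q : C × C) : P ⟶ (ihom (EnrichedCategory.Hom q.1 q.2 : V)).obj
        (EnrichedCategory.Hom (F.obj q.1) (G.obj q.2)) :=
      MonoidalClosed.curry ((β_ P (EnrichedCategory.Hom q.1 q.2)).inv ≫
        cmp (p q.1) (G.map q.1 q.2))
    have key (E : V) (k : E ⟶ P) : k ≫ Pi.lift l = k ≫ Pi.lift r ↔ ∀ c c' : C,
        (β_ E (EnrichedCategory.Hom c c')).hom ≫ cmp (F.map c c') (k ≫ p c') =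
          cmp (k ≫ p c) (G.map c c') := by
      have h1 (q : C × C) : k ≫ l q = k ≫ r q ↔
        (β_ E (EnrichedCategory.Hom q.1 q.2)).hom ≫ cmp (F.map q.1 q.2) (k ≫ p q.2) =
          cmp (k ≫ p q.1) (G.map q.1 q.2) := by
        rw [← MonoidalClosed.curry_natural_left, ← MonoidalClosed.curry_natural_left,
          MonoidalClosed.curry_injective.eq_iff, ← cancel_epi (β_ E (EnrichedCategory.Hom q.1 q.2)).hom,
          whiskerLeft_cmp, ← braiding_naturality_left_assoc, Iso.hom_inv_id_assoc, whiskerRight_cmp]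
      constructor
      · intro h c c'
        rw [← h1 (c, c')]
        have := congrArg (· ≫ Pi.π _ (c, c')) h
        simpa using this
      · intro h
        apply Pi.hom_ext
        intro q
        simpa using (h1 q).2 (h q.1 q.2)
    refine ⟨equalizer (Pi.lift l) (Pi.lift r), ⟨fun c => equalizer.ι _ _ ≫ p c, ?_⟩, ?_⟩
    · exact (key _ _).1 (equalizer.condition _ _)
    · intro E σ
      have hk (c : C) : Pi.lift σ.app ≫ p c = σ.app c := Pi.lift_π _ _
      refine ⟨equalizer.lift (Pi.lift σ.app) ((key _ _).2 ?_), ?_, ?_⟩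
      · intro c c'
        rw [hk, hk]
        exact σ.nat c c'
      · intro c
        rw [equalizer.lift_ι_assoc, hk]
      · intro f hf
        apply equalizer.hom_ext
        rw [equalizer.lift_ι]
        apply Pi.hom_ext
        intro c
        rw [Pi.lift_π, Category.assoc]
        exact hf c

/-- The representable presheaf `C(-, X) : Cᵒᵖ → V`. -/
def rep (X : C) : EnrichedFunctor V Cᵒᵖ V := corep (C := Cᵒᵖ) (op X)

/-- The cocylinder `μ : F ⟶ C(R -, L)` exhibits `L` as the colimit of `R : J → C` weighted by
`F : Jᵒᵖ → V`, i.e. `L` is the `F`-weighted limit of `Rᵒᵖ` in `Cᵒᵖ`. -/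
def IsWeightedColimit (F : EnrichedFunctor V Jᵒᵖ V) (R : EnrichedFunctor V J C) (L : C)
    (μ : ∀ j, F.obj (op j) ⟶ EnrichedCategory.Hom (R.obj j) L) : Prop :=
  IsWeightedLimit F (opFunctor R) (op L) (fun j => μ j.unop)

/-- The component of a transformation into a composite `V`-functor. -/
def GradedTrans.at {G : EnrichedFunctor V A B} {M : EnrichedFunctor V A K}
    {N : EnrichedFunctor V B K} {E : V} (η : GradedTrans E M (G.comp V N)) (a : A) :
    E ⟶ EnrichedCategory.Hom (M.obj a) (N.obj (G.obj a)) :=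
  η.app a

/-- The cocylinder `B(G a, b) ⟶ K(M a, N b)` corresponding to `η : M ⟶ N G`: apply `N` and compose
with the component of `η` at `a`. -/
def lanCylinder {G : EnrichedFunctor V A B} {M : EnrichedFunctor V A K}
    {N : EnrichedFunctor V B K} (η : GradedTrans (𝟙_ V) M (G.comp V N)) (b : B) (a : A) :
    (EnrichedCategory.Hom (G.obj a) b : V) ⟶ EnrichedCategory.Hom (M.obj a) (N.obj b) :=
  (λ_ _).inv ≫ (η.at a ⊗ₘ N.map (G.obj a) b) ≫ eComp V _ _ _

/-- `η : M ⟶ N G` exhibits `N : B → K` as the (pointwise) left Kan extension of `M : A → K` along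
`G : A → B`: for every `b` it exhibits `N b` as the colimit of `M` weighted by
`B(G -, b) : Aᵒᵖ → V`. -/
def IsLan (G : EnrichedFunctor V A B) (M : EnrichedFunctor V A K) (N : EnrichedFunctor V B K)
    (η : GradedTrans (𝟙_ V) M (G.comp V N)) : Prop :=
  ∀ b : B, IsWeightedColimit ((opFunctor G).comp V (rep b)) M (N.obj b) (lanCylinder η b)

theorem IsWeightedLimit.hom_ext {F : EnrichedFunctor V J V} {S : EnrichedFunctor V J C} {L : C}
    {μ : ∀ j, F.obj j ⟶ EnrichedCategory.Hom L (S.obj j)} (h : IsWeightedLimit F S L μ)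
    {X : C} {E : V} {f g : E ⟶ EnrichedCategory.Hom X L}
    (hfg : ∀ j, cmp f (μ j) = cmp g (μ j)) : f = g := by
  refine (h.existsUnique X E ⟨fun j => cmp f (μ j), fun j j' => ?_⟩).unique
    (fun _ => rfl) (fun j => (hfg j).symm)
  change _ = _ ≫ cmp (cmp _ _) _
  rw [whiskerLeft_cmp, h.naturality, ← cmp_assoc']
  rfl

theorem uncurry_rep_map (X Y Z : C) :
    MonoidalClosed.uncurry ((rep X).map (op Y) (op Z)) =
      (β_ (EnrichedCategory.Hom Y X) (EnrichedCategory.Hom Z Y : V)).hom ≫ eComp V Z Y X :=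
  MonoidalClosed.uncurry_curry _

section Lan

variable {G : EnrichedFunctor V A B} {M : EnrichedFunctor V A K} {N : EnrichedFunctor V B K}

theorem GradedTrans.nat_at {E : V} (η : GradedTrans E M (G.comp V N)) (a a' : A) :
    (β_ _ _).hom ≫ cmp (M.map a a') (η.at a') = cmp (η.at a) (G.map a a' ≫ N.map _ _) :=
  η.naturality a a'

theorem lanCylinder_eq (η : GradedTrans (𝟙_ V) M (G.comp V N)) (b : B) (a : A) :
    lanCylinder η b a = (λ_ _).inv ≫ cmp (η.at a) (N.map (G.obj a) b) := rfl

theorem lanCylinder_map (η : GradedTrans (𝟙_ V) M (G.comp V N)) (a : A) (b b' : B) :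
    cmp (lanCylinder η b a) (N.map b b') = eComp V (G.obj a) b b' ≫ lanCylinder η b' a := by
  rw [lanCylinder_eq, lanCylinder_eq, ← whiskerRight_cmp, leftUnitor_inv_naturality_assoc,
    whiskerLeft_cmp, N.map_comp]
  change _ = _ ≫ cmp _ (cmp _ _)
  rw [cmp_assoc']
  simp

theorem eId_lanCylinder (η : GradedTrans (𝟙_ V) M (G.comp V N)) (a : A) :
    eId V (G.obj a) ≫ lanCylinder η (G.obj a) a = η.at a := by
  rw [lanCylinder_eq, leftUnitor_inv_naturality_assoc, whiskerLeft_cmp, N.map_id, cmp_id,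
    ← unitors_equal, Iso.inv_hom_id_assoc]

theorem lan_hom_ext {η : GradedTrans (𝟙_ V) M (G.comp V N)} (h : IsLan G M N η) {b : B} {X : K}
    {E : V} {f g : E ⟶ EnrichedCategory.Hom (N.obj b) X}
    (hfg : ∀ a, cmp (lanCylinder η b a) f = cmp (lanCylinder η b a) g) : f = g := by
  refine IsWeightedLimit.hom_ext (h b) (X := op X) (fun a => ?_)
  have e (k : E ⟶ EnrichedCategory.Hom (N.obj b) X) :=
    cmp_op (X := op X) (Y := op (N.obj b)) (Z := op (M.obj a.unop)) k
      (lanCylinder η b a.unop)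
  exact (e f).trans ((congrArg (_ ≫ ·) (hfg a.unop)).trans (e g).symm)

theorem uncurry_weight (b : B) (a a' : A) :
    MonoidalClosed.uncurry (((opFunctor G).comp V (rep b)).map (op a) (op a')) =
      (β_ (EnrichedCategory.Hom (G.obj a) b) (EnrichedCategory.Hom a' a : V)).hom ≫
        cmp (G.map a' a) (𝟙 _) := by
  refine (MonoidalClosed.uncurry_natural_left _ _).trans ?_
  refine (congrArg (_ ≫ ·) (uncurry_rep_map b (G.obj a) (G.obj a'))).trans ?_
  refine (braiding_naturality_right_assoc _ (G.map a' a) _).trans (congrArg (_ ≫ ·) ?_)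
  refine (congrArg (_ ≫ ·) (eComp_eq_cmp (G.obj a') (G.obj a) b)).trans ?_
  refine (whiskerRight_cmp (G.map a' a) (𝟙 _) (𝟙 _)).trans ?_
  rw [Category.comp_id]

theorem lan_existsUnique {η : GradedTrans (𝟙_ V) M (G.comp V N)} (h : IsLan G M N η) {b : B}
    {X : K} {E : V}
    (s : ∀ a, E ⊗ EnrichedCategory.Hom (G.obj a) b ⟶ EnrichedCategory.Hom (M.obj a) X)
    (hs : ∀ a a', E ◁ ((β_ _ _).hom ≫ cmp (G.map a' a) (𝟙 _)) ≫ s a' =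
      (α_ _ _ _).inv ≫ (β_ _ _).hom ≫ cmp (M.map a' a) (s a)) :
    ∃ f : E ⟶ EnrichedCategory.Hom (N.obj b) X,
      ∀ a, (β_ _ _).hom ≫ cmp (lanCylinder η b a) f = s a := by
  obtain ⟨f, hf, -⟩ := (h b).existsUnique (op X) E ⟨fun a => s a.unop, fun a a' => by
    refine (congrArg (fun t => E ◁ t ≫ s a'.unop) (uncurry_weight b a.unop a'.unop)).trans
      ((hs a.unop a'.unop).trans ?_)
    refine congrArg (_ ≫ ·) ?_
    exact (cmp_op (X := op X) (Y := op (M.obj a.unop)) (Z := op (M.obj a'.unop)) (s a.unop)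
      (M.map a'.unop a.unop)).symm⟩
  refine ⟨f, fun a => Eq.trans ?_ (hf (op a))⟩
  exact (cmp_op (X := op X) (Y := op (N.obj b)) (Z := op (M.obj a)) f
      (lanCylinder η b a)).symm

theorem lan_extend {η : GradedTrans (𝟙_ V) M (G.comp V N)} (h : IsLan G M N η)
    (S : EnrichedFunctor V B K) {E : V}
    (σ : ∀ a, E ⟶ EnrichedCategory.Hom (M.obj a) (S.obj (G.obj a)))
    (hσ : ∀ a a', (β_ _ _).hom ≫ cmp (M.map a a') (σ a') =
      cmp (σ a) (G.map a a' ≫ S.map _ _)) :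
    ∃ τ : GradedTrans E N S, ∀ a b,
      (β_ _ _).hom ≫ cmp (lanCylinder η b a) (τ.app b) =
        cmp (σ a) (S.map (G.obj a) b) := by
  have ex (b : B) : ∃ f : E ⟶ EnrichedCategory.Hom (N.obj b) (S.obj b), ∀ a,
      (β_ _ _).hom ≫ cmp (lanCylinder η b a) f = cmp (σ a) (S.map (G.obj a) b) := by
    refine lan_existsUnique h (fun a => cmp (σ a) (S.map (G.obj a) b)) (fun a a' => ?_)
    rw [whiskerLeft_cmp, Category.assoc, cmp_map, Category.id_comp, ← whiskerLeft_cmp, cmp_assoc',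
      ← hσ, ← whiskerRight_cmp, cmp_assoc]
    simp only [braiding_tensor_left_hom, Category.assoc, Iso.inv_hom_id_assoc]
  choose τ hτ using ex
  have hτ' (b : B) (a : A) : cmp (lanCylinder η b a) (τ b) =
      (β_ _ _).inv ≫ cmp (σ a) (S.map (G.obj a) b) := by
    rw [← hτ, Iso.inv_hom_id_assoc]
  refine ⟨⟨τ, fun b b' => lan_hom_ext h fun a => ?_⟩, fun a b => hτ b a⟩
  change cmp _ (_ ≫ cmp _ _) = cmp _ (cmp _ _)
  rw [← whiskerLeft_cmp, cmp_assoc', cmp_assoc', lanCylinder_map, ← whiskerRight_cmp, hτ', hτ',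
    ← whiskerRight_cmp, cmp_assoc, braiding_inv_naturality_left_assoc, whiskerLeft_cmp,
    S.map_comp]
  change _ ≫ _ ≫ _ ≫ cmp _ (cmp _ _) = _
  simp only [braiding_tensor_right_inv, Category.assoc,
    ← MonoidalCategory.whiskerLeft_comp_assoc, Iso.inv_hom_id_assoc]
  simp

/-- Left Kan extensions have the universal property of enriched left Kan extensions, so the object
of `V`-natural transformations out of them exists whenever it does before extending. -/
theorem hasNatHom_of_isLan {η : GradedTrans (𝟙_ V) M (G.comp V N)} (h : IsLan G M N η)
    (S : EnrichedFunctor V B K) [HasNatHom M (G.comp V S)] : HasNatHom N S where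
  exists_natHom := by
    obtain ⟨τ, hτ⟩ := lan_extend h S (natHomπ M (G.comp V S)).at (natHomπ M (G.comp V S)).nat_at
    have hπ (a : A) : (natHomπ M (G.comp V S)).at a =
        (λ_ _).inv ≫ cmp (η.at a) (τ.app (G.obj a)) := by
      have h1 : (ρ_ _).inv ≫ _ ◁ eId V (G.obj a) ≫ _ = (ρ_ _).inv ≫ _ ◁ eId V (G.obj a) ≫ _ :=
        congrArg (fun t => (ρ_ _).inv ≫ _ ◁ eId V (G.obj a) ≫ t) (hτ a (G.obj a))
      rw [whiskerLeft_cmp, S.map_id, cmp_id, Iso.inv_hom_id_assoc,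
        braiding_naturality_right_assoc, whiskerRight_cmp, eId_lanCylinder] at h1
      rw [← h1]
      simp
    refine ⟨natHom M (G.comp V S), τ, fun E ρ => ?_⟩
    let ρ' : GradedTrans E (G.comp V N) (G.comp V S) := ⟨fun a => ρ.app (G.obj a), fun a a' =>
      (congrArg (_ ≫ ·) (ρ.nat' (G.map a a'))).trans (Iso.hom_inv_id_assoc _ _)⟩
    let r : GradedTrans E M (G.comp V S) := (η.comp ρ').precomp (λ_ E).inv
    have hr (a : A) : natHomLift r ≫ (natHomπ M (G.comp V S)).at a =
      (λ_ _).inv ≫ cmp (η.at a) (ρ.app (G.obj a)) := natHomLift_π r a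
    refine ⟨natHomLift r, fun b => lan_hom_ext h fun a => ?_, fun g hg => natHom_ext fun a => ?_⟩
    · rw [← whiskerLeft_cmp, ← cancel_epi (β_ E (EnrichedCategory.Hom (G.obj a) b)).hom,
        ← braiding_naturality_left_assoc, hτ, whiskerRight_cmp, hr, lanCylinder_eq,
        ← whiskerRight_cmp, ← whiskerRight_cmp, cmp_assoc, cmp_assoc, ← ρ.nat, ← whiskerLeft_cmp]
      simp
    · change g ≫ (natHomπ M (G.comp V S)).at a = natHomLift r ≫ (natHomπ M (G.comp V S)).at a
      rw [hr, hπ, leftUnitor_inv_naturality_assoc, whiskerLeft_cmp, hg]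

end Lan

end Colimits

section Yoneda

open Opposite

variable {V : Type w} [Category.{u} V] [MonoidalCategory V] [BraidedCategory V] [MonoidalClosed V]

/-- The unit `V`-category: one object, with hom-object `𝟙_ V`. -/
@[reducible]
def unitEnriched (V : Type w) [Category.{u} V] [MonoidalCategory V] :
    EnrichedCategory V PUnit.{u + 1} where
  Hom _ _ := 𝟙_ V
  id _ := 𝟙 _
  comp _ _ _ := (λ_ (𝟙_ V)).hom
  id_comp _ _ := by simp
  comp_id _ _ := by simp [unitors_equal]
  assoc _ _ _ _ := by simp [unitors_equal]

attribute [local instance] unitEnriched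

variable {K : Type u₁} [EnrichedCategory V K]

/-- The `V`-functor from the unit `V`-category picking out an object. -/
def pick (k : K) : EnrichedFunctor V PUnit.{u + 1} K where
  obj _ := k
  map _ _ := eId V k
  map_id _ := Category.id_comp _
  map_comp _ _ _ := by
    change (λ_ (𝟙_ V)).hom ≫ _ = cmp _ _
    rw [id_cmp]

/-- A presheaf is small if it is a small colimit of representables: for some `V`-category `A` with
a small set of objects, `J : A → K` and weight `F : Aᵒᵖ → V`, it is the `F`-weighted colimit of the
representables `K(-, J a)`, i.e. the left Kan extension of `F` along `Jᵒᵖ : Aᵒᵖ → Kᵒᵖ`. -/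
def IsSmall (P : EnrichedFunctor V Kᵒᵖ V) : Prop :=
  ∃ (A : Type u) (_ : EnrichedCategory V A) (J : EnrichedFunctor V A K)
    (F : EnrichedFunctor V Aᵒᵖ V) (η : GradedTrans (𝟙_ V) F ((opFunctor J).comp V P)),
    IsLan (opFunctor J) F P η

theorem IsSmall.hasNatHom [HasLimits V] {P : EnrichedFunctor V Kᵒᵖ V} (h : IsSmall P)
    (Q : EnrichedFunctor V Kᵒᵖ V) : HasNatHom P Q := by
  obtain ⟨A, _, J, F, η, h⟩ := h
  exact hasNatHom_of_isLan h Q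

/-- The presheaf on the unit `V`-category with value `x`. -/
def pickOp (x : K) : EnrichedFunctor V PUnit.{u + 1}ᵒᵖ K where
  obj _ := x
  map _ _ := eId V x
  map_id _ := Category.id_comp _
  map_comp _ _ _ := by
    change ((β_ (𝟙_ V) (𝟙_ V)).hom ≫ (λ_ (𝟙_ V)).hom) ≫ _ = cmp _ _
    rw [id_cmp, braiding_tensorUnit_left, unitors_equal, Category.assoc, Category.assoc,
      Iso.inv_hom_id_assoc]

/-- The name of the identity of `k`. -/
def repUnitApp (k : K) : 𝟙_ V ⟶ (ihom (𝟙_ V)).obj (EnrichedCategory.Hom k k) :=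
  MonoidalClosed.curry ((λ_ _).hom ≫ eId V k)

theorem repUnit_naturality (k : K) :
    (β_ (𝟙_ V) (𝟙_ V)).hom ≫ cmp (C := V) (X := 𝟙_ V) (Y := 𝟙_ V) (Z := EnrichedCategory.Hom k k)
      (eId V (𝟙_ V)) (repUnitApp k) =
    cmp (C := V) (X := 𝟙_ V) (Y := EnrichedCategory.Hom k k) (Z := EnrichedCategory.Hom k k)
      (repUnitApp k) (eId V (EnrichedCategory.Hom k k : V)) := by
  refine (congrArg ((β_ (𝟙_ V) (𝟙_ V)).hom ≫ ·) (id_cmp (C := V) (repUnitApp k))).trans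
    (Eq.trans ?_ (cmp_id (C := V) (repUnitApp k)).symm)
  rw [braiding_tensorUnit_left, Category.assoc, unitors_equal, Iso.inv_hom_id_assoc]

theorem map_of_unit (F : EnrichedFunctor V PUnit.{u + 1}ᵒᵖ K) (x : PUnit.{u + 1}ᵒᵖ) :
    F.map x x = eId V (F.obj x) :=
  (Category.id_comp _).symm.trans (F.map_id x)

theorem map_of_unit' (F : EnrichedFunctor V PUnit.{u + 1}ᵒᵖᵒᵖ K) (x : PUnit.{u + 1}ᵒᵖᵒᵖ) :
    F.map x x = eId V (F.obj x) :=
  (Category.id_comp _).symm.trans (F.map_id x)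

/-- The unit exhibiting a representable as a left Kan extension from the unit `V`-category. -/
def repUnit (k : K) : GradedTrans (𝟙_ V) (pickOp (𝟙_ V)) ((opFunctor (pick k)).comp V (rep k)) where
  app _ := repUnitApp k
  naturality x y := (repUnit_naturality k).trans
    (congrArg (cmp (repUnitApp k)) (map_of_unit ((opFunctor (pick k)).comp V (rep k)) x)).symm

theorem uncurry_repCylinder (k : K) (b : Kᵒᵖ) (x : PUnit.{u + 1}ᵒᵖ) :
    MonoidalClosed.uncurry (A := 𝟙_ V) (X := EnrichedCategory.Hom (op k) b)
      (lanCylinder (repUnit (V := V) k) b x) = (λ_ (EnrichedCategory.Hom (op k) b : V)).hom := by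
  have e : lanCylinder (repUnit (V := V) k) b x = (λ_ (EnrichedCategory.Hom (op k) b : V)).inv ≫
      cmp (C := V) (X := 𝟙_ V) (Y := EnrichedCategory.Hom (op k) (op k))
        (Z := EnrichedCategory.Hom (op k) b)
        (repUnitApp k) (MonoidalClosed.curry (eComp V (op k) (op k) b)) := rfl
  refine (congrArg _ e).trans ?_
  refine (MonoidalClosed.uncurry_natural_left _ _).trans ?_
  refine (congrArg (_ ≫ ·) (uncurry_cmp (repUnitApp k)
    (MonoidalClosed.curry (eComp V (op k) (op k) b)))).trans ?_
  rw [repUnitApp, MonoidalClosed.uncurry_curry]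
  refine (congrArg (fun t => _ ≫ _ ≫ _ ≫ t) (MonoidalClosed.uncurry_curry _)).trans ?_
  have h : (eId V (op k) : 𝟙_ V ⟶ _) ▷ EnrichedCategory.Hom (op k) b ≫ eComp V (op k) (op k) b =
      (λ_ _).hom := by
    rw [eComp_eq_cmp, whiskerRight_cmp, Category.comp_id, id_cmp, Category.comp_id]
  change _ ≫ _ ≫ ((λ_ (𝟙_ V)).hom ≫ eId V (op k)) ▷ _ ≫ _ = _
  rw [MonoidalCategory.comp_whiskerRight, Category.assoc, h]
  simp only [MonoidalCategory.leftUnitor_whiskerRight, Category.assoc,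
    Iso.inv_hom_id_assoc]
  refine (leftUnitor_naturality_assoc (λ_ (EnrichedCategory.Hom (op k) b : V)).inv
    (λ_ _).hom).trans ?_
  rw [Iso.inv_hom_id]
  exact Category.comp_id _

theorem cmp_eq_iff {P E X : V} (c : P ⟶ (ihom (𝟙_ V)).obj P)
    (hc : MonoidalClosed.uncurry c = (λ_ P).hom) (f : E ⟶ (ihom P).obj X)
    (s : E ⊗ P ⟶ (ihom (𝟙_ V)).obj X) :
    (β_ _ _).hom ≫ cmp (C := V) (X := 𝟙_ V) (Y := P) (Z := X) c f = s ↔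
      f = MonoidalClosed.curry ((λ_ _).inv ≫ MonoidalClosed.uncurry ((β_ _ _).inv ≫ s)) := by
  have h : MonoidalClosed.uncurry (A := 𝟙_ V) (cmp (C := V) (X := 𝟙_ V) (Y := P) (Z := X) c f) =
      (λ_ _).hom ≫ MonoidalClosed.uncurry f := by
    rw [uncurry_cmp, hc]
    simp
  rw [MonoidalClosed.eq_curry_iff, Iso.eq_inv_comp, ← h, ← Iso.eq_inv_comp]
  exact MonoidalClosed.uncurry_injective.eq_iff.symm

theorem isSmall_rep (k : K) : IsSmall (rep (V := V) k) := by
  refine ⟨PUnit, unitEnriched V, pick k, pickOp (𝟙_ V), repUnit k, fun b => ⟨fun x _ => ?_, ?_⟩⟩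
  · have h1 := map_of_unit' ((opFunctor (opFunctor (pick (V := V) k))).comp V (rep b)) x
    have h2 := map_of_unit' (opFunctor (pickOp (V := V) (𝟙_ V))) x
    refine (congrArg (fun t => MonoidalClosed.uncurry t ≫
      lanCylinder (repUnit (V := V) k) b x.unop) h1).trans
      (Eq.trans ?_ (congrArg (cmp (C := Vᵒᵖ) (lanCylinder (repUnit (V := V) k) b x.unop)) h2).symm)
    refine Eq.trans ?_ (cmp_id (C := Vᵒᵖ) (X := op (EnrichedCategory.Hom (op k) b))
      (Y := op (𝟙_ V)) (lanCylinder (repUnit (V := V) k) b x.unop)).symm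
    exact congrArg (· ≫ lanCylinder (repUnit (V := V) k) b x.unop)
      (uncurry_eId (EnrichedCategory.Hom (op k) b : V))
  · intro X E σ
    have key (f : E ⟶ (ihom (EnrichedCategory.Hom (op k) b)).obj X.unop) (x : PUnit.{u + 1}ᵒᵖᵒᵖ) :
        cmp (C := Vᵒᵖ) (X := X) (Y := op (EnrichedCategory.Hom (op k) b)) (Z := op (𝟙_ V)) f
          (lanCylinder (repUnit (V := V) k) b x.unop) = σ.app x ↔ _ :=
      (Eq.congr_left (cmp_op _ _)).trans
        (cmp_eq_iff _ (uncurry_repCylinder k b x.unop) f (σ.app x))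
    refine ⟨_, fun x => (key _ x).2 rfl, fun g hg => (key g (op (op PUnit.unit))).1 (hg _)⟩

theorem repHom_naturality (k k' : K) (x y : K) :
    (β_ (EnrichedCategory.Hom k k') (EnrichedCategory.Hom y x)).hom ≫
      cmp (C := V) (X := EnrichedCategory.Hom x k) (Y := EnrichedCategory.Hom y k)
        (Z := EnrichedCategory.Hom y k')
        (MonoidalClosed.curry (eComp V (op k) (op x) (op y))) (MonoidalClosed.curry (eComp V y k k')) =
    cmp (C := V) (X := EnrichedCategory.Hom x k) (Y := EnrichedCategory.Hom x k')
        (Z := EnrichedCategory.Hom y k')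
        (MonoidalClosed.curry (eComp V x k k'))
        (MonoidalClosed.curry (eComp V (op k') (op x) (op y))) := by
  apply MonoidalClosed.uncurry_injective
  refine (MonoidalClosed.uncurry_natural_left _ _).trans ?_
  refine (congrArg (_ ≫ ·) (uncurry_cmp _ _)).trans ?_
  refine Eq.trans ?_ (uncurry_cmp _ _).symm
  refine (congrArg₂ (fun s t => _ ≫ _ ≫ s ▷ _ ≫ t) (MonoidalClosed.uncurry_curry _)
    (MonoidalClosed.uncurry_curry _)).trans ?_
  refine Eq.trans ?_ (congrArg₂ (fun s t => _ ≫ s ▷ _ ≫ t) (MonoidalClosed.uncurry_curry _)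
    (MonoidalClosed.uncurry_curry _)).symm
  change _ ≫ _ ≫ ((β_ _ _).hom ≫ eComp V y x k) ▷ _ ≫ _ =
    _ ≫ _ ≫ (β_ _ _).hom ≫ eComp V y x k'
  simp only [eComp_eq_cmp, MonoidalCategory.comp_whiskerRight, Category.assoc]
  rw [whiskerRight_cmp, braiding_naturality_left_assoc, whiskerLeft_cmp]
  simp only [Category.comp_id]
  rw [cmp_assoc]
  simp [braiding_tensor_left_hom]

/-- The action of the Yoneda embedding on homs. -/
def repHom (k k' : K) : GradedTrans (EnrichedCategory.Hom k k' : V) (rep k) (rep k') where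
  app x := (corep x.unop).map k k'
  naturality x y := repHom_naturality k k' x.unop y.unop

theorem eId_repHom (k : K) [HasNatHom (rep (V := V) k) (rep k)] :
    eId V k ≫ natHomLift (repHom k k) = natHomLift (GradedTrans.id (rep (V := V) k)) := by
  apply natHom_ext
  intro x
  rw [Category.assoc, natHomLift_π, natHomLift_π]
  exact (corep x.unop).map_id k

theorem eComp_repHom (k k' k'' : K) [HasNatHom (rep (V := V) k) (rep k')]
    [HasNatHom (rep (V := V) k') (rep k'')] [HasNatHom (rep (V := V) k) (rep k'')] :
    eComp V k k' k'' ≫ natHomLift (repHom k k'') =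
      (natHomLift (repHom k k') ⊗ₘ natHomLift (repHom k' k'')) ≫
        natHomLift ((natHomπ (rep (V := V) k) (rep k')).comp (natHomπ (rep k') (rep k''))) := by
  apply natHom_ext
  intro x
  rw [Category.assoc, Category.assoc, natHomLift_π, natHomLift_π]
  refine ((corep x.unop).map_comp k k' k'').trans ?_
  refine Eq.trans ?_ (comp_cmp (C := V) (X := (rep k).obj x) (Y := (rep k').obj x)
    (Z := (rep k'').obj x) (natHomLift (repHom k k')) (natHomLift (repHom k' k''))
    ((natHomπ (rep k) (rep k')).app x) ((natHomπ (rep k') (rep k'')).app x)).symm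
  exact congrArg₂ (cmp (C := V) (X := (rep k).obj x) (Y := (rep k').obj x) (Z := (rep k'').obj x))
    (natHomLift_π (repHom k k') x).symm (natHomLift_π (repHom k' k'') x).symm

end Yoneda

section Main

open Opposite

variable {V : Type w} [Category.{u} V] [MonoidalCategory V] [BraidedCategory V] [MonoidalClosed V]
  [HasLimits V]

/-- The functor `V`-category `[C, D]`, for `C` with a small set of objects. -/
instance functorCategory {C : Type u} [EnrichedCategory V C] {D : Type u₂} [EnrichedCategory V D] :
    EnrichedCategory V (EnrichedFunctor V C D) :=
  enrichedOfFunctors id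

/-- The Yoneda embedding `A → [Aᵒᵖ, V]` for `A` with a small set of objects. -/
def yonedaFunctor (A : Type u) [EnrichedCategory V A] :
    EnrichedFunctor V A (EnrichedFunctor V Aᵒᵖ V) where
  obj := rep
  map k k' := natHomLift (repHom k k')
  map_id k := eId_repHom k
  map_comp k k' k'' := eComp_repHom k k' k''

variable (V) in
/-- A small presheaf on a (possibly large) `V`-category `K`. -/
structure SmallPresheaf (K : Type u₁) [EnrichedCategory V K] where
  /-- The underlying presheaf. -/
  presheaf : EnrichedFunctor V Kᵒᵖ V
  isSmall : IsSmall presheaf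

instance {K : Type u₁} [EnrichedCategory V K] (P Q : SmallPresheaf V K) :
    HasNatHom P.presheaf Q.presheaf :=
  P.isSmall.hasNatHom Q.presheaf

/-- The `V`-category of small presheaves on `K`, as a full subcategory of the presheaves. -/
instance smallPresheafCategory {K : Type u₁} [EnrichedCategory V K] :
    EnrichedCategory V (SmallPresheaf V K) :=
  enrichedOfFunctors SmallPresheaf.presheaf

/-- The representables as small presheaves. -/
def smallRep {K : Type u₁} [EnrichedCategory V K] (k : K) : SmallPresheaf V K :=
  ⟨rep k, isSmall_rep k⟩

/-- The Yoneda embedding of `K` into its small presheaves. -/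
def smallYoneda (K : Type u₁) [EnrichedCategory V K] : EnrichedFunctor V K (SmallPresheaf V K) where
  obj := smallRep
  map k k' :=
    haveI : HasNatHom (rep (V := V) k) (rep k') := (isSmall_rep k).hasNatHom _
    natHomLift (repHom k k')
  map_id k :=
    haveI : HasNatHom (rep (V := V) k) (rep k) := (isSmall_rep k).hasNatHom _
    eId_repHom k
  map_comp k k' k'' :=
    haveI (x y : K) : HasNatHom (rep (V := V) x) (rep y) := (isSmall_rep x).hasNatHom _
    eComp_repHom k k' k''

/-- A class of weights `Φ`: a class of small presheaves `F : Dᵒᵖ → V` on `V`-categories `D`. -/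
structure WeightClass (V : Type w) [Category.{u} V] [MonoidalCategory V] [BraidedCategory V]
    [MonoidalClosed V] where
  /-- Membership. -/
  Mem {D : Type a} [EnrichedCategory V D] (F : EnrichedFunctor V Dᵒᵖ V) : Prop
  isSmall {D : Type a} [EnrichedCategory V D] (F : EnrichedFunctor V Dᵒᵖ V) : Mem F → IsSmall F

variable {C : Type u₁} [EnrichedCategory V C] {D : Type u₂} [EnrichedCategory V D]

/-- `C` is `Φ`-complete: it has all limits `{F, S}` with `F` in `Φ`. -/
def IsComplete (Φ : WeightClass.{u, w, a} V) (C : Type u₁) [EnrichedCategory V C] : Prop :=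
  ∀ (J : Type a) [EnrichedCategory V J] (F : EnrichedFunctor V Jᵒᵖ V), Φ.Mem F →
    ∀ S : EnrichedFunctor V Jᵒᵖ C, ∃ (L : C) (μ : ∀ j, F.obj j ⟶ EnrichedCategory.Hom L (S.obj j)),
      IsWeightedLimit F S L μ

/-- `M : C → D` is `Φ`-continuous: `C` has all limits with weights in `Φ` and `M` preserves
them. -/
structure IsContinuous (Φ : WeightClass.{u, w, a} V) (M : EnrichedFunctor V C D) : Prop where
  complete : IsComplete Φ C
  preserves (J : Type a) [EnrichedCategory V J] (F : EnrichedFunctor V Jᵒᵖ V) (hF : Φ.Mem F)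
    (S : EnrichedFunctor V Jᵒᵖ C) (L : C) (μ : ∀ j, F.obj j ⟶ EnrichedCategory.Hom L (S.obj j)) :
    IsWeightedLimit F S L μ →
      IsWeightedLimit F (S.comp V M) (M.obj L) (fun j => μ j ≫ M.map L (S.obj j))

theorem IsContinuous.comp {Φ : WeightClass.{u, w, a} V} {G : EnrichedFunctor V C D}
    {E : Type u₃} [EnrichedCategory V E] {M : EnrichedFunctor V D E}
    (hG : IsContinuous Φ G) (hM : IsContinuous Φ M) : IsContinuous Φ (G.comp V M) where
  complete := hG.complete
  preserves J _ F hF S L μ h := by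
    have h2 := hM.preserves J F hF _ _ _ (hG.preserves J F hF S L μ h)
    have e : (fun j => (μ j ≫ G.map L (S.obj j)) ≫ M.map (G.obj L) (G.obj (S.obj j))) =
        fun j => μ j ≫ (G.comp V M).map L (S.obj j) := funext fun j => Category.assoc _ _ _
    have e2 : (S.comp V G).comp V M = S.comp V (G.comp V M) := by
      simp only [EnrichedFunctor.comp, EnrichedFunctor.mk.injEq, heq_eq_eq, true_and]
      funext X Y
      exact Category.assoc _ _ _
    have h3 (T : EnrichedFunctor V Jᵒᵖ E) (ht : (S.comp V G).comp V M = T) :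
        ∀ ν : ∀ j, F.obj j ⟶ EnrichedCategory.Hom (M.obj (G.obj L)) (T.obj j),
        (∀ j, HEq (ν j) ((μ j ≫ G.map L (S.obj j)) ≫ M.map (G.obj L) (G.obj (S.obj j)))) →
        IsWeightedLimit F T (M.obj (G.obj L)) ν := by
      subst ht
      intro ν hν
      rw [show ν = _ from funext fun j => eq_of_heq (hν j)]
      exact h2
    exact h3 _ e2 _ fun j => heq_of_eq (Category.assoc _ _ _).symm

variable {E : Type u₃} [EnrichedCategory V E]

/-- A `V`-adjunction `L ⊣ R`: isomorphisms `D(L X, Y) ≅ C(X, R Y)` in `V`, `V`-natural in `X` and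
in `Y`. -/
structure EnrichedAdjunction (L : EnrichedFunctor V C D) (R : EnrichedFunctor V D C) where
  /-- The isomorphism of hom-objects. -/
  homIso (X : C) (Y : D) : EnrichedCategory.Hom (L.obj X) Y ≅
    (EnrichedCategory.Hom X (R.obj Y) : V)
  naturality_left (X' X : C) (Y : D) :
    ((L.map X' X ⊗ₘ 𝟙 (EnrichedCategory.Hom (L.obj X) Y)) ≫
        eComp V (L.obj X') (L.obj X) Y) ≫ (homIso X' Y).hom =
      (𝟙 (EnrichedCategory.Hom X' X) ⊗ₘ (homIso X Y).hom) ≫ eComp V X' X (R.obj Y)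
  naturality_right (X : C) (Y Y' : D) :
    eComp V (L.obj X) Y Y' ≫ (homIso X Y').hom =
      ((homIso X Y).hom ⊗ₘ R.map Y Y') ≫ eComp V X (R.obj Y) (R.obj Y')

/-- The unit `X ⟶ R (L X)` of a `V`-adjunction. -/
def EnrichedAdjunction.unit {L : EnrichedFunctor V C D} {R : EnrichedFunctor V D C}
    (adj : EnrichedAdjunction L R) (X : C) :
    𝟙_ V ⟶ EnrichedCategory.Hom X (R.obj (L.obj X)) :=
  eId V (L.obj X) ≫ (adj.homIso X (L.obj X)).hom

/-- Axiom A: whenever `A` is a `V`-category with a small set of objects and `Φ`-limits and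
`F : A → V` is `Φ`-continuous, the `V`-functor `F * - : [Aᵒᵖ, V] → V`, that is, the left Kan
extension of `F` along the Yoneda embedding, is `Φ`-continuous. -/
def AxiomA (Φ : WeightClass.{u, w, a} V) : Prop :=
  ∀ (A : Type u) [EnrichedCategory V A], IsComplete Φ A →
    ∀ F : EnrichedFunctor V A V, IsContinuous Φ F →
      ∀ (T : EnrichedFunctor V (EnrichedFunctor V Aᵒᵖ V) V)
        (η : GradedTrans (𝟙_ V) F ((yonedaFunctor A).comp V T)),
        IsLan (yonedaFunctor A) F T η → IsContinuous Φ T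

/-- Axiom B2: `K` has `Φ`-limits, and its Yoneda embedding into the `V`-category of small
presheaves has a `Φ`-continuous left adjoint. -/
def AxiomB2 (Φ : WeightClass.{u, w, a} V) (K : Type u₁) [EnrichedCategory V K] : Prop :=
  IsComplete Φ K ∧ ∃ L : EnrichedFunctor V (SmallPresheaf V K) K,
    Nonempty (EnrichedAdjunction L (smallYoneda K)) ∧ IsContinuous Φ L

/-- A model of the theory `A` in `K`: a `Φ`-continuous `V`-functor `A → K`. -/
structure Model (Φ : WeightClass.{u, w, a} V) (A : Type u) [EnrichedCategory V A]
    (K : Type u₁) [EnrichedCategory V K] where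
  /-- The underlying `V`-functor. -/
  functor : EnrichedFunctor V A K
  continuous : IsContinuous Φ functor

section Models

variable {Φ : WeightClass.{u, w, a} V} {A : Type u} [EnrichedCategory V A]
  {B : Type u} [EnrichedCategory V B] {K : Type u₁} [EnrichedCategory V K]

/-- The `V`-category `Φ-Cts(A, K)` of models, as a full subcategory of `[A, K]`. -/
instance modelCategory : EnrichedCategory V (Model Φ A K) :=
  enrichedOfFunctors Model.functor

/-- The `V`-natural transformation underlying a morphism of models. -/
def Model.trans {E : V} {M M' : Model Φ A K} (f : E ⟶ EnrichedCategory.Hom M M') :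
    GradedTrans E M.functor M'.functor :=
  (natHomπ M.functor M'.functor).precomp f

/-- Restriction of a transformation along a `V`-functor. -/
def GradedTrans.restrict {E : V} {M N : EnrichedFunctor V B K} (σ : GradedTrans E M N)
    (G : EnrichedFunctor V A B) : GradedTrans E (G.comp V M) (G.comp V N) where
  app a := σ.app (G.obj a)
  naturality a a' :=
    (congrArg ((β_ _ _).hom ≫ ·) (σ.nat' (G.map a a'))).trans (Iso.hom_inv_id_assoc _ _)

/-- The algebraic functor `G^* : Φ-Cts(B, K) → Φ-Cts(A, K)` of a `Φ`-continuous `G : A → B`,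
given by composition with `G`. -/
def algebraicFunctor (K : Type u₁) [EnrichedCategory V K] (G : EnrichedFunctor V A B)
    (hG : IsContinuous Φ G) : EnrichedFunctor V (Model Φ B K) (Model Φ A K) where
  obj M := ⟨G.comp V M.functor, hG.comp M.continuous⟩
  map M M' := natHomLift ((natHomπ M.functor M'.functor).restrict G)
  map_id M := by
    apply natHom_ext
    intro a
    refine (Category.assoc _ _ _).trans ?_
    refine (congrArg (eId V M ≫ ·) (natHomLift_π _ a)).trans ?_
    exact (natHomLift_π (GradedTrans.id M.functor) (G.obj a)).trans
      (natHomLift_π (GradedTrans.id (G.comp V M.functor)) a).symm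
  map_comp M M' M'' := by
    apply natHom_ext
    intro a
    refine (Category.assoc _ _ _).trans ?_
    refine (congrArg (eComp V M M' M'' ≫ ·) (natHomLift_π _ a)).trans ?_
    refine (natHomLift_π ((natHomπ M.functor M'.functor).comp (natHomπ M'.functor M''.functor))
      (G.obj a)).trans ?_
    refine Eq.trans ?_ (Category.assoc _ _ _).symm
    refine Eq.trans ?_ (congrArg (_ ≫ ·) (natHomLift_π ((natHomπ (G.comp V M.functor)
      (G.comp V M'.functor)).comp (natHomπ _ (G.comp V M''.functor))) a).symm)
    refine Eq.trans ?_ (comp_cmp (C := K) _ _ _ _).symm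
    exact congrArg₂ (cmp (C := K))
      (natHomLift_π ((natHomπ M.functor M'.functor).restrict G) a).symm
      (natHomLift_π ((natHomπ M'.functor M''.functor).restrict G) a).symm

end Models

end Main

end

end EnrichedLan

/-!
The proof computes with generalized elements of hom-objects: objects of `V`-natural transformations
are replaced by transformations graded by an object `E` of `V`, so that universal properties hold
whether or not the relevant ends exist.

*Values in `V`.* Colimits in `V` weighted by presheaves on a `V`-category with a small set of objects
are tensor products of modules, hence coequalizers of coproducts (`exists_isTensor`), so left Kan
extensions into `V` exist (`exists_isLan_self`). By the Yoneda lemma, `Lan_G M` is the composite of the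
nerve `B → [Aᵒᵖ, V]`, `b ↦ B(G -, b)`, with `Lan_Y M` (`exists_isLan_nerve_comp`). The nerve is
continuous because limits of presheaves are pointwise (`isWeightedLimit_of_evalAt`) and `B(G a, -)`
preserves limits; `Lan_Y M` is continuous by Axiom A.

*Values in `K`.* Left Kan extension of presheaves along `Mᵒᵖ` gives a `V`-functor from `[Aᵒᵖ, V]` to the
small presheaves on `K`. Composing it with the nerve of `G` gives `lanPresheaf M G`, which sends `b` to
`∫^a B(G a, b) ⊗ K(-, M a)`. Its evaluation at an object `k` is the left Kan extension along `G` of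
`K(k, M -)`, by symmetry of the tensor product (`IsTensor.swap`), and is therefore continuous by the
case of `V`; as limits of presheaves are pointwise, `lanPresheaf M G` is continuous. A left adjoint
of the Yoneda embedding sends a left Kan extension along `Mᵒᵖ` of a weight `W` to the colimit of `M`
weighted by `W` (`isWeightedColimit_of_isLan_op`), so its composite with `lanPresheaf M G` is `Lan_G M`
(`exists_isLan_lanPresheaf_comp`). Under Axiom B2 this adjoint is continuous, and so is the composite.

*Adjunction.* Pointwise left Kan extensions have the universal property
`[B, D](Lan_G M, S) ≅ [A, D](M, S G)` (`IsLan.existsUnique`, `IsLan.natHomIso`). Hence they form a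
`V`-functor (`lanFunctor`) and, when they preserve continuity, a left adjoint of composition with `G`
(`exists_adjunction_algebraicFunctor`).
-/

namespace EnrichedLan

set_option linter.unusedSectionVars false

noncomputable section

open Opposite

/-! ### Weighted colimits and tensor products of modules -/

section Calculus

variable {V : Type w} [Category.{u} V] [MonoidalCategory V] [SymmetricCategory V]

theorem braiding_comp_eq_iff {X Y Z : V} {q : X ⊗ Y ⟶ Z} {r : Y ⊗ X ⟶ Z} :
    (β_ Y X).hom ≫ q = r ↔ q = (β_ X Y).hom ≫ r := by
  rw [← cancel_epi (β_ X Y).hom, SymmetricCategory.symmetry_assoc]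

theorem braiding_shuffle (X Y Z : V) :
    (α_ X Y Z).hom ≫ X ◁ (β_ Y Z).hom =
      (β_ (X ⊗ Y) Z).hom ≫ Z ◁ (β_ X Y).hom ≫ (α_ Z Y X).inv ≫ (β_ (Z ⊗ Y) X).hom := by
  have h : (β_ (Z ⊗ Y) X).hom = (β_ X (Z ⊗ Y)).inv := by
    rw [← cancel_epi (β_ X (Z ⊗ Y)).hom, SymmetricCategory.symmetry, Iso.hom_inv_id]
  rw [h]
  simp [braiding_tensor_left_hom, braiding_tensor_right_inv]

/-- Compatibility with a left action, written with the parameter object on the right or on the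
left. -/
theorem action_comp_iff {H F F' E Z : V} (l : H ⊗ F ⟶ F') (s : F' ⊗ E ⟶ Z) (t : H ⊗ F ⊗ E ⟶ Z) :
    l ▷ E ≫ s = (α_ _ _ _).hom ≫ t ↔
      E ◁ ((β_ F H).hom ≫ l) ≫ (β_ E F').hom ≫ s =
        (α_ E F H).inv ≫ (β_ (E ⊗ F) H).hom ≫ H ◁ (β_ E F).hom ≫ t := by
  rw [← cancel_epi ((β_ (H ⊗ F) E).hom ≫ E ◁ (β_ H F).hom), Category.assoc, Category.assoc,
    ← MonoidalCategory.whiskerLeft_comp_assoc, SymmetricCategory.symmetry_assoc,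
    ← braiding_naturality_left_assoc, SymmetricCategory.symmetry_assoc]
  have h := braiding_shuffle H F E
  have h' : (β_ (H ⊗ F) E).hom ≫ E ◁ (β_ H F).hom ≫ (α_ E F H).inv ≫ (β_ (E ⊗ F) H).hom ≫
      H ◁ (β_ E F).hom ≫ t = ((α_ H F E).hom ≫ H ◁ (β_ F E).hom) ≫ H ◁ (β_ E F).hom ≫ t := by
    rw [h]; simp only [Category.assoc]
  rw [h', Category.assoc, ← MonoidalCategory.whiskerLeft_comp_assoc, SymmetricCategory.symmetry,
    MonoidalCategory.whiskerLeft_id, Category.id_comp]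

variable [MonoidalClosed V]
variable {C : Type u₁} [EnrichedCategory V C] {D : Type u₂} [EnrichedCategory V D]
  {J : Type u₃} [EnrichedCategory V J] {K : Type u₄} [EnrichedCategory V K]

/-- The left action `J(a', a) ⊗ F a ⟶ F a'` of the homs of `J` on a presheaf `F : Jᵒᵖ → V`. -/
def act (F : EnrichedFunctor V Jᵒᵖ V) (a' a : J) :
    (a' ⟶[V] a) ⊗ F.obj (op a) ⟶ F.obj (op a') :=
  (β_ _ _).hom ≫ MonoidalClosed.uncurry (F.map (op a) (op a'))

theorem uncurry_presheaf_map (F : EnrichedFunctor V Jᵒᵖ V) (a' a : J) :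
    MonoidalClosed.uncurry (F.map (op a) (op a')) =
      (β_ (F.obj (op a)) (a' ⟶[V] a)).hom ≫ act F a' a := by
  rw [act, SymmetricCategory.symmetry_assoc]

/-- Weighted colimits in `C`, without opposites: cocylinders `F a ⟶ C(R a, X)` are graded by an object
`E` on the right, and their naturality is expressed by the left action of `J` on `F`. -/
theorem isWeightedColimit_iff (F : EnrichedFunctor V Jᵒᵖ V) (R : EnrichedFunctor V J C) (L : C)
    (μ : ∀ j, F.obj (op j) ⟶ (R.obj j ⟶[V] L)) :
    IsWeightedColimit F R L μ ↔
      (∀ a' a, act F a' a ≫ μ a' = cmp (R.map a' a) (μ a)) ∧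
      ∀ (X : C) (E : V) (s : ∀ a, F.obj (op a) ⊗ E ⟶ (R.obj a ⟶[V] X)),
        (∀ a' a, act F a' a ▷ E ≫ s a' = (α_ _ _ _).hom ≫ cmp (R.map a' a) (s a)) →
        ∃! f : E ⟶ (L ⟶[V] X), ∀ a, cmp (μ a) f = s a := by
  have h1 (a' a : J) : (MonoidalClosed.uncurry (F.map (op a) (op a')) ≫ μ a' =
      cmp (C := Cᵒᵖ) (X := op L) (Y := op (R.obj a)) (Z := op (R.obj a')) (μ a) (R.map a' a)) ↔
      act F a' a ≫ μ a' = cmp (R.map a' a) (μ a) := by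
    rw [cmp_op, act, Category.assoc,
      ← cancel_epi (β_ (a' ⟶[V] a) (F.obj (op a))).hom, SymmetricCategory.symmetry_assoc]
  have h2 (X : C) (E : V) (s : ∀ a, F.obj (op a) ⊗ E ⟶ (R.obj a ⟶[V] X)) (a' a : J) :
      (act F a' a ▷ E ≫ s a' = (α_ _ _ _).hom ≫ cmp (R.map a' a) (s a)) ↔
      E ◁ MonoidalClosed.uncurry (F.map (op a) (op a')) ≫ (β_ _ _).hom ≫ s a' =
        (α_ E (F.obj (op a)) (a' ⟶[V] a)).inv ≫ cmp (C := Cᵒᵖ) (X := op X) (Y := op (R.obj a))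
          (Z := op (R.obj a')) ((β_ _ _).hom ≫ s a) (R.map a' a) := by
    rw [cmp_op, ← whiskerLeft_cmp, uncurry_presheaf_map]
    exact action_comp_iff _ _ _
  have h3 (X : C) (E : V) (f : E ⟶ (L ⟶[V] X)) (a : J) :
      cmp (C := Cᵒᵖ) (X := op X) (Y := op L) (Z := op (R.obj a)) f (μ a) =
        (β_ _ _).hom ≫ cmp (μ a) f := cmp_op _ _
  constructor
  · rintro ⟨hn, hu⟩
    refine ⟨fun a' a => (h1 a' a).1 (hn (op a) (op a')), fun X E s hs => ?_⟩
    obtain ⟨f, hf, huf⟩ := hu (op X) E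
      ⟨fun j => (β_ _ _).hom ≫ s j.unop, fun j j' => (h2 X E s j'.unop j.unop).1 (hs _ _)⟩
    have key (g : E ⟶ (L ⟶[V] X)) (a : J) : cmp (C := Cᵒᵖ) (X := op X) (Y := op L)
        (Z := op (R.obj a)) g (μ a) = (β_ _ _).hom ≫ s a ↔ cmp (μ a) g = s a := by
      rw [h3, cancel_epi]
    exact ⟨f, fun a => (key f a).1 (hf (op a)), fun g hg => huf g fun j => (key g j.unop).2 (hg _)⟩
  · rintro ⟨hn, hu⟩
    refine ⟨fun j j' => (h1 j'.unop j.unop).2 (hn _ _), fun X E σ => ?_⟩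
    have e (a : J) : (β_ E (F.obj (op a))).hom ≫ (β_ _ _).hom ≫ σ.app (op a) = σ.app (op a) :=
      SymmetricCategory.symmetry_assoc _ _ _
    have hs (a' a : J) := (h2 X.unop E (fun a => (β_ _ _).hom ≫ σ.app (op a)) a' a).2 (by
      refine (congrArg (E ◁ MonoidalClosed.uncurry (F.map (op a) (op a')) ≫ ·) (e a')).trans ?_
      refine (σ.naturality (op a) (op a')).trans ?_
      exact congrArg (fun t => _ ≫ cmp (C := Cᵒᵖ) t _) (e a).symm)
    obtain ⟨f, hf, huf⟩ := hu X.unop E _ hs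
    have key (g : E ⟶ (L ⟶[V] X.unop)) (a : J) : cmp (C := Cᵒᵖ) (X := X) (Y := op L)
        (Z := op (R.obj a)) g (μ a) = σ.app (op a) ↔
          cmp (μ a) g = (β_ _ _).hom ≫ σ.app (op a) := by
      exact (Eq.congr_left (h3 _ _ _ _)).trans braiding_comp_eq_iff
    exact ⟨f, fun j => (key f j.unop).2 (hf _), fun g hg => huf g fun a => (key g a).1 (hg (op a))⟩

/-- Currying of the right-hand tensor factor. -/
def rcurry (X E Y : V) : (X ⊗ E ⟶ Y) ≃ (X ⟶ (ihom E).obj Y) where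
  toFun t := MonoidalClosed.curry ((β_ E X).hom ≫ t)
  invFun t := (β_ X E).hom ≫ MonoidalClosed.uncurry t
  left_inv t := by dsimp only; rw [MonoidalClosed.uncurry_curry, SymmetricCategory.symmetry_assoc]
  right_inv t := by dsimp only; rw [SymmetricCategory.symmetry_assoc, MonoidalClosed.curry_uncurry]

theorem rcurry_whiskerRight_comp {X X' E Y : V} (p : X' ⟶ X) (t : X ⊗ E ⟶ Y) :
    rcurry X' E Y (p ▷ E ≫ t) = p ≫ rcurry X E Y t := by
  change MonoidalClosed.curry _ = p ≫ MonoidalClosed.curry _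
  rw [← MonoidalClosed.curry_natural_left, braiding_naturality_right_assoc]

/-- `ν` exhibits `L` as the tensor product of the right module `R` and the left module `F`, for
actions of a family `H` of objects of `V`: it is the universal balanced family `R a ⊗ F a ⟶ L`. -/
structure IsTensor {ι : Type u₃} {R F : ι → V} {H : ι → ι → V} (r : ∀ a' a, R a' ⊗ H a' a ⟶ R a)
    (l : ∀ a' a, H a' a ⊗ F a ⟶ F a') (L : V) (ν : ∀ a, R a ⊗ F a ⟶ L) : Prop where
  balanced (a' a : ι) : R a' ◁ l a' a ≫ ν a' = (α_ _ _ _).inv ≫ r a' a ▷ F a ≫ ν a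
  existsUnique (X : V) (t : ∀ a, R a ⊗ F a ⟶ X) :
    (∀ a' a, R a' ◁ l a' a ≫ t a' = (α_ _ _ _).inv ≫ r a' a ▷ F a ≫ t a) →
      ∃! g : L ⟶ X, ∀ a, ν a ≫ g = t a

/-- Factorization of an `E`-graded cocylinder with values in `V`, transposed to a factorization of
the family `R a ⊗ F a ⟶ [E, X]`. -/
theorem cmp_self_eq_iff {R F L E X : V} (μ : F ⟶ (ihom R).obj L) (f : E ⟶ (ihom L).obj X)
    (s : F ⊗ E ⟶ (ihom R).obj X) :
    cmp (C := V) (X := R) (Y := L) (Z := X) μ f = s ↔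
      MonoidalClosed.uncurry μ ≫ rcurry L E X (MonoidalClosed.uncurry f) =
        rcurry _ E X ((α_ R F E).hom ≫ MonoidalClosed.uncurry s) := by
  rw [← rcurry_whiskerRight_comp, (rcurry _ _ _).injective.eq_iff, ← Iso.inv_comp_eq,
    ← MonoidalClosed.uncurry_injective.eq_iff]
  exact Eq.congr_left (uncurry_cmp μ f)

/-- Naturality of an `E`-graded cocylinder with values in `V` is balancedness of the family
`R a ⊗ F a ⟶ [E, X]` obtained from it by transposition. -/
theorem balanced_graded_iff {R R' F F' H X E : V} (r : H ⟶ (ihom R').obj R) (l : H ⊗ F ⟶ F')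
    (s' : F' ⊗ E ⟶ (ihom R').obj X) (s : F ⊗ E ⟶ (ihom R).obj X) :
    (l ▷ E ≫ s' = (α_ _ _ _).hom ≫ cmp (C := V) (X := R') (Y := R) (Z := X) r s) ↔
      R' ◁ l ≫ rcurry _ E X ((α_ R' F' E).hom ≫ MonoidalClosed.uncurry s') =
        (α_ _ _ _).inv ≫ MonoidalClosed.uncurry r ▷ F ≫
          rcurry _ E X ((α_ R F E).hom ≫ MonoidalClosed.uncurry s) := by
  rw [← rcurry_whiskerRight_comp, ← rcurry_whiskerRight_comp, ← rcurry_whiskerRight_comp,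
    (rcurry _ _ _).injective.eq_iff, ← MonoidalClosed.uncurry_injective.eq_iff,
    MonoidalClosed.uncurry_natural_left, ← cancel_epi (α_ R' (H ⊗ F) E).hom]
  refine Eq.congr (by simp) ?_
  rw [MonoidalClosed.uncurry_natural_left]
  refine (congrArg (fun t => _ ≫ _ ≫ t) (uncurry_cmp r s)).trans ?_
  simp

/-- A colimit weighted by `F` of a `V`-functor `R` with values in `V` is a tensor product of `R` and
`F`: test against cocylinders graded by the unit object. -/
theorem isTensor_of_isWeightedColimit {F : EnrichedFunctor V Jᵒᵖ V} {R : EnrichedFunctor V J V}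
    {L : V} {μ : ∀ j, F.obj (op j) ⟶ (ihom (R.obj j)).obj L} (h : IsWeightedColimit F R L μ) :
    IsTensor (R := R.obj) (F := fun a => F.obj (op a))
      (fun a' a => MonoidalClosed.uncurry (R.map a' a)) (act F) L
      (fun a => MonoidalClosed.uncurry (μ a)) := by
  obtain ⟨hb, hu⟩ := (isWeightedColimit_iff F R L μ).1 h
  refine ⟨fun a' a => ?_, fun X t ht => ?_⟩
  · refine (MonoidalClosed.uncurry_natural_left _ _).symm.trans
      ((congrArg MonoidalClosed.uncurry (hb a' a)).trans ?_)
    exact uncurry_cmp (R.map a' a) (μ a)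
  · -- ungraded maps into `X` are maps graded by the unit object
    have hi {Y : V} (g : Y ⟶ X) : rcurry Y (𝟙_ V) X ((ρ_ Y).hom ≫ g) =
        g ≫ rcurry X (𝟙_ V) X (ρ_ X).hom := by
      rw [← rcurry_whiskerRight_comp, rightUnitor_naturality]
    have hinj {Y : V} {g g' : Y ⟶ X} : g ≫ rcurry X (𝟙_ V) X (ρ_ X).hom =
        g' ≫ rcurry X (𝟙_ V) X (ρ_ X).hom ↔ g = g' := by
      rw [← hi, ← hi, (rcurry _ _ _).injective.eq_iff, cancel_epi]
    let s (a : J) : F.obj (op a) ⊗ 𝟙_ V ⟶ (ihom (R.obj a)).obj X :=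
      MonoidalClosed.curry (R.obj a ◁ (ρ_ _).hom ≫ t a)
    have hs (a : J) : rcurry _ (𝟙_ V) X ((α_ _ _ _).hom ≫ MonoidalClosed.uncurry (s a)) =
        t a ≫ rcurry X (𝟙_ V) X (ρ_ X).hom := by
      rw [← hi, MonoidalClosed.uncurry_curry]
      simp
    have key (g : L ⟶ X) (a : J) : cmp (C := V) (X := R.obj a) (Y := L) (Z := X) (μ a)
        (MonoidalClosed.curry ((ρ_ L).hom ≫ g)) = s a ↔ MonoidalClosed.uncurry (μ a) ≫ g = t a := by
      rw [cmp_self_eq_iff, hs, MonoidalClosed.uncurry_curry, hi, ← Category.assoc, hinj]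
    obtain ⟨f, hf, huf⟩ := hu X (𝟙_ V) s (fun a' a => (balanced_graded_iff _ _ _ _).2 (by
      rw [hs, hs, ← Category.assoc, ht a' a]
      simp only [Category.assoc]))
    have hf' : f = MonoidalClosed.curry ((ρ_ L).hom ≫ (ρ_ L).inv ≫ MonoidalClosed.uncurry f) := by
      rw [Iso.hom_inv_id_assoc]
      exact (MonoidalClosed.curry_uncurry f).symm
    refine ⟨(ρ_ L).inv ≫ MonoidalClosed.uncurry f, fun a => ?_, fun g hg => ?_⟩
    · rw [← key, ← hf']
      exact hf a
    · rw [Iso.eq_inv_comp, ← huf _ fun a => (key g a).2 (hg a)]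
      exact (MonoidalClosed.uncurry_curry _).symm

/-- A tensor product of `R` and `F` is a colimit weighted by `F`, for the universal property graded
by `E` with target `X` is the ungraded one with target `[E, X]`. -/
theorem IsTensor.isWeightedColimit {F : EnrichedFunctor V Jᵒᵖ V} {R : EnrichedFunctor V J V}
    {L : V} {μ : ∀ j, F.obj (op j) ⟶ (ihom (R.obj j)).obj L}
    (h : IsTensor (R := R.obj) (F := fun a => F.obj (op a))
      (fun a' a => MonoidalClosed.uncurry (R.map a' a)) (act F) L
      (fun a => MonoidalClosed.uncurry (μ a))) : IsWeightedColimit F R L μ := by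
  rw [isWeightedColimit_iff]
  refine ⟨fun a' a => ?_, fun X E s hs => ?_⟩
  · apply MonoidalClosed.uncurry_injective
    refine (MonoidalClosed.uncurry_natural_left _ _).trans ((h.balanced a' a).trans ?_)
    exact (uncurry_cmp (R.map a' a) (μ a)).symm
  · obtain ⟨g, hg, hu⟩ := h.existsUnique ((ihom E).obj X)
      (fun a => rcurry _ E X ((α_ _ _ E).hom ≫ MonoidalClosed.uncurry (s a)))
      (fun a' a => (balanced_graded_iff _ _ _ _).1 (hs a' a))
    refine ⟨MonoidalClosed.curry ((rcurry _ _ _).symm g), fun a => ?_, fun f hf => ?_⟩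
    · refine (cmp_self_eq_iff _ _ _).2 ?_
      rw [MonoidalClosed.uncurry_curry, Equiv.apply_symm_apply]
      exact hg a
    · rw [← hu (rcurry _ _ _ (MonoidalClosed.uncurry f)) fun a => (cmp_self_eq_iff _ _ _).1 (hf a),
        Equiv.symm_apply_apply]
      exact (MonoidalClosed.curry_uncurry _).symm

/-- Tensor products of modules are symmetric: exchange the roles of the two modules, reversing the
direction of the actions. -/
theorem IsTensor.swap {ι : Type u₃} {R F : ι → V} {H : ι → ι → V}
    {r : ∀ a' a, R a' ⊗ H a' a ⟶ R a} {l : ∀ a' a, H a' a ⊗ F a ⟶ F a'} {L : V}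
    {ν : ∀ a, R a ⊗ F a ⟶ L} (h : IsTensor r l L ν) :
    IsTensor (R := F) (F := R) (H := fun a' a => H a a') (fun a' a => (β_ _ _).hom ≫ l a a')
      (fun a' a => (β_ _ _).hom ≫ r a a') L (fun a => (β_ _ _).hom ≫ ν a) := by
  have key (X : V) (t : ∀ a, R a ⊗ F a ⟶ X) (a' a : ι) :
      (F a ◁ ((β_ _ _).hom ≫ r a' a) ≫ (β_ _ _).hom ≫ t a =
        (α_ _ _ _).inv ≫ ((β_ _ _).hom ≫ l a' a) ▷ R a' ≫ (β_ _ _).hom ≫ t a') ↔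
      R a' ◁ l a' a ≫ t a' = (α_ _ _ _).inv ≫ r a' a ▷ F a ≫ t a := by
    -- the two braidings reversing `F a ⊗ H a' a ⊗ R a'` agree
    have c : F a ◁ (β_ (H a' a) (R a')).hom ≫ (β_ (F a) (R a' ⊗ H a' a)).hom ≫ (α_ _ _ _).hom =
        (α_ _ _ _).inv ≫ (β_ (F a) (H a' a)).hom ▷ R a' ≫ (β_ (H a' a ⊗ F a) (R a')).hom := by
      simpa [braiding_tensor_left_hom, braiding_tensor_right_hom] using
        (yang_baxter (F a) (H a' a) (R a')).symm
    rw [MonoidalCategory.whiskerLeft_comp_assoc, MonoidalCategory.comp_whiskerRight_assoc,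
      braiding_naturality_right_assoc, braiding_naturality_left_assoc,
      ← cancel_epi ((α_ _ _ _).inv ≫ (β_ (F a) (H a' a)).hom ▷ R a' ≫
        (β_ (H a' a ⊗ F a) (R a')).hom), eq_comm]
    refine Eq.congr (by simp only [Category.assoc]) ?_
    rw [← c]
    simp
  refine ⟨fun a' a => (key L ν a a').2 (h.balanced a a'), fun X t ht => ?_⟩
  have e (a : ι) : (β_ (F a) (R a)).hom ≫ (β_ _ _).hom ≫ t a = t a :=
    SymmetricCategory.symmetry_assoc _ _ _
  obtain ⟨g, hg, hu⟩ := h.existsUnique X (fun a => (β_ _ _).hom ≫ t a)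
    fun a' a => (key X (fun a => (β_ _ _).hom ≫ t a) a' a).1 (by
      rw [e, e]; exact ht a a')
  exact ⟨g, fun a => by rw [Category.assoc, hg, e],
    fun f hf => hu f fun a => by rw [← hf, Category.assoc, SymmetricCategory.symmetry_assoc]⟩

/-- Tensor products of small families of modules exist, as coequalizers of coproducts. -/
theorem exists_isTensor [HasColimits V] {ι : Type u} {R F : ι → V} {H : ι → ι → V}
    (r : ∀ a' a, R a' ⊗ H a' a ⟶ R a) (l : ∀ a' a, H a' a ⊗ F a ⟶ F a') :
    ∃ (L : V) (ν : ∀ a, R a ⊗ F a ⟶ L), IsTensor r l L ν := by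
  let p : (∐ fun q : ι × ι => R q.1 ⊗ H q.1 q.2 ⊗ F q.2) ⟶ ∐ fun a => R a ⊗ F a :=
    Sigma.desc fun q => R q.1 ◁ l q.1 q.2 ≫ Sigma.ι (fun a => R a ⊗ F a) q.1
  let p' : (∐ fun q : ι × ι => R q.1 ⊗ H q.1 q.2 ⊗ F q.2) ⟶ ∐ fun a => R a ⊗ F a :=
    Sigma.desc fun q => (α_ _ _ _).inv ≫ r q.1 q.2 ▷ F q.2 ≫ Sigma.ι (fun a => R a ⊗ F a) q.2
  have key (X : V) (t : (∐ fun a => R a ⊗ F a) ⟶ X) : p ≫ t = p' ≫ t ↔ ∀ a' a,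
      R a' ◁ l a' a ≫ Sigma.ι (fun a => R a ⊗ F a) a' ≫ t =
        (α_ _ _ _).inv ≫ r a' a ▷ F a ≫ Sigma.ι (fun a => R a ⊗ F a) a ≫ t := by
    constructor
    · intro h a' a
      have := congrArg (Sigma.ι (fun q : ι × ι => R q.1 ⊗ H q.1 q.2 ⊗ F q.2) (a', a) ≫ ·) h
      simpa [p, p'] using this
    · intro h
      apply Sigma.hom_ext
      intro q
      simpa [p, p'] using h q.1 q.2
  refine ⟨coequalizer p p', fun a => Sigma.ι (fun a => R a ⊗ F a) a ≫ coequalizer.π p p',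
    (key _ _).1 (coequalizer.condition p p'), fun X t ht => ?_⟩
  refine ⟨coequalizer.desc (Sigma.desc t) ((key _ _).2 (by simpa using ht)), fun a => by simp,
    fun f hf => ?_⟩
  apply coequalizer.hom_ext
  apply Sigma.hom_ext
  intro a
  simpa using hf a

end Calculus

/-! ### Pointwise left Kan extensions and their universal property -/

section KanExtensions

variable {V : Type w} [Category.{u} V] [MonoidalCategory V] [SymmetricCategory V]
  [MonoidalClosed V]
variable {A : Type u₁} [EnrichedCategory V A] {B : Type u₂} [EnrichedCategory V B]
  {K : Type u₄} [EnrichedCategory V K]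

theorem act_weight (G : EnrichedFunctor V A B) (b : B) (a' a : A) :
    act ((opFunctor G).comp V (rep b)) a' a = cmp (G.map a' a) (𝟙 (G.obj a ⟶[V] b)) := by
  refine (congrArg ((β_ _ _).hom ≫ ·) (uncurry_weight (G := G) b a a')).trans ?_
  exact SymmetricCategory.symmetry_assoc _ _ _

theorem whiskerLeft_cmp_assoc {E E' A' T : V} {X Y Z : K} (q : A' ⟶ E')
    (f : E ⟶ (X ⟶[V] Y)) (g : E' ⟶ (Y ⟶[V] Z)) (t : (X ⟶[V] Z) ⟶ T) :
    E ◁ q ≫ cmp f g ≫ t = cmp f (q ≫ g) ≫ t := by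
  rw [← Category.assoc, whiskerLeft_cmp]

theorem whiskerRight_cmp_assoc {E E' A' T : V} {X Y Z : K} (p : A' ⟶ E)
    (f : E ⟶ (X ⟶[V] Y)) (g : E' ⟶ (Y ⟶[V] Z)) (t : (X ⟶[V] Z) ⟶ T) :
    p ▷ E' ≫ cmp f g ≫ t = cmp (p ≫ f) g ≫ t := by
  rw [← Category.assoc, whiskerRight_cmp]

/-- The universal property of the colimit defining the value at `b` of a left Kan extension. -/
theorem isWeightedColimit_lan_iff {G : EnrichedFunctor V A B} {M : EnrichedFunctor V A K} {b : B}
    {L : K} {μ : ∀ a, (G.obj a ⟶[V] b) ⟶ (M.obj a ⟶[V] L)} :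
    IsWeightedColimit ((opFunctor G).comp V (rep b)) M L μ ↔
      (∀ a' a, cmp (G.map a' a) (𝟙 (G.obj a ⟶[V] b)) ≫ μ a' = cmp (M.map a' a) (μ a)) ∧
      ∀ (X : K) (E : V) (s : ∀ a, (G.obj a ⟶[V] b) ⊗ E ⟶ (M.obj a ⟶[V] X)),
        (∀ a' a, cmp (G.map a' a) (𝟙 (G.obj a ⟶[V] b)) ▷ E ≫ s a' =
          (α_ _ _ _).hom ≫ cmp (M.map a' a) (s a)) →
        ∃! f : E ⟶ (L ⟶[V] X), ∀ a, cmp (μ a) f = s a := by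
  refine (isWeightedColimit_iff ((opFunctor G).comp V (rep b)) M L μ).trans (and_congr ?_ ?_)
  · exact forall₂_congr fun a' a => Eq.congr_left (congrArg (· ≫ μ a') (act_weight G b a' a))
  · exact forall₃_congr fun X E s => imp_congr_left (forall₂_congr fun a' a =>
      Eq.congr_left (congrArg (fun t => t ▷ E ≫ s a') (act_weight G b a' a)))

theorem IsWeightedColimit.hom_ext {J : Type u₃} [EnrichedCategory V J]
    {F : EnrichedFunctor V Jᵒᵖ V} {R : EnrichedFunctor V J K}
    {L : K} {μ : ∀ j, F.obj (op j) ⟶ (R.obj j ⟶[V] L)} (h : IsWeightedColimit F R L μ) {X : K}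
    {E : V} {f g : E ⟶ (L ⟶[V] X)} (hfg : ∀ j, cmp (μ j) f = cmp (μ j) g) : f = g := by
  obtain ⟨hn, hu⟩ := (isWeightedColimit_iff F R L μ).1 h
  refine (hu X E (fun j => cmp (μ j) f) (fun a' a => ?_)).unique (fun _ => rfl)
    (fun j => (hfg j).symm)
  rw [whiskerRight_cmp, hn, cmp_assoc]

section

variable {G : EnrichedFunctor V A B} {M : EnrichedFunctor V A K}

/-- A `V`-functor `N` with a colimit cocylinder `B(G a, b) ⟶ K(M a, N b)` for each `b`, natural in `b`,
is a left Kan extension; the unit is obtained by evaluating at identities. -/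
theorem exists_isLan_of_cylinder (N : EnrichedFunctor V B K)
    (ν : ∀ b a, (G.obj a ⟶[V] b) ⟶ (M.obj a ⟶[V] N.obj b))
    (hν : ∀ a b b', cmp (ν b a) (N.map b b') = eComp V (G.obj a) b b' ≫ ν b' a)
    (hcol : ∀ b, IsWeightedColimit ((opFunctor G).comp V (rep b)) M (N.obj b) (ν b)) :
    ∃ η : GradedTrans (𝟙_ V) M (G.comp V N), IsLan G M N η := by
  have hact (b : B) (a' a : A) : cmp (G.map a' a) (𝟙 (G.obj a ⟶[V] b)) ≫ ν b a' =
      cmp (M.map a' a) (ν b a) :=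
    (isWeightedColimit_lan_iff.1 (hcol b)).1 a' a
  let η : GradedTrans (𝟙_ V) M (G.comp V N) :=
    { app := fun a => eId V (G.obj a) ≫ ν (G.obj a) a
      naturality := fun a a' => by
        change (β_ (𝟙_ V) (a ⟶[V] a')).hom ≫ cmp (Z := N.obj (G.obj a')) (M.map a a')
            (eId V (G.obj a') ≫ ν (G.obj a') a') =
          cmp (Z := N.obj (G.obj a')) (eId V (G.obj a) ≫ ν (G.obj a) a)
            (G.map a a' ≫ N.map (G.obj a) (G.obj a'))
        rw [← whiskerLeft_cmp, ← hact, whiskerLeft_cmp_assoc, Category.comp_id, cmp_id,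
          ← whiskerRight_cmp, ← whiskerLeft_cmp, hν, eComp_eq_cmp, whiskerLeft_cmp_assoc,
          whiskerRight_cmp_assoc, Category.comp_id, Category.comp_id, id_cmp]
        simp }
  have hη (b : B) (a : A) : lanCylinder η b a = ν b a := by
    rw [lanCylinder_eq]
    change _ ≫ cmp (eId V (G.obj a) ≫ ν (G.obj a) a) _ = _
    rw [← whiskerRight_cmp, hν, eComp_eq_cmp, whiskerRight_cmp_assoc, Category.comp_id, id_cmp]
    simp
  refine ⟨η, fun b => ?_⟩
  rw [show lanCylinder η b = ν b from funext (hη b)]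
  exact hcol b

/-- `IsWeightedColimit.hom_ext` for the weight `B(G -, b)`, with unfolded types. -/
theorem lan_colimit_hom_ext {b : B} {L : K} {μ : ∀ a, (G.obj a ⟶[V] b) ⟶ (M.obj a ⟶[V] L)}
    (h : IsWeightedColimit ((opFunctor G).comp V (rep b)) M L μ) {X : K} {E : V}
    {f g : E ⟶ (L ⟶[V] X)} (hfg : ∀ a, cmp (μ a) f = cmp (μ a) g) : f = g :=
  h.hom_ext hfg

/-- Left Kan extensions exist as soon as the colimits that define their values do. -/
theorem exists_isLan (hcol : ∀ b, ∃ (L : K) (μ : ∀ a, (G.obj a ⟶[V] b) ⟶ (M.obj a ⟶[V] L)),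
      IsWeightedColimit ((opFunctor G).comp V (rep b)) M L μ) :
    ∃ (N : EnrichedFunctor V B K) (η : GradedTrans (𝟙_ V) M (G.comp V N)), IsLan G M N η := by
  choose L μ h using hcol
  have hact (b : B) (a' a : A) : cmp (G.map a' a) (𝟙 (G.obj a ⟶[V] b)) ≫ μ b a' =
      cmp (M.map a' a) (μ b a) :=
    (isWeightedColimit_lan_iff.1 (h b)).1 a' a
  have ex (b b' : B) : ∃ f : (b ⟶[V] b') ⟶ (L b ⟶[V] L b'),
      ∀ a, cmp (μ b a) f = eComp V (G.obj a) b b' ≫ μ b' a := by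
    refine ((isWeightedColimit_lan_iff.1 (h b)).2 (L b') (b ⟶[V] b')
      (fun a => eComp V (G.obj a) b b' ≫ μ b' a) (fun a' a => ?_)).exists
    rw [← whiskerLeft_cmp, ← hact, whiskerLeft_cmp_assoc, eComp_eq_cmp,
      whiskerRight_cmp_assoc, Category.comp_id, Category.comp_id]
    rw [eComp_eq_cmp, ← Category.assoc, ← cmp_assoc]
  choose f hf using ex
  let N : EnrichedFunctor V B K :=
    { obj := L
      map := f
      map_id := fun b => lan_colimit_hom_ext (h b) fun a => ?_
      map_comp := fun b b' b'' => lan_colimit_hom_ext (h b) fun a => ?_ }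
  · exact ⟨N, exists_isLan_of_cylinder N μ (fun a b b' => hf b b' a) h⟩
  · rw [← whiskerLeft_cmp, hf, cmp_id, eComp_eq_cmp, whiskerLeft_cmp_assoc, Category.comp_id,
      cmp_id, Category.assoc, Category.id_comp]
  · change _ = cmp _ (cmp _ _)
    rw [← whiskerLeft_cmp, hf, cmp_assoc', hf, ← whiskerRight_cmp, hf]
    simp only [eComp_eq_cmp, whiskerLeft_cmp_assoc, whiskerRight_cmp_assoc, Category.comp_id]
    rw [cmp_assoc', Category.assoc]

theorem GradedTrans.ext_app {E : V} {F G : EnrichedFunctor V B K} {σ τ : GradedTrans E F G}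
    (h : ∀ c, σ.app c = τ.app c) : σ = τ := by
  cases σ; cases τ; congr; exact funext h

/-- The universal property of left Kan extensions, for graded transformations. -/
theorem IsLan.existsUnique {N : EnrichedFunctor V B K} {η : GradedTrans (𝟙_ V) M (G.comp V N)}
    (h : IsLan G M N η) (S : EnrichedFunctor V B K) {E : V} (σ : GradedTrans E M (G.comp V S)) :
    ∃! τ : GradedTrans E N S, ∀ a, (λ_ E).inv ≫ cmp (η.at a) (τ.app (G.obj a)) = σ.at a := by
  have hlan (τ : GradedTrans E N S) (b : B) (a : A) :
      (β_ _ _).hom ≫ cmp (lanCylinder η b a) (τ.app b) =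
        cmp ((λ_ E).inv ≫ cmp (η.at a) (τ.app (G.obj a))) (S.map (G.obj a) b) := by
    rw [lanCylinder_eq, ← whiskerRight_cmp, ← whiskerRight_cmp, cmp_assoc, cmp_assoc, ← τ.nat,
      ← whiskerLeft_cmp]
    simp
  obtain ⟨τ, hτ⟩ := lan_extend h S σ.at σ.nat_at
  refine ⟨τ, fun a => ?_, fun ρ hρ => GradedTrans.ext_app fun b => lan_hom_ext h fun a => ?_⟩
  · have h1 := congrArg (fun t => (ρ_ _).inv ≫ _ ◁ eId V (G.obj a) ≫ t)
      ((hlan τ (G.obj a) a).symm.trans (hτ a (G.obj a)))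
    simpa only [whiskerLeft_cmp, S.map_id, cmp_id, Iso.inv_hom_id_assoc] using h1
  · rw [← cancel_epi (β_ _ _).hom, hlan, hτ, hρ]

/-- Restriction of a graded transformation along a `V`-functor between arbitrary `V`-categories. -/
def GradedTrans.whisker {E : V} {N S : EnrichedFunctor V B K} (τ : GradedTrans E N S)
    (G : EnrichedFunctor V A B) : GradedTrans E (G.comp V N) (G.comp V S) where
  app a := τ.app (G.obj a)
  naturality a a' :=
    (congrArg ((β_ _ _).hom ≫ ·) (τ.nat' (G.map a a'))).trans (Iso.hom_inv_id_assoc _ _)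

theorem IsLan.trans_ext {N : EnrichedFunctor V B K} {η : GradedTrans (𝟙_ V) M (G.comp V N)}
    (h : IsLan G M N η) {S : EnrichedFunctor V B K} {E : V} {τ τ' : GradedTrans E N S}
    (hτ : ∀ a, cmp (η.at a) (τ.app (G.obj a)) = cmp (η.at a) (τ'.app (G.obj a))) : τ = τ' :=
  (h.existsUnique S ((GradedTrans.comp (G := G.comp V N) (H := G.comp V S) η
    (τ.whisker G)).precomp (λ_ E).inv)).unique (fun _ => rfl)
    fun a => congrArg ((λ_ E).inv ≫ ·) (hτ a).symm

end

end KanExtensions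

/-! ### Composition with unit-graded elements -/

section UnitElements

variable {V : Type w} [Category.{u} V] [MonoidalCategory V]
variable {C : Type u₁} [EnrichedCategory V C]

/-- Composition of a generalized element of a hom-object with a morphism after it. -/
def post {E : V} {X Y Z : C} (f : E ⟶ (X ⟶[V] Y)) (t : 𝟙_ V ⟶ (Y ⟶[V] Z)) : E ⟶ (X ⟶[V] Z) :=
  (ρ_ E).inv ≫ cmp f t

/-- Composition of a generalized element of a hom-object with a morphism before it. -/
def pre {E : V} {X Y Z : C} (t : 𝟙_ V ⟶ (X ⟶[V] Y)) (f : E ⟶ (Y ⟶[V] Z)) : E ⟶ (X ⟶[V] Z) :=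
  (λ_ E).inv ≫ cmp t f

theorem comp_post {E E' : V} {X Y Z : C} (p : E' ⟶ E) (f : E ⟶ (X ⟶[V] Y))
    (t : 𝟙_ V ⟶ (Y ⟶[V] Z)) : p ≫ post f t = post (p ≫ f) t := by
  rw [post, post, ← whiskerRight_cmp, rightUnitor_inv_naturality_assoc]

theorem comp_pre {E E' : V} {X Y Z : C} (p : E' ⟶ E) (t : 𝟙_ V ⟶ (X ⟶[V] Y))
    (f : E ⟶ (Y ⟶[V] Z)) : p ≫ pre t f = pre t (p ≫ f) := by
  rw [pre, pre, ← whiskerLeft_cmp, leftUnitor_inv_naturality_assoc]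

theorem post_eId {E : V} {X Y : C} (f : E ⟶ (X ⟶[V] Y)) : post f (eId V Y) = f := by
  rw [post, cmp_id, Iso.inv_hom_id_assoc]

theorem pre_eId {E : V} {X Y : C} (f : E ⟶ (X ⟶[V] Y)) : pre (eId V X) f = f := by
  rw [pre, id_cmp, Iso.inv_hom_id_assoc]

theorem eId_post {X Y : C} (t : 𝟙_ V ⟶ (X ⟶[V] Y)) : post (eId V X) t = t := by
  rw [post, id_cmp, ← unitors_inv_equal, Iso.inv_hom_id_assoc]

theorem eId_pre {X Y : C} (t : 𝟙_ V ⟶ (X ⟶[V] Y)) : pre t (eId V Y) = t := by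
  rw [pre, cmp_id, unitors_inv_equal, Iso.inv_hom_id_assoc]

theorem post_eq_pre {X Y Z : C} (s : 𝟙_ V ⟶ (X ⟶[V] Y)) (t : 𝟙_ V ⟶ (Y ⟶[V] Z)) :
    post s t = pre s t := by
  rw [post, pre, unitors_inv_equal]

theorem post_post {E : V} {W X Y Z : C} (f : E ⟶ (W ⟶[V] X)) (s : 𝟙_ V ⟶ (X ⟶[V] Y))
    (t : 𝟙_ V ⟶ (Y ⟶[V] Z)) : post (post f s) t = post f (post s t) := by
  rw [post, post, post, post, ← whiskerRight_cmp, ← whiskerLeft_cmp, cmp_assoc]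
  simp

theorem pre_pre {E : V} {W X Y Z : C} (s : 𝟙_ V ⟶ (W ⟶[V] X)) (t : 𝟙_ V ⟶ (X ⟶[V] Y))
    (f : E ⟶ (Y ⟶[V] Z)) : pre s (pre t f) = pre (pre s t) f := by
  rw [pre, pre, pre, pre, ← whiskerRight_cmp, ← whiskerLeft_cmp, cmp_assoc']
  simp

theorem pre_post {E : V} {W X Y Z : C} (s : 𝟙_ V ⟶ (W ⟶[V] X)) (f : E ⟶ (X ⟶[V] Y))
    (t : 𝟙_ V ⟶ (Y ⟶[V] Z)) : pre s (post f t) = post (pre s f) t := by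
  rw [post, pre, post, pre, ← whiskerRight_cmp, ← whiskerLeft_cmp, cmp_assoc']
  simp

theorem cmp_post {E E' : V} {W X Y Z : C} (f : E ⟶ (W ⟶[V] X)) (g : E' ⟶ (X ⟶[V] Y))
    (t : 𝟙_ V ⟶ (Y ⟶[V] Z)) : cmp f (post g t) = post (cmp f g) t := by
  rw [post, post, ← whiskerLeft_cmp, cmp_assoc]
  simp

theorem pre_cmp {E E' : V} {W X Y Z : C} (t : 𝟙_ V ⟶ (W ⟶[V] X)) (f : E ⟶ (X ⟶[V] Y))
    (g : E' ⟶ (Y ⟶[V] Z)) : cmp (pre t f) g = pre t (cmp f g) := by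
  rw [pre, pre, ← whiskerRight_cmp, cmp_assoc]
  simp

theorem post_cmp {E E' : V} {W X Y Z : C} (f : E ⟶ (W ⟶[V] X)) (t : 𝟙_ V ⟶ (X ⟶[V] Y))
    (g : E' ⟶ (Y ⟶[V] Z)) : cmp (post f t) g = cmp f (pre t g) := by
  rw [pre, post, ← whiskerRight_cmp, ← whiskerLeft_cmp, cmp_assoc]
  simp

variable {D : Type u₂} [EnrichedCategory V D]

theorem post_map (N : EnrichedFunctor V C D) {E : V} {X Y Z : C} (f : E ⟶ (X ⟶[V] Y))
    (t : 𝟙_ V ⟶ (Y ⟶[V] Z)) : post f t ≫ N.map X Z = post (f ≫ N.map X Y) (t ≫ N.map Y Z) := by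
  rw [post, post, Category.assoc, cmp_map]

theorem pre_map (N : EnrichedFunctor V C D) {E : V} {X Y Z : C} (t : 𝟙_ V ⟶ (X ⟶[V] Y))
    (f : E ⟶ (Y ⟶[V] Z)) : pre t f ≫ N.map X Z = pre (t ≫ N.map X Y) (f ≫ N.map Y Z) := by
  rw [pre, pre, Category.assoc, cmp_map]

/-- Naturality of a unit-graded transformation on generalized elements. -/
theorem GradedTrans.post_app [BraidedCategory V] {N N' : EnrichedFunctor V C D}
    (θ : GradedTrans (𝟙_ V) N N') {E : V} {X Y : C} (f : E ⟶ (X ⟶[V] Y)) :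
    post (f ≫ N.map X Y) (θ.app Y) = pre (θ.app X) (f ≫ N'.map X Y) := by
  rw [post, pre, θ.nat']
  simp [braiding_inv_tensorUnit_left]

/-- Two unit-graded transformations that are inverse to each other. -/
structure GradedTrans.IsInverse [BraidedCategory V] {N N' : EnrichedFunctor V C D}
    (θ : GradedTrans (𝟙_ V) N N') (θ' : GradedTrans (𝟙_ V) N' N) : Prop where
  hom_inv (c : C) : pre (θ.app c) (θ'.app c) = eId V (N.obj c)
  inv_hom (c : C) : pre (θ'.app c) (θ.app c) = eId V (N'.obj c)

end UnitElements

/-! ### Weighted limits and continuity -/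

section Limits

variable {V : Type w} [Category.{u} V] [MonoidalCategory V] [SymmetricCategory V]
  [MonoidalClosed V]
variable {C : Type u₁} [EnrichedCategory V C] {D : Type u₂} [EnrichedCategory V D]
  {J : Type u₃} [EnrichedCategory V J] {B : Type u₄} [EnrichedCategory V B]

theorem IsWeightedLimit.nat {F : EnrichedFunctor V J V} {S : EnrichedFunctor V J C} {L : C}
    {μ : ∀ j, F.obj j ⟶ (L ⟶[V] S.obj j)} (h : IsWeightedLimit F S L μ) (j j' : J) :
    MonoidalClosed.uncurry (F.map j j') ≫ μ j' = cmp (μ j) (S.map j j') :=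
  h.naturality j j'

theorem IsWeightedLimit.nat_map {F : EnrichedFunctor V J V} {S : EnrichedFunctor V J C} {L : C}
    {μ : ∀ j, F.obj j ⟶ (L ⟶[V] S.obj j)} (h : IsWeightedLimit F S L μ)
    (N : EnrichedFunctor V C D) (j j' : J) :
    MonoidalClosed.uncurry (F.map j j') ≫ μ j' ≫ N.map L (S.obj j') =
      cmp (μ j ≫ N.map L (S.obj j)) (S.map j j' ≫ N.map (S.obj j) (S.obj j')) := by
  rw [← Category.assoc, h.nat, cmp_map]

/-- Graded cylinders over a composite `V`-functor, with unfolded types. -/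
theorem isWeightedLimit_comp_iff {F : EnrichedFunctor V J V} {S : EnrichedFunctor V J C}
    {N : EnrichedFunctor V C D} {L : D} {μ : ∀ j, F.obj j ⟶ (L ⟶[V] N.obj (S.obj j))} :
    IsWeightedLimit F (S.comp V N) L μ ↔
      (∀ j j', MonoidalClosed.uncurry (F.map j j') ≫ μ j' =
        cmp (μ j) (S.map j j' ≫ N.map (S.obj j) (S.obj j'))) ∧
      ∀ (X : D) (E : V) (s : ∀ j, E ⊗ F.obj j ⟶ (X ⟶[V] N.obj (S.obj j))),
        (∀ j j', E ◁ MonoidalClosed.uncurry (F.map j j') ≫ s j' =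
          (α_ _ _ _).inv ≫ cmp (s j) (S.map j j' ≫ N.map (S.obj j) (S.obj j'))) →
        ∃! f : E ⟶ (X ⟶[V] L), ∀ j, cmp f (μ j) = s j :=
  ⟨fun h => ⟨h.naturality, fun X E s hs => h.existsUnique X E ⟨s, hs⟩⟩,
    fun h => ⟨h.1, fun X E σ => h.2 X E σ.app σ.naturality⟩⟩

/-- Preservation of a weighted limit is invariant under isomorphism of `V`-functors. -/
theorem IsWeightedLimit.of_inverse {F : EnrichedFunctor V J V} {S : EnrichedFunctor V J C} {L : C}
    {μ : ∀ j, F.obj j ⟶ (L ⟶[V] S.obj j)} (hL : IsWeightedLimit F S L μ)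
    {N N' : EnrichedFunctor V C D} {θ : GradedTrans (𝟙_ V) N N'} {θ' : GradedTrans (𝟙_ V) N' N}
    (hθ : θ.IsInverse θ')
    (h : IsWeightedLimit F (S.comp V N) (N.obj L) (fun j => μ j ≫ N.map L (S.obj j))) :
    IsWeightedLimit F (S.comp V N') (N'.obj L) (fun j => μ j ≫ N'.map L (S.obj j)) := by
  obtain ⟨hn, hu⟩ := isWeightedLimit_comp_iff.1 h
  refine isWeightedLimit_comp_iff.2 ⟨hL.nat_map N', fun X E s hs => ?_⟩
  obtain ⟨f, hf, huf⟩ := hu X E (fun j => post (s j) (θ'.app (S.obj j))) fun j j' => by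
    rw [comp_post, hs, ← comp_post, ← cmp_post, θ'.post_app, post_cmp]
  have e (g : E ⟶ (X ⟶[V] N'.obj L)) (j : J) : cmp g (μ j ≫ N'.map L (S.obj j)) = s j ↔
      cmp (post g (θ'.app L)) (μ j ≫ N.map L (S.obj j)) = post (s j) (θ'.app (S.obj j)) := by
    rw [post_cmp, ← θ'.post_app, cmp_post]
    constructor
    · intro h; rw [h]
    · intro h
      have := congrArg (fun t => post t (θ.app (S.obj j))) h
      simpa only [post_post, post_eq_pre (θ'.app _), hθ.inv_hom, post_eId] using this
  refine ⟨post f (θ.app L), fun j => (e _ j).2 ?_, fun g hg => ?_⟩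
  · rw [post_post, post_eq_pre, hθ.hom_inv, post_eId]
    exact hf j
  · rw [← huf _ fun j => (e g j).1 (hg j)]
    rw [post_post, post_eq_pre, hθ.inv_hom, post_eId]

theorem IsContinuous.of_inverse {Φ : WeightClass.{u, w, a} V}
    {N N' : EnrichedFunctor V C D} {θ : GradedTrans (𝟙_ V) N N'} {θ' : GradedTrans (𝟙_ V) N' N}
    (hθ : θ.IsInverse θ') (hN : IsContinuous Φ N) : IsContinuous Φ N' where
  complete := hN.complete
  preserves J _ F hF S L μ h := h.of_inverse hθ (hN.preserves J F hF S L μ h)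

theorem IsLan.exists_inverse {G : EnrichedFunctor V C B} {M : EnrichedFunctor V C D}
    {N N' : EnrichedFunctor V B D} {η : GradedTrans (𝟙_ V) M (G.comp V N)}
    {η' : GradedTrans (𝟙_ V) M (G.comp V N')} (h : IsLan G M N η) (h' : IsLan G M N' η') :
    ∃ (θ : GradedTrans (𝟙_ V) N N') (θ' : GradedTrans (𝟙_ V) N' N), θ.IsInverse θ' := by
  obtain ⟨θ, hθ, -⟩ := h.existsUnique N' η'
  obtain ⟨θ', hθ', -⟩ := h'.existsUnique N η
  -- both round trips have the same form; the uniqueness clause identifies them with the identity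
  have aux {N N' : EnrichedFunctor V B D} {η : GradedTrans (𝟙_ V) M (G.comp V N)}
      {η' : GradedTrans (𝟙_ V) M (G.comp V N')} (h : IsLan G M N η)
      {θ : GradedTrans (𝟙_ V) N N'} {θ' : GradedTrans (𝟙_ V) N' N}
      (hθ : ∀ a, pre (η.at a) (θ.app (G.obj a)) = η'.at a)
      (hθ' : ∀ a, pre (η'.at a) (θ'.app (G.obj a)) = η.at a) (b : B) :
      pre (θ.app b) (θ'.app b) = eId V (N.obj b) := by
    have e : (θ.comp θ').precomp (λ_ _).inv = GradedTrans.id N := by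
      refine (h.existsUnique N η).unique (fun a => ?_) (fun a => ?_)
      · change pre (η.at a) (pre (θ.app (G.obj a)) (θ'.app (G.obj a))) = _
        rw [pre_pre, hθ, hθ']
      · exact eId_pre _
    exact congrArg (fun τ => τ.app b) e
  exact ⟨θ, θ', aux h hθ hθ', aux h' hθ' hθ⟩

/-- Continuity of one left Kan extension implies that of any other. -/
theorem IsLan.isContinuous {Φ : WeightClass.{u, w, a} V} {G : EnrichedFunctor V C B}
    {M : EnrichedFunctor V C D} {N N' : EnrichedFunctor V B D}
    {η : GradedTrans (𝟙_ V) M (G.comp V N)} {η' : GradedTrans (𝟙_ V) M (G.comp V N')}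
    (h : IsLan G M N η) (h' : IsLan G M N' η') (hN : IsContinuous Φ N) : IsContinuous Φ N' := by
  obtain ⟨θ, θ', hθ⟩ := h.exists_inverse h'
  exact hN.of_inverse hθ

theorem uncurry_comp_curry_eComp {E : V} {X Y Z : C} (g : E ⟶ (Y ⟶[V] Z)) :
    MonoidalClosed.uncurry (g ≫ MonoidalClosed.curry (eComp V X Y Z)) = cmp (𝟙 (X ⟶[V] Y)) g := by
  rw [MonoidalClosed.uncurry_natural_left, MonoidalClosed.uncurry_curry, eComp_eq_cmp,
    whiskerLeft_cmp, Category.comp_id]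

theorem assoc_whisker_eq {X E F F' H Z : V} {l : F ⊗ H ⟶ F'} {s : X ⊗ E ⊗ F' ⟶ Z}
    {t : (X ⊗ E ⊗ F) ⊗ H ⟶ Z}
    (h : X ◁ E ◁ l ≫ s = X ◁ (α_ E F H).inv ≫ (α_ X (E ⊗ F) H).inv ≫ t) :
    (X ⊗ E) ◁ l ≫ (α_ X E F').hom ≫ s =
      (α_ (X ⊗ E) F H).inv ≫ (α_ X E F).hom ▷ H ≫ t := by
  have h' := congrArg ((α_ X E _).hom ≫ ·) h
  simpa using h'

/-- A limit of `S` in `C` is sent to a limit by every representable `C(x, -)`. -/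
theorem IsWeightedLimit.corep {F : EnrichedFunctor V J V} {S : EnrichedFunctor V J C} {L : C}
    {μ : ∀ j, F.obj j ⟶ (L ⟶[V] S.obj j)} (h : IsWeightedLimit F S L μ) (x : C) :
    IsWeightedLimit F (S.comp V (corep x)) (x ⟶[V] L)
      (fun j => μ j ≫ (EnrichedLan.corep x).map L (S.obj j)) := by
  have hc {E E' : V} {Y Z : C} {X : V} (f : E ⟶ (ihom X).obj (x ⟶[V] Y)) (g : E' ⟶ (Y ⟶[V] Z)) :
      MonoidalClosed.uncurry (cmp (C := V) (X := X) (Y := x ⟶[V] Y) (Z := x ⟶[V] Z) f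
        (g ≫ (EnrichedLan.corep x).map Y Z)) =
      (α_ _ _ _).inv ≫ cmp (MonoidalClosed.uncurry f) g := by
    refine (uncurry_cmp f (g ≫ (EnrichedLan.corep x).map Y Z)).trans ?_
    have e : MonoidalClosed.uncurry (g ≫ (EnrichedLan.corep x).map Y Z) =
        cmp (𝟙 (x ⟶[V] Y)) g := uncurry_comp_curry_eComp g
    refine (congrArg (fun t => _ ≫ MonoidalClosed.uncurry f ▷ E' ≫ t) e).trans ?_
    exact congrArg (_ ≫ ·) ((whiskerRight_cmp (MonoidalClosed.uncurry f) (𝟙 (x ⟶[V] Y)) g).trans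
      (congrArg (cmp · g) (Category.comp_id _)))
  refine isWeightedLimit_comp_iff.2 ⟨h.nat_map _, fun X E s hs => ?_⟩
  -- an `E`-graded cylinder from `X` over `C(x, S -)` is an `X ⊗ E`-graded cylinder from `x` over `S`
  · obtain ⟨f, hf, hu⟩ := h.existsUnique x (X ⊗ E)
      ⟨fun j => (α_ _ _ _).hom ≫ MonoidalClosed.uncurry (s j), fun j j' => by
        have h1 := congrArg MonoidalClosed.uncurry (hs j j')
        rw [MonoidalClosed.uncurry_natural_left, MonoidalClosed.uncurry_natural_left] at h1
        have h2 := h1.trans (congrArg (_ ≫ ·) (hc (s j) (S.map j j')))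
        change _ = _ ≫ cmp _ _
        rw [← whiskerRight_cmp]
        exact assoc_whisker_eq h2⟩
    have key (g : E ⟶ (ihom X).obj (x ⟶[V] L)) (j : J) :
        cmp (C := V) (X := X) (Y := x ⟶[V] L) (Z := x ⟶[V] S.obj j) g
          (μ j ≫ (EnrichedLan.corep x).map L (S.obj j)) = s j ↔
        cmp (MonoidalClosed.uncurry g) (μ j) = (α_ _ _ _).hom ≫ MonoidalClosed.uncurry (s j) := by
      refine MonoidalClosed.uncurry_injective.eq_iff.symm.trans ?_
      exact (Eq.congr_left (hc g (μ j))).trans (Iso.inv_comp_eq _)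
    refine ⟨MonoidalClosed.curry f, fun j => (key _ j).2 ?_, fun g hg => ?_⟩
    · rw [MonoidalClosed.uncurry_curry]
      exact hf j
    · rw [← hu _ fun j => (key g j).1 (hg j)]
      exact (MonoidalClosed.curry_uncurry g).symm

end Limits

/-! ### Limits in functor categories are pointwise -/

section Pointwise

variable {V : Type w} [Category.{u} V] [MonoidalCategory V] [SymmetricCategory V]
  [MonoidalClosed V]
variable {C : Type u₁} [EnrichedCategory V C] {D : Type u₂} [EnrichedCategory V D]
  {J : Type u₃} [EnrichedCategory V J] {ι : Type u₄}

theorem braiding_shuffle_left (X Y Z : V) :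
    (β_ X Y).hom ▷ Z ≫ (α_ Y X Z).hom =
      (α_ X Y Z).hom ≫ X ◁ (β_ Y Z).hom ≫ (α_ X Z Y).inv ≫ (β_ (X ⊗ Z) Y).hom := by
  rw [braiding_tensor_left_hom]
  simp only [Iso.inv_hom_id_assoc]
  rw [← MonoidalCategory.whiskerLeft_comp_assoc, SymmetricCategory.symmetry]
  simp

/-- Evaluation at an object `c`, as a `V`-functor on a full subcategory of `[C, D]`. -/
def evalAt (P : ι → EnrichedFunctor V C D) [∀ i j, HasNatHom (P i) (P j)] (c : C) :
    letI := enrichedOfFunctors P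
    EnrichedFunctor V ι D :=
  letI := enrichedOfFunctors P
  { obj := fun i => (P i).obj c
    map := fun i j => (natHomπ (P i) (P j)).app c
    map_id := fun _ => natHomLift_π _ _
    map_comp := fun _ _ _ => natHomLift_π _ _ }

/-- Limits in a full subcategory of `[C, D]` may be verified pointwise. -/
theorem isWeightedLimit_of_evalAt (P : ι → EnrichedFunctor V C D)
    [∀ i j, HasNatHom (P i) (P j)] (F : EnrichedFunctor V J V) :
    letI := enrichedOfFunctors P
    ∀ (S : EnrichedFunctor V J ι) (L : ι) (μ : ∀ j, F.obj j ⟶ (L ⟶[V] S.obj j)),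
      (∀ c, IsWeightedLimit F (S.comp V (evalAt P c)) ((P L).obj c)
        (fun j => μ j ≫ (evalAt P c).map L (S.obj j))) → IsWeightedLimit F S L μ := by
  let _ := enrichedOfFunctors P
  intro S L μ h
  have h' c := isWeightedLimit_comp_iff.1 (h c)
  have hπ {E E' : V} {i j k : ι} (f : E ⟶ (i ⟶[V] j)) (g : E' ⟶ (j ⟶[V] k)) (c : C) :
      cmp f g ≫ (natHomπ (P i) (P k)).app c =
        cmp (f ≫ (natHomπ (P i) (P j)).app c) (g ≫ (natHomπ (P j) (P k)).app c) :=
    cmp_map (evalAt P c) f g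
  refine ⟨fun j j' => natHom_ext fun c => ?_, fun X E σ => ?_⟩
  · refine (Category.assoc _ _ _).trans (((h' c).1 j j').trans ?_)
    exact (hπ (μ j) (S.map j j') c).symm
  · have ex (c : C) := (h' c).2 ((P X).obj c) E
      (fun j => σ.app j ≫ (natHomπ (P X) (P (S.obj j))).app c) fun j j' => by
        refine (Category.assoc _ _ _).symm.trans
          ((congrArg (· ≫ (natHomπ (P X) (P (S.obj j'))).app c) (σ.naturality j j')).trans ?_)
        refine (Category.assoc _ _ _).trans (congrArg (_ ≫ ·) ?_)
        exact hπ (σ.app j) (S.map j j') c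
    choose f hf huf using ex
    -- the pointwise factorizations are natural, as can be tested after composition with `μ`
    let τ : GradedTrans E (P X) (P L) := ⟨f, fun c c' => by
      refine (h c').hom_ext fun j => ?_
      have hL := ((natHomπ (P L) (P (S.obj j))).precomp (μ j)).nat c c'
      have hX := ((natHomπ (P X) (P (S.obj j))).precomp (σ.app j)).nat c c'
      change (β_ _ _).hom ≫ cmp _ (μ j ≫ (natHomπ (P L) (P (S.obj j))).app c') =
        cmp (μ j ≫ (natHomπ (P L) (P (S.obj j))).app c) _ at hL
      change (β_ _ _).hom ≫ cmp _ (σ.app j ≫ (natHomπ (P X) (P (S.obj j))).app c') =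
        cmp (σ.app j ≫ (natHomπ (P X) (P (S.obj j))).app c) _ at hX
      change cmp ((β_ _ _).hom ≫ cmp _ (f c')) (μ j ≫ (natHomπ (P L) (P (S.obj j))).app c') =
        cmp (cmp (f c) _) (μ j ≫ (natHomπ (P L) (P (S.obj j))).app c')
      rw [braiding_comp_eq_iff] at hL
      have hfc (c : C) : cmp (f c) (μ j ≫ (natHomπ (P L) (P (S.obj j))).app c) =
        σ.app j ≫ (natHomπ (P X) (P (S.obj j))).app c := hf c j
      rw [← whiskerRight_cmp, cmp_assoc, cmp_assoc, hfc, hL,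
        ← whiskerLeft_cmp (β_ (c ⟶[V] c') (F.obj j)).hom, cmp_assoc', hfc,
        ← hX]
      have e := braiding_shuffle_left E (c ⟶[V] c') (F.obj j)
      simpa only [Category.assoc] using congrArg
        (· ≫ cmp ((P X).map c c') (σ.app j ≫ (natHomπ (P X) (P (S.obj j))).app c')) e⟩
    have hτ (c : C) : natHomLift τ ≫ (natHomπ (P X) (P L)).app c = f c := natHomLift_π τ c
    refine ⟨natHomLift τ, fun j => natHom_ext fun c => ?_, fun g hg => natHom_ext fun c => ?_⟩
    · refine (hπ (natHomLift τ) (μ j) c).trans ?_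
      rw [hτ]
      exact hf c j
    · rw [hτ]
      refine huf c _ fun j => ?_
      exact (hπ g (μ j) c).symm.trans (congrArg (· ≫ (natHomπ (P X) (P (S.obj j))).app c) (hg j))

end Pointwise

/-! ### Presheaves and the Yoneda lemma -/

section Presheaves

section

variable {V : Type w} [Category.{u} V] [MonoidalCategory V] [BraidedCategory V]
variable {C : Type u₁} [EnrichedCategory V C] {D : Type u₂} [EnrichedCategory V D]
  {F G H : EnrichedFunctor V C D} [HasNatHom F G] [HasNatHom G H] [HasNatHom F H]

/-- Composition of generalized elements of the objects of `V`-natural transformations. -/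
def natHomComp {E E' : V} (f : E ⟶ natHom F G) (g : E' ⟶ natHom G H) : E ⊗ E' ⟶ natHom F H :=
  (f ⊗ₘ g) ≫ natHomLift ((natHomπ F G).comp (natHomπ G H))

theorem natHomComp_π {E E' : V} (f : E ⟶ natHom F G) (g : E' ⟶ natHom G H) (c : C) :
    natHomComp f g ≫ (natHomπ F H).app c =
      cmp (f ≫ (natHomπ F G).app c) (g ≫ (natHomπ G H).app c) := by
  rw [natHomComp, Category.assoc, natHomLift_π]
  exact comp_cmp f g _ _

end

variable {V : Type w} [Category.{u} V] [MonoidalCategory V] [SymmetricCategory V]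
  [MonoidalClosed V]
variable {K : Type u₄} [EnrichedCategory V K]

/-- Naturality of transformations between presheaves, in terms of the left actions of the homs. -/
theorem presheaf_naturality_iff {F F' G G' H E : V} (f : H ⟶ (ihom F).obj F')
    (g : H ⟶ (ihom G).obj G') (s : F ⊗ E ⟶ G) (s' : F' ⊗ E ⟶ G') :
    ((β_ E H).hom ≫ cmp (C := V) (X := F) (Y := F') (Z := G') f (MonoidalClosed.curry s') =
      cmp (C := V) (X := F) (Y := G) (Z := G') (MonoidalClosed.curry s) g) ↔
    ((β_ H F).hom ≫ MonoidalClosed.uncurry f) ▷ E ≫ s' =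
      (α_ H F E).hom ≫ H ◁ s ≫ (β_ H G).hom ≫ MonoidalClosed.uncurry g := by
  refine MonoidalClosed.uncurry_injective.eq_iff.symm.trans ?_
  have h1 : MonoidalClosed.uncurry ((β_ E H).hom ≫
      cmp (C := V) (X := F) (Y := F') (Z := G') f (MonoidalClosed.curry s')) =
      F ◁ (β_ E H).hom ≫ (α_ _ _ _).inv ≫ MonoidalClosed.uncurry f ▷ E ≫ s' := by
    refine (MonoidalClosed.uncurry_natural_left _ _).trans (congrArg (_ ≫ ·) ?_)
    refine (uncurry_cmp f (MonoidalClosed.curry s')).trans ?_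
    rw [MonoidalClosed.uncurry_curry]
  have h2 : MonoidalClosed.uncurry
      (cmp (C := V) (X := F) (Y := G) (Z := G') (MonoidalClosed.curry s) g) =
      (α_ _ _ _).inv ≫ s ▷ H ≫ MonoidalClosed.uncurry g := by
    refine (uncurry_cmp (MonoidalClosed.curry s) g).trans ?_
    rw [MonoidalClosed.uncurry_curry]
  have h3 : s ▷ H ≫ MonoidalClosed.uncurry g = (β_ (F ⊗ E) H).hom ≫ H ◁ s ≫ (β_ H G).hom ≫
      MonoidalClosed.uncurry g := by
    rw [← braiding_naturality_left_assoc, SymmetricCategory.symmetry_assoc]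
  have h4 : F ◁ (β_ E H).hom ≫ (α_ _ _ _).inv ≫ MonoidalClosed.uncurry f ▷ E ≫ s' =
      (F ◁ (β_ E H).hom ≫ (α_ _ _ _).inv ≫ (β_ F H).hom ▷ E) ≫
        ((β_ H F).hom ≫ MonoidalClosed.uncurry f) ▷ E ≫ s' := by
    simp only [Category.assoc, ← MonoidalCategory.comp_whiskerRight_assoc,
      SymmetricCategory.symmetry_assoc]
  rw [h1, h2, h3, h4, ← cancel_epi (F ◁ (β_ E H).hom ≫ (α_ _ _ _).inv ≫ (β_ F H).hom ▷ E)]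
  refine Eq.congr_right ?_
  simp [braiding_tensor_left_hom]

/-- A graded transformation of presheaves, given by a family `F x ⊗ E ⟶ G x` compatible with the
left actions of the homs. -/
def GradedTrans.ofAct {E : V} {F G : EnrichedFunctor V Kᵒᵖ V}
    (s : ∀ x : K, F.obj (op x) ⊗ E ⟶ G.obj (op x))
    (hs : ∀ y x, act F y x ▷ E ≫ s y = (α_ _ _ _).hom ≫ (y ⟶[V] x) ◁ s x ≫ act G y x) :
    GradedTrans E F G where
  app x := MonoidalClosed.curry (s x.unop)
  naturality x y := (presheaf_naturality_iff (F.map x y) (G.map x y) (s x.unop) (s y.unop)).2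
    (hs y.unop x.unop)

theorem GradedTrans.act_comp {E : V} {F G : EnrichedFunctor V Kᵒᵖ V} (σ : GradedTrans E F G)
    (y x : K) : act F y x ▷ E ≫ MonoidalClosed.uncurry (σ.app (op y)) =
      (α_ _ _ _).hom ≫ (y ⟶[V] x) ◁ MonoidalClosed.uncurry (σ.app (op x)) ≫ act G y x := by
  refine (presheaf_naturality_iff (F.map (op x) (op y)) (G.map (op x) (op y)) _ _).1 ?_
  have e (x : K) : MonoidalClosed.curry (MonoidalClosed.uncurry (σ.app (op x))) = σ.app (op x) :=
    MonoidalClosed.curry_uncurry _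
  rw [e, e]
  exact σ.nat (op x) (op y)

theorem act_rep (k : K) (y x : K) : act (rep (V := V) k) y x = eComp V y x k := by
  refine (congrArg ((β_ _ _).hom ≫ ·) (uncurry_rep_map k x y)).trans ?_
  exact SymmetricCategory.symmetry_assoc _ _ _

theorem eId_act (P : EnrichedFunctor V Kᵒᵖ V) (x : K) :
    eId V x ▷ _ ≫ act P x x = (λ_ (P.obj (op x))).hom := by
  rw [act, braiding_naturality_left_assoc]
  have h : MonoidalClosed.uncurry (eId V x ≫ P.map (op x) (op x)) = (ρ_ _).hom :=
    (congrArg MonoidalClosed.uncurry (P.map_id (op x))).trans (uncurry_eId _)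
  refine (congrArg (_ ≫ ·) ((MonoidalClosed.uncurry_natural_left _ _).symm.trans h)).trans ?_
  exact braiding_rightUnitor _

/-- Transposition of the associativity of a right action to that of the corresponding left action. -/
theorem action_assoc {P P₁ P₂ H₁ H₂ H : V} {u₁ : P ⊗ H₁ ⟶ P₁} {u₂ : P₁ ⊗ H₂ ⟶ P₂}
    {c : H₂ ⊗ H₁ ⟶ H} {u : P ⊗ H ⟶ P₂}
    (h : P ◁ ((β_ H₁ H₂).hom ≫ c) ≫ u = (α_ _ _ _).inv ≫ u₁ ▷ H₂ ≫ u₂) :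
    c ▷ P ≫ (β_ H P).hom ≫ u =
      (α_ _ _ _).hom ≫ H₂ ◁ ((β_ H₁ P).hom ≫ u₁) ≫ (β_ H₂ P₁).hom ≫ u₂ := by
  have e : (β_ (H₂ ⊗ H₁) P).hom ≫ P ◁ (β_ H₂ H₁).hom ≫ (α_ P H₁ H₂).inv =
      (α_ _ _ _).hom ≫ H₂ ◁ (β_ H₁ P).hom ≫ (β_ H₂ (P ⊗ H₁)).hom := by
    have := congrArg (· ≫ (β_ H₂ (P ⊗ H₁)).hom) (braiding_shuffle H₂ H₁ P)
    simpa only [Category.assoc, SymmetricCategory.symmetry, Category.comp_id] using this.symm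
  have e' := congrArg (· ≫ u₁ ▷ H₂ ≫ u₂) e
  simp only [Category.assoc] at e'
  rw [← h, MonoidalCategory.whiskerLeft_comp_assoc,
    ← MonoidalCategory.whiskerLeft_comp_assoc _ (β_ H₂ H₁).hom,
    SymmetricCategory.symmetry, MonoidalCategory.whiskerLeft_id, Category.id_comp] at e'
  rw [braiding_naturality_left_assoc, e', MonoidalCategory.whiskerLeft_comp_assoc,
    braiding_naturality_right_assoc H₂ u₁]

theorem eComp_act (P : EnrichedFunctor V Kᵒᵖ V) (z y x : K) :
    eComp V z y x ▷ _ ≫ act P z x = (α_ _ _ _).hom ≫ (z ⟶[V] y) ◁ act P y x ≫ act P z y := by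
  have h := congrArg MonoidalClosed.uncurry (P.map_comp (op x) (op y) (op z))
  have h1 : (P.obj (op x)) ◁ ((β_ (y ⟶[V] x) (z ⟶[V] y)).hom ≫ eComp V z y x) ≫
      MonoidalClosed.uncurry (P.map (op x) (op z)) = (α_ _ _ _).inv ≫
        MonoidalClosed.uncurry (P.map (op x) (op y)) ▷ (z ⟶[V] y) ≫
          MonoidalClosed.uncurry (P.map (op y) (op z)) :=
    (MonoidalClosed.uncurry_natural_left _ _).symm.trans
      (h.trans (uncurry_cmp (P.map (op x) (op y)) (P.map (op y) (op z))))
  exact action_assoc h1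

/-- The Yoneda transformation: an element of `P k` acts on `K(-, k)`. -/
def yonedaTrans (P : EnrichedFunctor V Kᵒᵖ V) (k : K) :
    GradedTrans (P.obj (op k)) (rep k) P :=
  GradedTrans.ofAct (fun x => act P x k) fun y x =>
    (congrArg (fun t => t ▷ _ ≫ act P y k) (act_rep k y x)).trans (eComp_act P y x k)

/-- The comparison `P k ⟶ [Kᵒᵖ, V](K(-, k), P)` of the Yoneda lemma. -/
def yonedaElt (P : EnrichedFunctor V Kᵒᵖ V) (k : K) [HasNatHom (rep (V := V) k) P] :
    P.obj (op k) ⟶ natHom (rep (V := V) k) P :=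
  natHomLift (yonedaTrans P k)

/-- Evaluation of a transformation out of a representable presheaf. -/
def yonedaEv (P : EnrichedFunctor V Kᵒᵖ V) (k : K) [HasNatHom (rep (V := V) k) P] (x : K) :
    (x ⟶[V] k) ⊗ natHom (rep (V := V) k) P ⟶ P.obj (op x) :=
  MonoidalClosed.uncurry ((natHomπ (rep k) P).app (op x))

theorem whiskerLeft_yonedaEv {P : EnrichedFunctor V Kᵒᵖ V} {k : K}
    [HasNatHom (rep (V := V) k) P] {E : V} (f : E ⟶ natHom (rep (V := V) k) P) (x : K) :
    (x ⟶[V] k) ◁ f ≫ yonedaEv P k x =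
      MonoidalClosed.uncurry (f ≫ (natHomπ (rep k) P).app (op x)) :=
  (MonoidalClosed.uncurry_natural_left _ _).symm

theorem yonedaEv_ext {P : EnrichedFunctor V Kᵒᵖ V} {k : K} [HasNatHom (rep (V := V) k) P] {E : V}
    {f g : E ⟶ natHom (rep (V := V) k) P}
    (h : ∀ x, (x ⟶[V] k) ◁ f ≫ yonedaEv P k x = (x ⟶[V] k) ◁ g ≫ yonedaEv P k x) : f = g :=
  natHom_ext fun x => MonoidalClosed.uncurry_injective
    ((whiskerLeft_yonedaEv f x.unop).symm.trans ((h x.unop).trans (whiskerLeft_yonedaEv g x.unop)))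

theorem yonedaElt_ev (P : EnrichedFunctor V Kᵒᵖ V) (k : K) [HasNatHom (rep (V := V) k) P]
    (x : K) : (x ⟶[V] k) ◁ yonedaElt P k ≫ yonedaEv P k x = act P x k := by
  rw [whiskerLeft_yonedaEv, yonedaElt, natHomLift_π]
  exact MonoidalClosed.uncurry_curry _

theorem yonedaEv_act (P : EnrichedFunctor V Kᵒᵖ V) (k : K) [HasNatHom (rep (V := V) k) P]
    (y x : K) : eComp V y x k ▷ _ ≫ yonedaEv P k y =
      (α_ _ _ _).hom ≫ (y ⟶[V] x) ◁ yonedaEv P k x ≫ act P y x :=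
  (congrArg (fun t => t ▷ _ ≫ yonedaEv P k y) (act_rep k y x)).symm.trans
    ((natHomπ (rep (V := V) k) P).act_comp y x)

/-- The Yoneda lemma. -/
def yonedaIso (P : EnrichedFunctor V Kᵒᵖ V) (k : K) [HasNatHom (rep (V := V) k) P] :
    P.obj (op k) ≅ natHom (rep (V := V) k) P where
  hom := yonedaElt P k
  inv := (λ_ _).inv ≫ eId V k ▷ _ ≫ yonedaEv P k k
  hom_inv_id := by
    rw [leftUnitor_inv_naturality_assoc, whisker_exchange_assoc, yonedaElt_ev, eId_act,
      Iso.inv_hom_id]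
  inv_hom_id := by
    apply yonedaEv_ext
    intro x
    have h := congrArg (fun t => (x ⟶[V] k) ◁ ((λ_ _).inv ≫ eId V k ▷ _) ≫ (α_ _ _ _).inv ≫ t)
      (yonedaEv_act P k x k)
    simp only [Iso.inv_hom_id_assoc, MonoidalCategory.whiskerLeft_comp, Category.assoc] at h
    rw [MonoidalCategory.whiskerLeft_comp, Category.assoc, yonedaElt_ev,
      MonoidalCategory.whiskerLeft_comp, MonoidalCategory.whiskerLeft_comp, Category.assoc,
      Category.assoc, ← h, associator_inv_naturality_middle_assoc, eComp_eq_cmp,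
      ← MonoidalCategory.comp_whiskerRight_assoc, whiskerLeft_cmp, Category.comp_id, cmp_id]
    simp

section

variable {P P' : EnrichedFunctor V Kᵒᵖ V} {a a' : K} [HasNatHom (rep (V := V) a) P]

theorem natHomComp_yonedaEv [HasNatHom P P'] [HasNatHom (rep (V := V) a) P'] {E E' : V}
    (f : E ⟶ natHom (rep (V := V) a) P) (g : E' ⟶ natHom P P') (x : K) :
    (x ⟶[V] a) ◁ natHomComp f g ≫ yonedaEv P' a x =
      (α_ _ _ _).inv ≫ ((x ⟶[V] a) ◁ f ≫ yonedaEv P a x) ▷ E' ≫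
        MonoidalClosed.uncurry (g ≫ (natHomπ P P').app (op x)) := by
  refine (whiskerLeft_yonedaEv _ _).trans ?_
  refine (congrArg MonoidalClosed.uncurry (natHomComp_π f g (op x))).trans ?_
  refine (uncurry_cmp _ _).trans ?_
  exact congrArg (fun t => _ ≫ t ▷ E' ≫ _) (whiskerLeft_yonedaEv f x).symm

theorem repHom_natHomComp_yonedaEv [HasNatHom (rep (V := V) a') (rep a)]
    [HasNatHom (rep (V := V) a') P] {E : V} (g : E ⟶ natHom (rep (V := V) a) P) (x : K) :
    (x ⟶[V] a') ◁ natHomComp (natHomLift (repHom a' a)) g ≫ yonedaEv P a' x =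
      (α_ _ _ _).inv ≫ eComp V x a' a ▷ E ≫ (x ⟶[V] a) ◁ g ≫ yonedaEv P a x := by
  rw [natHomComp_yonedaEv, whiskerLeft_yonedaEv, whiskerLeft_yonedaEv]
  refine congrArg (fun t => _ ≫ t ▷ E ≫ _) ?_
  refine (congrArg MonoidalClosed.uncurry (natHomLift_π (repHom a' a) (op x))).trans ?_
  exact MonoidalClosed.uncurry_curry _

/-- The Yoneda comparison is natural in the representing object. -/
theorem act_yonedaElt [HasNatHom (rep (V := V) a') (rep a)] [HasNatHom (rep (V := V) a') P] :
    act P a' a ≫ yonedaElt P a' = natHomComp (natHomLift (repHom a' a)) (yonedaElt P a) := by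
  apply yonedaEv_ext
  intro x
  rw [repHom_natHomComp_yonedaEv, MonoidalCategory.whiskerLeft_comp, Category.assoc, yonedaElt_ev,
    yonedaElt_ev, eComp_act, Iso.inv_hom_id_assoc]

/-- The Yoneda comparison is natural in the presheaf. -/
theorem yonedaElt_natHomComp [HasNatHom P P'] [HasNatHom (rep (V := V) a) P'] {E : V}
    (g : E ⟶ natHom P P') :
    natHomComp (yonedaElt P a) g =
      MonoidalClosed.uncurry (g ≫ (natHomπ P P').app (op a)) ≫ yonedaElt P' a := by
  apply yonedaEv_ext
  intro x
  have h := ((natHomπ P P').precomp g).act_comp x a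
  rw [natHomComp_yonedaEv, yonedaElt_ev, MonoidalCategory.whiskerLeft_comp, Category.assoc,
    yonedaElt_ev, Iso.inv_comp_eq]
  exact h

end

end Presheaves

/-! ### Kan extensions of models in the base -/

section Weights

variable {V : Type w} [Category.{u} V] [MonoidalCategory V] [SymmetricCategory V]
  [MonoidalClosed V]
variable {A : Type u₁} [EnrichedCategory V A] {B : Type u₂} [EnrichedCategory V B]
  {B' : Type u₃} [EnrichedCategory V B'] {K : Type u₄} [EnrichedCategory V K]
  {G : EnrichedFunctor V A B} {G' : EnrichedFunctor V A B'} {M : EnrichedFunctor V A K}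

theorem lanCylinder_cmp {N : EnrichedFunctor V B K} (η : GradedTrans (𝟙_ V) M (G.comp V N))
    {E E' : V} {a : A} {b b' : B} (f : E ⟶ (G.obj a ⟶[V] b)) (g : E' ⟶ (b ⟶[V] b')) :
    cmp (f ≫ lanCylinder η b a) (g ≫ N.map b b') = cmp f g ≫ lanCylinder η b' a := by
  rw [← whiskerRight_cmp, ← whiskerLeft_cmp, lanCylinder_map, eComp_eq_cmp,
    whiskerLeft_cmp_assoc, whiskerRight_cmp_assoc, Category.comp_id, Category.comp_id]

/-- Colimits defining left Kan extensions may be transported along isomorphisms of weights. -/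
theorem isWeightedColimit_lan_of_iso {b : B} {b' : B'} {L : K}
    {μ : ∀ a, (G'.obj a ⟶[V] b') ⟶ (M.obj a ⟶[V] L)}
    (y : ∀ a, (G.obj a ⟶[V] b) ≅ (G'.obj a ⟶[V] b'))
    (hy : ∀ a' a, cmp (G.map a' a) (𝟙 _) ≫ (y a').hom = cmp (G'.map a' a) (y a).hom)
    (h : IsWeightedColimit ((opFunctor G').comp V (rep b')) M L μ) :
    IsWeightedColimit ((opFunctor G).comp V (rep b)) M L (fun a => (y a).hom ≫ μ a) := by
  obtain ⟨hn, hu⟩ := isWeightedColimit_lan_iff.1 h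
  have hn' (a' a : A) : cmp (G.map a' a) (𝟙 (G.obj a ⟶[V] b)) ≫ (y a').hom ≫ μ a' =
      cmp (M.map a' a) ((y a).hom ≫ μ a) := by
    rw [← Category.assoc, hy, ← whiskerLeft_cmp, ← hn, whiskerLeft_cmp_assoc, Category.comp_id]
  refine isWeightedColimit_lan_iff.2 ⟨hn', fun X E s hs => ?_⟩
  · have hy' (a' a : A) : cmp (G'.map a' a) (𝟙 _) ≫ (y a').inv =
        (a' ⟶[V] a) ◁ (y a).inv ≫ cmp (G.map a' a) (𝟙 _) := by
      rw [Iso.comp_inv_eq, Category.assoc, hy, whiskerLeft_cmp, Iso.inv_hom_id]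
    obtain ⟨f, hf, huf⟩ := hu X E (fun a => (y a).inv ▷ E ≫ s a) fun a' a => by
      rw [← MonoidalCategory.comp_whiskerRight_assoc, hy',
        MonoidalCategory.comp_whiskerRight_assoc, hs, ← whiskerLeft_cmp]
      simp
    have key (g : E ⟶ (L ⟶[V] X)) (a : A) :
        cmp ((y a).hom ≫ μ a) g = s a ↔ cmp (μ a) g = (y a).inv ▷ E ≫ s a := by
      rw [← whiskerRight_cmp, ← cancel_epi ((y a).inv ▷ E),
        ← MonoidalCategory.comp_whiskerRight_assoc, Iso.inv_hom_id,
        MonoidalCategory.id_whiskerRight, Category.id_comp]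
    exact ⟨f, fun a => (key f a).2 (hf a), fun g hg => huf g fun a => (key g a).1 (hg a)⟩

end Weights

section ValuesInV

variable {V : Type w} [Category.{u} V] [MonoidalCategory V] [SymmetricCategory V]
  [MonoidalClosed V]

/-- Transport along pointwise equalities. The diagram is given by its fields, so that two composites
of `V`-functors that are not syntactically equal may be compared. -/
theorem IsWeightedLimit.congr {J : Type u₃} [EnrichedCategory V J] {D : Type u₂}
    [EnrichedCategory V D] {F : EnrichedFunctor V J V} {o : J → D}
    {m m' : ∀ j j' : J, EnrichedCategory.Hom j j' ⟶ EnrichedCategory.Hom (o j) (o j')} {p q p' q'} {L : D}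
    {μ μ' : ∀ j, F.obj j ⟶ EnrichedCategory.Hom L (o j)} (h : IsWeightedLimit F ⟨o, m, p, q⟩ L μ)
    (hm : ∀ j j', m j j' = m' j j') (hμ : ∀ j, μ j = μ' j) :
    IsWeightedLimit F ⟨o, m', p', q'⟩ L μ' := by
  obtain rfl : m = m' := funext₂ hm
  obtain rfl : μ = μ' := funext hμ
  exact h

section

variable {A : Type u} [EnrichedCategory V A] {B : Type u₂} [EnrichedCategory V B]

/-- A cocomplete `V` has all colimits weighted by presheaves on `V`-categories with a small set of
objects. -/
theorem exists_isWeightedColimit_self [HasColimits V] (F : EnrichedFunctor V Aᵒᵖ V)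
    (M : EnrichedFunctor V A V) :
    ∃ (L : V) (μ : ∀ a, F.obj (op a) ⟶ (ihom (M.obj a)).obj L), IsWeightedColimit F M L μ := by
  obtain ⟨L, ν, h⟩ := exists_isTensor (R := M.obj) (F := fun a => F.obj (op a))
    (fun a' a => MonoidalClosed.uncurry (M.map a' a)) (act F)
  refine ⟨L, fun a => MonoidalClosed.curry (ν a), IsTensor.isWeightedColimit ?_⟩
  simp only [MonoidalClosed.uncurry_curry]
  exact h

theorem exists_isLan_self [HasColimits V] (G : EnrichedFunctor V A B)
    (M : EnrichedFunctor V A V) :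
    ∃ (N : EnrichedFunctor V B V) (η : GradedTrans (𝟙_ V) M (G.comp V N)), IsLan G M N η :=
  exists_isLan fun b => exists_isWeightedColimit_self ((opFunctor G).comp V (rep b)) M

variable [HasLimits V]

/-- The nerve `B → [Aᵒᵖ, V]`, `b ↦ B(G -, b)`, of a `V`-functor `G : A → B`. -/
def nerve (G : EnrichedFunctor V A B) : EnrichedFunctor V B (EnrichedFunctor V Aᵒᵖ V) where
  obj b := (opFunctor G).comp V (rep b)
  map b b' := natHomLift ((repHom b b').whisker (opFunctor G))
  map_id b := by
    apply natHom_ext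
    intro x
    refine (Category.assoc _ _ _).trans ?_
    refine (congrArg (eId V b ≫ ·) (natHomLift_π _ x)).trans ?_
    exact ((corep (G.obj x.unop)).map_id b).trans
      (natHomLift_π (GradedTrans.id ((opFunctor G).comp V (rep b))) x).symm
  map_comp b b' b'' := by
    apply natHom_ext
    intro x
    refine (Category.assoc _ _ _).trans ?_
    refine (congrArg (eComp V b b' b'' ≫ ·) (natHomLift_π _ x)).trans ?_
    refine ((corep (G.obj x.unop)).map_comp b b' b'').trans ?_
    refine Eq.trans ?_ (natHomComp_π (F := (opFunctor G).comp V (rep b))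
      (G := (opFunctor G).comp V (rep b')) (H := (opFunctor G).comp V (rep b''))
      (natHomLift ((repHom b b').whisker (opFunctor G)))
      (natHomLift ((repHom b' b'').whisker (opFunctor G))) x).symm
    exact congrArg₂ (cmp (C := V)) (natHomLift_π ((repHom b b').whisker (opFunctor G)) x).symm
      (natHomLift_π ((repHom b' b'').whisker (opFunctor G)) x).symm

theorem nerve_map_π (G : EnrichedFunctor V A B) (b b' : B) (a : A) :
    (nerve G).map b b' ≫ (natHomπ ((nerve G).obj b) ((nerve G).obj b')).app (op a) =
      (corep (G.obj a)).map b b' :=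
  natHomLift_π ((repHom b b').whisker (opFunctor G)) (op a)

/-- The nerve is continuous, since each `B(G a, -)` is and limits of presheaves are pointwise. -/
theorem nerve_isContinuous {Φ : WeightClass.{u, w, a} V} (G : EnrichedFunctor V A B)
    (hB : IsComplete Φ B) : IsContinuous Φ (nerve G) where
  complete := hB
  preserves J _ F hF S L μ h := by
    refine isWeightedLimit_of_evalAt id F (S.comp V (nerve G)) ((nerve G).obj L) _ fun x => ?_
    refine (h.corep (G.obj x.unop)).congr (fun j j' => ?_) fun j => ?_
    · exact ((Category.assoc _ _ _).trans
        (congrArg (S.map j j' ≫ ·) (nerve_map_π G (S.obj j) (S.obj j') x.unop))).symm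
    · exact ((Category.assoc _ _ _).trans
        (congrArg (μ j ≫ ·) (nerve_map_π G L (S.obj j) x.unop))).symm

/-- A left Kan extension along `G` is the nerve of `G` followed by a left Kan extension along the
Yoneda embedding. -/
theorem exists_isLan_nerve_comp {M : EnrichedFunctor V A V} (G : EnrichedFunctor V A B)
    {T : EnrichedFunctor V (EnrichedFunctor V Aᵒᵖ V) V}
    {η : GradedTrans (𝟙_ V) M ((yonedaFunctor A).comp V T)} (h : IsLan (yonedaFunctor A) M T η) :
    ∃ η' : GradedTrans (𝟙_ V) M (G.comp V ((nerve G).comp V T)),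
      IsLan G M ((nerve G).comp V T) η' := by
  let y (b : B) (a : A) : (G.obj a ⟶[V] b) ≅ natHom (rep (V := V) a) ((nerve G).obj b) :=
    yonedaIso ((nerve G).obj b) a
  let ν (b : B) (a : A) : (G.obj a ⟶[V] b) ⟶ (ihom (M.obj a)).obj (T.obj ((nerve G).obj b)) :=
    (y b a).hom ≫ lanCylinder η ((nerve G).obj b) a
  have hy (b b' : B) (a : A) : cmp (C := EnrichedFunctor V Aᵒᵖ V) (X := rep a)
      (Y := (nerve G).obj b) (Z := (nerve G).obj b') (y b a).hom ((nerve G).map b b') =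
        eComp V (G.obj a) b b' ≫ (y b' a).hom := by
    refine (yonedaElt_natHomComp (P := (nerve G).obj b) (P' := (nerve G).obj b')
      ((nerve G).map b b')).trans (congrArg (· ≫ (y b' a).hom) ?_)
    refine (congrArg MonoidalClosed.uncurry (nerve_map_π G b b' a)).trans ?_
    exact MonoidalClosed.uncurry_curry _
  have hact (b : B) (a' a : A) : cmp (G.map a' a) (𝟙 (G.obj a ⟶[V] b)) ≫ (y b a').hom =
      cmp (C := EnrichedFunctor V Aᵒᵖ V) (X := rep a') (Y := rep a) (Z := (nerve G).obj b)
        ((yonedaFunctor A).map a' a) (y b a).hom :=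
    (congrArg (· ≫ (y b a').hom) (act_weight G b a' a)).symm.trans
      (act_yonedaElt (P := (nerve G).obj b))
  have hν (a : A) (b b' : B) : cmp (C := V) (X := M.obj a) (Y := T.obj ((nerve G).obj b))
      (Z := T.obj ((nerve G).obj b')) (ν b a) (((nerve G).comp V T).map b b') =
        eComp V (G.obj a) b b' ≫ ν b' a :=
    (lanCylinder_cmp η (y b a).hom ((nerve G).map b b')).trans
      ((congrArg (· ≫ lanCylinder η ((nerve G).obj b') a) (hy b b' a)).trans (Category.assoc _ _ _))
  exact exists_isLan_of_cylinder (G := G) (M := M) ((nerve G).comp V T) ν hν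
    fun b => isWeightedColimit_lan_of_iso (y b) (hact b) (h ((nerve G).obj b))

/-- Under Axiom A, left Kan extensions into `V` of `Φ`-continuous `V`-functors are
`Φ`-continuous. -/
theorem AxiomA.isContinuous_of_isLan [HasColimits V] {Φ : WeightClass.{u, w, a} V}
    (hΦ : AxiomA Φ) (hA : IsComplete Φ A) (hB : IsComplete Φ B) {G : EnrichedFunctor V A B}
    {M : EnrichedFunctor V A V} (hM : IsContinuous Φ M) {N : EnrichedFunctor V B V}
    {η : GradedTrans (𝟙_ V) M (G.comp V N)} (h : IsLan G M N η) : IsContinuous Φ N := by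
  obtain ⟨T, ηT, hT⟩ := exists_isLan_self (yonedaFunctor A) M
  obtain ⟨η', hη'⟩ := exists_isLan_nerve_comp G hT
  exact hη'.isContinuous h ((nerve_isContinuous G hB).comp (hΦ A hA M hM T ηT hT))

end

end ValuesInV

/-! ### Elements of internal homs -/

section Elements

variable {V : Type w} [Category.{u} V] [MonoidalCategory V] [SymmetricCategory V]
  [MonoidalClosed V]

/-- The morphism of `V` named by an element of an internal hom. -/
def elt {X Y : V} (t : 𝟙_ V ⟶ (ihom X).obj Y) : X ⟶ Y :=
  (ρ_ X).inv ≫ MonoidalClosed.uncurry t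

theorem uncurry_pre {E X Y Z : V} (t : 𝟙_ V ⟶ (ihom X).obj Y) (g : E ⟶ (ihom Y).obj Z) :
    MonoidalClosed.uncurry (pre (C := V) (X := X) (Y := Y) (Z := Z) t g) =
      elt t ▷ E ≫ MonoidalClosed.uncurry g := by
  refine (MonoidalClosed.uncurry_natural_left _ _).trans ?_
  refine (congrArg (_ ≫ ·) (uncurry_cmp t g)).trans ?_
  rw [elt]
  simp

theorem uncurry_post {E X Y Z : V} (g : E ⟶ (ihom X).obj Y) (t : 𝟙_ V ⟶ (ihom Y).obj Z) :
    MonoidalClosed.uncurry (post (C := V) (X := X) (Y := Y) (Z := Z) g t) =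
      MonoidalClosed.uncurry g ≫ elt t := by
  refine (MonoidalClosed.uncurry_natural_left _ _).trans ?_
  refine (congrArg (_ ≫ ·) (uncurry_cmp g t)).trans ?_
  rw [elt, rightUnitor_inv_naturality_assoc]
  simp

/-- Composition with an element of `[X, C(x, Y)]` in terms of the morphism `X ⟶ C(x, Y)` it names. -/
theorem uncurry_pre_corep {C : Type u₁} [EnrichedCategory V C] {x Y Z : C} {E X : V}
    (t : 𝟙_ V ⟶ (ihom X).obj (x ⟶[V] Y)) (f : E ⟶ (Y ⟶[V] Z)) :
    MonoidalClosed.uncurry (pre (C := V) (X := X) (Y := x ⟶[V] Y) (Z := x ⟶[V] Z) t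
      (f ≫ (corep x).map Y Z)) = cmp (elt t) f := by
  refine (uncurry_pre t (f ≫ (corep x).map Y Z)).trans ?_
  refine (congrArg (_ ≫ ·) (uncurry_comp_curry_eComp f)).trans ?_
  rw [whiskerRight_cmp, Category.comp_id]

end Elements

/-! ### Functoriality of left Kan extension -/

section LanFunctor

variable {V : Type w} [Category.{u} V] [MonoidalCategory V] [SymmetricCategory V]
  [MonoidalClosed V]
variable {A : Type u₁} [EnrichedCategory V A] {B : Type u₂} [EnrichedCategory V B]
  {D : Type u₄} [EnrichedCategory V D] {ι : Type u₃} {κ : Type a}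

/-- Morphisms into `[B, D](Lan_G M, S)` are equal if they agree after restriction along the unit. -/
theorem IsLan.natHom_ext {G : EnrichedFunctor V A B} {M : EnrichedFunctor V A D}
    {N S : EnrichedFunctor V B D} {η : GradedTrans (𝟙_ V) M (G.comp V N)} (h : IsLan G M N η)
    [HasNatHom N S] {E : V} {f g : E ⟶ natHom N S}
    (hfg : ∀ a, pre (η.at a) (f ≫ (natHomπ N S).app (G.obj a)) =
      pre (η.at a) (g ≫ (natHomπ N S).app (G.obj a))) : f = g := by
  have e : (natHomπ N S).precomp f = (natHomπ N S).precomp g :=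
    h.trans_ext fun a => (cancel_epi (λ_ E).inv).1 (hfg a)
  exact EnrichedLan.natHom_ext fun c => congrArg (fun τ => τ.app c) e

variable (W : ι → EnrichedFunctor V A D) (P : κ → EnrichedFunctor V B D)
  [∀ i j, HasNatHom (W i) (W j)] [∀ i j, HasNatHom (P i) (P j)] {G : EnrichedFunctor V A B}
  {o : ι → κ} {η : ∀ i, GradedTrans (𝟙_ V) (W i) (G.comp V (P (o i)))}
  (h : ∀ i, IsLan G (W i) (P (o i)) (η i))

/-- The action of left Kan extension along `G` on transformations. -/
def lanTrans (i j : ι) : GradedTrans (natHom (W i) (W j)) (P (o i)) (P (o j)) :=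
  ((h i).existsUnique (P (o j)) ((GradedTrans.comp (natHomπ (W i) (W j)) (η j)).precomp
    (ρ_ _).inv)).choose

/-- The defining property of `lanTrans`: compatibility with the units. -/
theorem lanTrans_spec (i j : ι) (a : A) :
    pre ((η i).at a) ((lanTrans W P h i j).app (G.obj a)) =
      post ((natHomπ (W i) (W j)).app a) ((η j).at a) :=
  ((h i).existsUnique (P (o j)) ((GradedTrans.comp (natHomπ (W i) (W j)) (η j)).precomp
    (ρ_ _).inv)).choose_spec.1 a

theorem pre_lanTrans (i j : ι) (a : A) :
    pre ((η i).at a) (natHomLift (lanTrans W P h i j) ≫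
      (natHomπ (P (o i)) (P (o j))).app (G.obj a)) =
      post ((natHomπ (W i) (W j)).app a) ((η j).at a) := by
  rw [natHomLift_π, lanTrans_spec]

theorem comp_pre_lanTrans {E : V} {i j : ι} (f : E ⟶ natHom (W i) (W j)) (a : A) :
    pre ((η i).at a) ((f ≫ natHomLift (lanTrans W P h i j)) ≫
      (natHomπ (P (o i)) (P (o j))).app (G.obj a)) =
      post (f ≫ (natHomπ (W i) (W j)).app a) ((η j).at a) := by
  rw [Category.assoc, ← comp_pre, pre_lanTrans, comp_post]

/-- Left Kan extension along `G`, as a `V`-functor between full subcategories of functor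
categories. -/
def lanFunctor :
    letI := enrichedOfFunctors W
    letI := enrichedOfFunctors P
    EnrichedFunctor V ι κ :=
  letI := enrichedOfFunctors W
  letI := enrichedOfFunctors P
  { obj := o
    map := fun i j => natHomLift (lanTrans W P h i j)
    map_id := fun i => (h i).natHom_ext fun a => by
      refine (comp_pre_lanTrans W P h (natHomLift (GradedTrans.id (W i))) a).trans ?_
      refine (congrArg (post · _) (natHomLift_π (GradedTrans.id (W i)) a)).trans ?_
      refine (eId_post ((η i).at a)).trans ((eId_pre _).symm.trans ?_)
      exact congrArg (pre _) (natHomLift_π (GradedTrans.id (P (o i))) (G.obj a)).symm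
    map_comp := fun i j k => (h i).natHom_ext fun a => by
      refine (comp_pre_lanTrans W P h
        (natHomLift ((natHomπ (W i) (W j)).comp (natHomπ (W j) (W k)))) a).trans ?_
      refine (congrArg (post · _)
        (natHomLift_π ((natHomπ (W i) (W j)).comp (natHomπ (W j) (W k))) a)).trans ?_
      refine Eq.trans ?_ (congrArg (pre ((η i).at a)) (natHomComp_π (F := P (o i)) (G := P (o j))
        (H := P (o k)) (natHomLift (lanTrans W P h i j)) (natHomLift (lanTrans W P h j k))
        (G.obj a))).symm
      rw [← pre_cmp, pre_lanTrans, post_cmp, pre_lanTrans, cmp_post]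
      rfl }

end LanFunctor

/-! ### Generalized elements under an adjunction -/

section Adjunctions

variable {V : Type w} [Category.{u} V] [MonoidalCategory V] [SymmetricCategory V]
  [MonoidalClosed V]
variable {C : Type u₁} [EnrichedCategory V C] {D : Type u₂} [EnrichedCategory V D]
  {L : EnrichedFunctor V C D} {R : EnrichedFunctor V D C}

/-- The adjunction isomorphism is given by the right adjoint and the unit, on generalized elements. -/
theorem EnrichedAdjunction.comp_homIso (adj : EnrichedAdjunction L R) {E : V} {X : C} {Y : D}
    (f : E ⟶ (L.obj X ⟶[V] Y)) :
    f ≫ (adj.homIso X Y).hom = pre (adj.unit X) (f ≫ R.map (L.obj X) Y) := by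
  calc f ≫ (adj.homIso X Y).hom = pre (eId V (L.obj X)) f ≫ (adj.homIso X Y).hom := by
        rw [pre_eId]
    _ = (λ_ E).inv ≫ (eId V (L.obj X) ⊗ₘ f) ≫
        cmp (adj.homIso X (L.obj X)).hom (R.map (L.obj X) Y) := by
      rw [pre, cmp, Category.assoc, Category.assoc, adj.naturality_right]
      rfl
    _ = _ := by
      rw [comp_cmp]
      rfl

/-- The left adjoint on homs transposes to composition with the unit, on generalized elements. -/
theorem EnrichedAdjunction.map_homIso (adj : EnrichedAdjunction L R) {E : V} {X' X : C}
    (f : E ⟶ (X' ⟶[V] X)) :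
    f ≫ L.map X' X ≫ (adj.homIso X' (L.obj X)).hom = post f (adj.unit X) := by
  calc f ≫ L.map X' X ≫ (adj.homIso X' (L.obj X)).hom =
        post (f ≫ L.map X' X) (eId V (L.obj X)) ≫ (adj.homIso X' (L.obj X)).hom := by
        rw [post_eId, Category.assoc]
    _ = (ρ_ E).inv ≫ (f ⊗ₘ eId V (L.obj X)) ≫
        cmp (𝟙 (X' ⟶[V] X)) (adj.homIso X (L.obj X)).hom := by
      refine Eq.trans ?_ (congrArg (fun t => (ρ_ E).inv ≫ (f ⊗ₘ eId V (L.obj X)) ≫ t)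
        (adj.naturality_left X' X (L.obj X)))
      simp only [post, cmp, Category.assoc, tensorHom_comp_tensorHom_assoc, Category.comp_id]
    _ = _ := by
      rw [comp_cmp, Category.comp_id]
      rfl

end Adjunctions

/-! ### Reflecting small presheaves -/

section Reflection

variable {V : Type w} [Category.{u} V] [MonoidalCategory V] [SymmetricCategory V]
  [MonoidalClosed V]
variable {A : Type u₁} [EnrichedCategory V A] {K : Type u₄} [EnrichedCategory V K]
  {M : EnrichedFunctor V A K} {W : EnrichedFunctor V Aᵒᵖ V} {X : K}

/-- The cocylinder of a unit-graded transformation `W ⟶ K(M -, X)`. -/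
def cocylinder (k : GradedTrans (𝟙_ V) W ((opFunctor M).comp V (rep X))) (a : A) :
    W.obj (op a) ⟶ (M.obj a ⟶[V] X) :=
  elt (k.at (op a))

/-- Compatibility of a family with the actions on `W` and on `K(M -, X)` is naturality of the
corresponding graded cocylinder. -/
theorem act_graded_iff {E : V} (s : ∀ a, W.obj (op a) ⊗ E ⟶ (M.obj a ⟶[V] X)) (a' a : A) :
    (act W a' a ▷ E ≫ s a' = (α_ _ _ _).hom ≫ (a' ⟶[V] a) ◁ s a ≫
      act ((opFunctor M).comp V (rep X)) a' a) ↔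
    act W a' a ▷ E ≫ s a' = (α_ _ _ _).hom ≫ cmp (M.map a' a) (s a) := by
  have e : (a' ⟶[V] a) ◁ s a ≫ cmp (M.map a' a) (𝟙 (M.obj a ⟶[V] X)) = cmp (M.map a' a) (s a) := by
    rw [whiskerLeft_cmp, Category.comp_id]
  exact Eq.congr_right (congrArg ((α_ _ _ _).hom ≫ ·)
    ((congrArg ((a' ⟶[V] a) ◁ s a ≫ ·) (act_weight M X a' a)).trans e))

theorem comp_rightUnitor_inv_cmp {H F F' : V} {x y z : K} {l : H ⊗ F ⟶ F'} {m : H ⟶ (x ⟶[V] y)}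
    {s' : F' ⊗ 𝟙_ V ⟶ (x ⟶[V] z)} {s : F ⊗ 𝟙_ V ⟶ (y ⟶[V] z)}
    (h : l ▷ 𝟙_ V ≫ s' = (α_ _ _ _).hom ≫ cmp m s) :
    l ≫ (ρ_ F').inv ≫ s' = cmp m ((ρ_ F).inv ≫ s) := by
  rw [rightUnitor_inv_naturality_assoc, h, ← whiskerLeft_cmp]
  simp

theorem act_cocylinder (k : GradedTrans (𝟙_ V) W ((opFunctor M).comp V (rep X))) (a' a : A) :
    act W a' a ≫ cocylinder k a' = cmp (M.map a' a) (cocylinder k a) := by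
  have h := (act_graded_iff (fun a => MonoidalClosed.uncurry (k.at (op a))) a' a).1
    (k.act_comp a' a)
  exact comp_rightUnitor_inv_cmp h

/-- Colimits of `M` weighted by `W`, in terms of graded transformations `W ⟶ K(M -, Y)`. -/
theorem isWeightedColimit_of_trans (k : GradedTrans (𝟙_ V) W ((opFunctor M).comp V (rep X)))
    (h : ∀ (Y : K) (E : V) (σ : GradedTrans E W ((opFunctor M).comp V (rep Y))),
      ∃! f : E ⟶ (X ⟶[V] Y), ∀ a, pre (C := V) (Y := M.obj a ⟶[V] X) (Z := M.obj a ⟶[V] Y)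
        (k.at (op a)) (f ≫ (corep (M.obj a)).map X Y) = σ.at (op a)) :
    IsWeightedColimit W M X (cocylinder k) := by
  rw [isWeightedColimit_iff]
  refine ⟨act_cocylinder k, fun Y E s hs => ?_⟩
  let σ : GradedTrans E W ((opFunctor M).comp V (rep Y)) :=
    GradedTrans.ofAct s fun a' a => (act_graded_iff s a' a).2 (hs a' a)
  have key (f : E ⟶ (X ⟶[V] Y)) (a : A) : pre (C := V) (Y := M.obj a ⟶[V] X)
      (Z := M.obj a ⟶[V] Y) (k.at (op a)) (f ≫ (corep (M.obj a)).map X Y) = σ.at (op a) ↔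
      cmp (cocylinder k a) f = s a := by
    have e : MonoidalClosed.uncurry (σ.at (op a)) = s a := MonoidalClosed.uncurry_curry _
    rw [← e]
    refine MonoidalClosed.uncurry_injective.eq_iff.symm.trans ?_
    exact Eq.congr_left (uncurry_pre_corep (x := M.obj a) (Y := X) (Z := Y) (k.at (op a)) f)
  obtain ⟨f, hf, hu⟩ := h Y E σ
  exact ⟨f, fun a => (key f a).1 (hf a), fun g hg => hu g fun a => (key g a).2 (hg a)⟩

variable [HasLimits V]

theorem smallYoneda_map_π (x y z : K) :
    (smallYoneda K).map x y ≫ (natHomπ (smallRep x).presheaf (smallRep (V := V) y).presheaf).app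
      (op z) = (corep z).map x y :=
  haveI : HasNatHom (rep (V := V) x) (rep y) := (isSmall_rep x).hasNatHom _
  natHomLift_π (repHom x y) (op z)

variable {L : EnrichedFunctor V (SmallPresheaf V K) K}

/-- The transformation `W ⟶ P M ⟶ K(M -, L P)` induced by the unit of an adjunction with the
Yoneda embedding. -/
def unitTrans (adj : EnrichedAdjunction L (smallYoneda K)) (P : SmallPresheaf V K)
    (η : GradedTrans (𝟙_ V) W ((opFunctor M).comp V P.presheaf)) :
    GradedTrans (𝟙_ V) W ((opFunctor M).comp V (rep (L.obj P))) :=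
  (GradedTrans.comp (G := (opFunctor M).comp V P.presheaf)
    (H := (opFunctor M).comp V (rep (L.obj P))) η
    (((natHomπ P.presheaf (smallRep (L.obj P)).presheaf).precomp (adj.unit P)).whisker
      (opFunctor M))).precomp (λ_ _).inv

/-- Composition with `unitTrans adj P η` is transposition across the adjunction followed by restriction
along `η`. -/
theorem pre_unitTrans (adj : EnrichedAdjunction L (smallYoneda K)) (P : SmallPresheaf V K)
    (η : GradedTrans (𝟙_ V) W ((opFunctor M).comp V P.presheaf)) {Y : K} {E : V}
    (f : E ⟶ (L.obj P ⟶[V] Y)) (a : A) :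
    pre (C := V) (Y := M.obj a ⟶[V] L.obj P) (Z := M.obj a ⟶[V] Y)
      ((unitTrans adj P η).at (op a)) (f ≫ (corep (M.obj a)).map (L.obj P) Y) =
    pre (C := V) (Z := M.obj a ⟶[V] Y) (η.at (op a)) ((f ≫ (adj.homIso P Y).hom) ≫
      (natHomπ P.presheaf (smallRep Y).presheaf).app (op (M.obj a))) := by
  have e : (f ≫ (adj.homIso P Y).hom) ≫
      (natHomπ P.presheaf (smallRep Y).presheaf).app (op (M.obj a)) =
      pre (C := V) (Y := M.obj a ⟶[V] L.obj P) (Z := M.obj a ⟶[V] Y)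
        (adj.unit P ≫ (natHomπ P.presheaf (smallRep (L.obj P)).presheaf).app (op (M.obj a)))
        (f ≫ (corep (M.obj a)).map (L.obj P) Y) := by
    refine (congrArg (· ≫ _) (adj.comp_homIso f)).trans ?_
    refine (pre_map (evalAt SmallPresheaf.presheaf (op (M.obj a))) (adj.unit P)
      (f ≫ (smallYoneda K).map (L.obj P) Y)).trans ?_
    refine congrArg (pre (C := V) _) ((Category.assoc _ _ _).trans (congrArg (f ≫ ·) ?_))
    exact smallYoneda_map_π (L.obj P) Y (M.obj a)
  refine Eq.trans ?_ (congrArg (pre (C := V) (η.at (op a))) e.symm)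
  exact (pre_pre (C := V) (Y := M.obj a ⟶[V] L.obj P) (Z := M.obj a ⟶[V] Y) _ _ _).symm

/-- A left adjoint `L` of the Yoneda embedding sends the left Kan extension of `W` along `Mᵒᵖ` to the
colimit of `M` weighted by `W`. -/
theorem isWeightedColimit_of_isLan_op (adj : EnrichedAdjunction L (smallYoneda K))
    (P : SmallPresheaf V K) {η : GradedTrans (𝟙_ V) W ((opFunctor M).comp V P.presheaf)}
    (h : IsLan (opFunctor M) W P.presheaf η) :
    IsWeightedColimit W M (L.obj P) (cocylinder (unitTrans adj P η)) := by
  refine isWeightedColimit_of_trans _ fun Y E σ => ?_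
  obtain ⟨τ, hτ, hu⟩ := h.existsUnique (smallRep Y).presheaf σ
  let t : E ⟶ (P ⟶[V] (smallYoneda K).obj Y) := natHomLift τ
  have ht (a : A) : pre (C := V) (Z := M.obj a ⟶[V] Y) (η.at (op a))
      (t ≫ (natHomπ P.presheaf (smallRep Y).presheaf).app (op (M.obj a))) = σ.at (op a) :=
    (congrArg (pre (C := V) (η.at (op a))) (natHomLift_π τ _)).trans (hτ (op a))
  refine ⟨t ≫ (adj.homIso P Y).inv, fun a => ?_, fun g hg => ?_⟩
  · refine (pre_unitTrans adj P η _ a).trans ?_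
    rw [Category.assoc, Iso.inv_hom_id, Category.comp_id]
    exact ht a
  · rw [Iso.eq_comp_inv]
    refine h.natHom_ext fun a => ?_
    exact (pre_unitTrans adj P η g a.unop).symm.trans ((hg a.unop).trans (ht a.unop).symm)

end Reflection

/-! ### Values of left Kan extensions of presheaves -/

section Pointwise

variable {V : Type w} [Category.{u} V] [MonoidalCategory V] [SymmetricCategory V]
  [MonoidalClosed V]
variable {A : Type u₁} [EnrichedCategory V A] {K : Type u₄} [EnrichedCategory V K]
  {M : EnrichedFunctor V A K} {W : EnrichedFunctor V Aᵒᵖ V}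

/-- Tensor products over `ιᵒᵖ` are tensor products over `ι`, the families being reindexed. -/
theorem IsTensor.unop {ι : Type u₁} {R F : ιᵒᵖ → V} {H : ιᵒᵖ → ιᵒᵖ → V}
    {r : ∀ x' x, R x' ⊗ H x' x ⟶ R x} {l : ∀ x' x, H x' x ⊗ F x ⟶ F x'} {L : V}
    {ν : ∀ x, R x ⊗ F x ⟶ L} (h : IsTensor r l L ν)
    {r' : ∀ a' a : ι, R (op a') ⊗ H (op a') (op a) ⟶ R (op a)} {ν' : ∀ a, R (op a) ⊗ F (op a) ⟶ L}
    (hr : ∀ a' a, r (op a') (op a) = r' a' a) (hν : ∀ a, ν (op a) = ν' a) :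
    IsTensor (R := fun a => R (op a)) (F := fun a => F (op a)) (H := fun a' a => H (op a') (op a))
      r' (fun a' a => l (op a') (op a)) L ν' := by
  obtain rfl : (fun a' a => r (op a') (op a)) = r' := funext₂ hr
  obtain rfl : (fun a => ν (op a)) = ν' := funext hν
  refine ⟨fun a' a => h.balanced (op a') (op a), fun X t ht => ?_⟩
  obtain ⟨g, hg, hu⟩ := h.existsUnique X (fun x => t x.unop) fun x' x => ht x'.unop x.unop
  exact ⟨g, fun a => hg (op a), fun g' hg' => hu g' fun x => hg' x.unop⟩

/-- The cocylinder `W ⟶ [K(k, M -), P k]` corresponding to a transformation `W ⟶ P M`. -/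
def evCocylinder {P : EnrichedFunctor V Kᵒᵖ V}
    (η : GradedTrans (𝟙_ V) W ((opFunctor M).comp V P)) (k : K) (a : A) :
    W.obj (op a) ⟶ (ihom (k ⟶[V] M.obj a)).obj (P.obj (op k)) :=
  elt (Y := P.obj (op (M.obj a))) (η.at (op a)) ≫ MonoidalClosed.curry (act P k (M.obj a))

theorem uncurry_evCocylinder {P : EnrichedFunctor V Kᵒᵖ V}
    (η : GradedTrans (𝟙_ V) W ((opFunctor M).comp V P)) (k : K) (a : A) :
    MonoidalClosed.uncurry (evCocylinder η k a) =
      (k ⟶[V] M.obj a) ◁ elt (Y := P.obj (op (M.obj a))) (η.at (op a)) ≫ act P k (M.obj a) := by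
  rw [evCocylinder, MonoidalClosed.uncurry_natural_left, MonoidalClosed.uncurry_curry]

theorem braiding_uncurry_lanCylinder {P : EnrichedFunctor V Kᵒᵖ V}
    (η : GradedTrans (𝟙_ V) W ((opFunctor M).comp V P)) (k : K) (a : A) :
    (β_ _ _).hom ≫ MonoidalClosed.uncurry (lanCylinder η (op k) (op a)) =
      MonoidalClosed.uncurry (evCocylinder η k a) := by
  refine (congrArg ((β_ _ _).hom ≫ ·) (uncurry_pre (Y := P.obj (op (M.obj a))) (η.at (op a))
    (P.map (op (M.obj a)) (op k)))).trans ?_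
  rw [uncurry_evCocylinder, act]
  exact (braiding_naturality_right_assoc _ _ _).symm

/-- The action of `Aᵒᵖ` on the weight `K(k, M -)` of the Kan extension along `Mᵒᵖ` is that of the
`V`-functor `K(k, M -)`. -/
theorem braiding_act_opFunctor (k : K) (a' a : A) :
    (β_ _ _).hom ≫ act ((opFunctor (opFunctor M)).comp V (rep (op k))) (op a) (op a') =
      MonoidalClosed.uncurry ((M.comp V (corep k)).map a' a) := by
  refine (congrArg ((β_ _ _).hom ≫ ·) ((act_weight (opFunctor M) (op k) (op a) (op a')).trans
    (cmp_op (X := op (M.obj a)) (Y := op (M.obj a')) (Z := op k) (M.map a' a) (𝟙 _)))).trans ?_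
  refine (SymmetricCategory.symmetry_assoc _ _ _).trans ?_
  exact (uncurry_comp_curry_eComp (M.map a' a)).symm

/-- The value at `k` of the left Kan extension of `W` along `Mᵒᵖ` is a colimit of `K(k, M -)`
weighted by `W`. -/
theorem isWeightedColimit_evCocylinder {P : EnrichedFunctor V Kᵒᵖ V}
    {η : GradedTrans (𝟙_ V) W ((opFunctor M).comp V P)} (h : IsLan (opFunctor M) W P η) (k : K) :
    IsWeightedColimit W (M.comp V (corep k)) (P.obj (op k)) (evCocylinder η k) :=
  IsTensor.isWeightedColimit ((isTensor_of_isWeightedColimit (h (op k))).swap.unop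
    (fun a' a => braiding_act_opFunctor k a' a) (braiding_uncurry_lanCylinder η k))

/-- The action of a presheaf is natural with respect to transformations of presheaves. -/
theorem cmp_curry_act {P P' : EnrichedFunctor V Kᵒᵖ V} {E U U' : V} (τ : GradedTrans E P P')
    {x : K} {e : U ⟶ P.obj (op x)} {e' : U' ⟶ P'.obj (op x)} {c : U ⊗ E ⟶ U'}
    (h : e ▷ E ≫ MonoidalClosed.uncurry (τ.app (op x)) = c ≫ e') (k : K) :
    cmp (C := V) (X := k ⟶[V] x) (Y := P.obj (op k)) (Z := P'.obj (op k))
      (e ≫ MonoidalClosed.curry (act P k x)) (τ.app (op k)) =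
        c ≫ e' ≫ MonoidalClosed.curry (act P' k x) := by
  apply MonoidalClosed.uncurry_injective
  refine (uncurry_cmp _ _).trans ?_
  rw [MonoidalClosed.uncurry_natural_left, MonoidalClosed.uncurry_natural_left,
    MonoidalClosed.uncurry_natural_left, MonoidalClosed.uncurry_curry,
    MonoidalClosed.uncurry_curry, MonoidalCategory.comp_whiskerRight_assoc, τ.act_comp,
    ← associator_inv_naturality_middle_assoc, Iso.inv_hom_id_assoc,
    ← MonoidalCategory.whiskerLeft_comp_assoc, h, MonoidalCategory.whiskerLeft_comp_assoc]

end Pointwise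

/-! ### Kan extensions of models in a category satisfying Axiom B2 -/

section PresheafLan

variable {V : Type w} [Category.{u} V] [MonoidalCategory V] [SymmetricCategory V]
  [MonoidalClosed V] [HasLimits V] [HasColimits V]
variable {A : Type u} [EnrichedCategory V A] {B : Type u₂} [EnrichedCategory V B]
  {K : Type u₄} [EnrichedCategory V K] (M : EnrichedFunctor V A K)

/-- The left Kan extension along `Mᵒᵖ` of a presheaf on `A`, a small presheaf on `K`. -/
def presheafLan (W : EnrichedFunctor V Aᵒᵖ V) : SmallPresheaf V K where
  presheaf := (exists_isLan_self (opFunctor M) W).choose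
  isSmall := ⟨A, _, M, W, (exists_isLan_self (opFunctor M) W).choose_spec⟩

/-- The unit of the left Kan extension along `Mᵒᵖ`. -/
def presheafLanUnit (W : EnrichedFunctor V Aᵒᵖ V) :
    GradedTrans (𝟙_ V) W ((opFunctor M).comp V (presheafLan M W).presheaf) :=
  (exists_isLan_self (opFunctor M) W).choose_spec.choose

theorem isLan_presheafLan (W : EnrichedFunctor V Aᵒᵖ V) :
    IsLan (opFunctor M) W (presheafLan M W).presheaf (presheafLanUnit M W) :=
  (exists_isLan_self (opFunctor M) W).choose_spec.choose_spec

/-- The `V`-functor `[Aᵒᵖ, V] → P K` given by left Kan extension along `Mᵒᵖ`. -/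
def presheafLanFunctor : EnrichedFunctor V (EnrichedFunctor V Aᵒᵖ V) (SmallPresheaf V K) :=
  lanFunctor id SmallPresheaf.presheaf (isLan_presheafLan M)

variable (G : EnrichedFunctor V A B)

/-- The left Kan extension along `G` of `A ⟶ K ⟶ P K`, namely `b ↦ ∫^a B(G a, b) ⊗ K(-, M a)`. -/
def lanPresheaf : EnrichedFunctor V B (SmallPresheaf V K) :=
  (nerve G).comp V (presheafLanFunctor M)

/-- The unit of `presheafLan M` at the nerve of `G`. -/
def lanPresheafUnit (b : B) : GradedTrans (𝟙_ V) ((opFunctor G).comp V (rep b))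
    ((opFunctor M).comp V ((lanPresheaf M G).obj b).presheaf) :=
  presheafLanUnit M ((nerve G).obj b)

theorem isLan_lanPresheaf (b : B) : IsLan (opFunctor M) ((opFunctor G).comp V (rep b))
    ((lanPresheaf M G).obj b).presheaf (lanPresheafUnit M G b) :=
  isLan_presheafLan M ((nerve G).obj b)

/-- Naturality of `lanPresheafUnit` in `b`. -/
theorem pre_lanPresheaf_map (b b' : B) (a : A) :
    pre (C := V) (X := G.obj a ⟶[V] b)
      (Y := ((lanPresheaf M G).obj b).presheaf.obj (op (M.obj a)))
      (Z := ((lanPresheaf M G).obj b').presheaf.obj (op (M.obj a)))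
      ((lanPresheafUnit M G b).at (op a)) ((lanPresheaf M G).map b b' ≫
      (natHomπ ((lanPresheaf M G).obj b).presheaf ((lanPresheaf M G).obj b').presheaf).app
        (op (M.obj a))) =
    post (C := V) (X := G.obj a ⟶[V] b) (Y := G.obj a ⟶[V] b')
      (Z := ((lanPresheaf M G).obj b').presheaf.obj (op (M.obj a)))
      ((corep (G.obj a)).map b b') ((lanPresheafUnit M G b').at (op a)) := by
  refine (comp_pre_lanTrans id SmallPresheaf.presheaf (isLan_presheafLan M) ((nerve G).map b b')
    (op a)).trans ?_
  exact congrArg (fun t => post (C := V) t ((lanPresheafUnit M G b').at (op a)))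
    (nerve_map_π G b b' a)

/-- Evaluating `lanPresheaf M G` at `k` gives a left Kan extension of `K(k, M -)` along `G`: by symmetry
of the tensor product, `∫^a B(G a, b) ⊗ K(k, M a)` is a value of either Kan extension. -/
theorem exists_isLan_lanPresheaf_evalAt (k : K) :
    ∃ η : GradedTrans (𝟙_ V) (M.comp V (corep k))
      (G.comp V ((lanPresheaf M G).comp V (evalAt SmallPresheaf.presheaf (op k)))),
      IsLan G (M.comp V (corep k))
        ((lanPresheaf M G).comp V (evalAt SmallPresheaf.presheaf (op k))) η := by
  refine exists_isLan_of_cylinder (G := G) (M := M.comp V (corep k))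
    ((lanPresheaf M G).comp V (evalAt SmallPresheaf.presheaf (op k)))
    (fun b a => evCocylinder (lanPresheafUnit M G b) k a) (fun a b b' => ?_)
    fun b => isWeightedColimit_evCocylinder (isLan_lanPresheaf M G b) k
  · refine cmp_curry_act ((natHomπ ((lanPresheaf M G).obj b).presheaf
      ((lanPresheaf M G).obj b').presheaf).precomp ((lanPresheaf M G).map b b')) (x := M.obj a)
      (c := eComp V (G.obj a) b b') ?_ k
    refine (uncurry_pre (X := G.obj a ⟶[V] b)
      (Y := ((lanPresheaf M G).obj b).presheaf.obj (op (M.obj a)))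
      (Z := ((lanPresheaf M G).obj b').presheaf.obj (op (M.obj a))) _ _).symm.trans ?_
    refine (congrArg MonoidalClosed.uncurry (pre_lanPresheaf_map M G b b' a)).trans ?_
    refine (uncurry_post _ _).trans (congrArg (· ≫ _) ?_)
    exact MonoidalClosed.uncurry_curry _

theorem IsContinuous.comp_corep {Φ : WeightClass.{u, w, a} V} {M : EnrichedFunctor V A K}
    (hM : IsContinuous Φ M) (hK : IsComplete Φ K) (k : K) :
    IsContinuous Φ (M.comp V (corep k)) :=
  hM.comp ⟨hK, fun _ _ _ _ _ _ _ h => h.corep k⟩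

/-- Under Axiom A, the left Kan extension of `A ⟶ K ⟶ P K` along `G` is `Φ`-continuous, since it is
so after evaluation at each object of `K`. -/
theorem AxiomA.isContinuous_lanPresheaf {Φ : WeightClass.{u, w, a} V} (hΦ : AxiomA Φ)
    (hA : IsComplete Φ A) (hB : IsComplete Φ B) (hK : IsComplete Φ K)
    {M : EnrichedFunctor V A K} (hM : IsContinuous Φ M) : IsContinuous Φ (lanPresheaf M G) where
  complete := hB
  preserves J _ F hF S L μ h := by
    refine isWeightedLimit_of_evalAt SmallPresheaf.presheaf F (S.comp V (lanPresheaf M G))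
      ((lanPresheaf M G).obj L) _ fun x => ?_
    obtain ⟨η, hη⟩ := exists_isLan_lanPresheaf_evalAt M G x.unop
    have hc := hΦ.isContinuous_of_isLan hA hB (hM.comp_corep hK x.unop) hη
    exact (hc.preserves J F hF S L μ h).congr (fun j j' => (Category.assoc _ _ _).symm)
      fun j => (Category.assoc _ _ _).symm

variable {L : EnrichedFunctor V (SmallPresheaf V K) K}

/-- A left adjoint `L` of the Yoneda embedding of `K` sends the left Kan extension of
`A ⟶ K ⟶ P K` to a left Kan extension of `M`. -/
theorem exists_isLan_lanPresheaf_comp (adj : EnrichedAdjunction L (smallYoneda K)) :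
    ∃ η : GradedTrans (𝟙_ V) M (G.comp V ((lanPresheaf M G).comp V L)),
      IsLan G M ((lanPresheaf M G).comp V L) η := by
  let P (b : B) : SmallPresheaf V K := (lanPresheaf M G).obj b
  let c (b : B) := unitTrans adj (P b) (lanPresheafUnit M G b)
  refine exists_isLan_of_cylinder (G := G) (M := M)
    ((lanPresheaf M G).comp V L) (fun b a => cocylinder (c b) a) (fun a b b' => ?_)
    fun b => isWeightedColimit_of_isLan_op adj (P b) (isLan_lanPresheaf M G b)
  · let f : (b ⟶[V] b') ⟶ (P b ⟶[V] P b') := (lanPresheaf M G).map b b'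
    let π (Q Q' : SmallPresheaf V K) :=
      (natHomπ Q.presheaf Q'.presheaf).app (op (M.obj a))
    have h1 : ((f ≫ L.map (P b) (P b')) ≫ (adj.homIso (P b) (L.obj (P b'))).hom) ≫
        π (P b) (smallRep (L.obj (P b'))) =
        post (C := V) (f ≫ π (P b) (P b')) (adj.unit (P b') ≫ π (P b') (smallRep (L.obj (P b')))) :=
      (congrArg (· ≫ _) ((Category.assoc _ _ _).trans (adj.map_homIso f))).trans
        (post_map (evalAt SmallPresheaf.presheaf (op (M.obj a))) f (adj.unit (P b')))
    have h2 : pre (C := V) (X := G.obj a ⟶[V] b) (Y := M.obj a ⟶[V] L.obj (P b))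
        (Z := M.obj a ⟶[V] L.obj (P b')) ((c b).at (op a))
        ((f ≫ L.map (P b) (P b')) ≫ (corep (M.obj a)).map (L.obj (P b)) (L.obj (P b'))) =
        post (C := V) (X := G.obj a ⟶[V] b) (Y := G.obj a ⟶[V] b')
          (Z := M.obj a ⟶[V] L.obj (P b')) ((corep (G.obj a)).map b b') ((c b').at (op a)) := by
      refine (pre_unitTrans adj (P b) (lanPresheafUnit M G b) _ a).trans ?_
      refine (congrArg (pre (C := V) _) h1).trans ?_
      refine (pre_post (C := V) _ _ _).trans ?_
      refine (congrArg (post (C := V) · _) (pre_lanPresheaf_map M G b b' a)).trans ?_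
      refine (post_post (C := V) _ _ _).trans ?_
      exact congrArg (post (C := V) _) (post_eq_pre (C := V) _ _)
    refine (uncurry_pre_corep (x := M.obj a) ((c b).at (op a)) (f ≫ L.map (P b) (P b'))).symm.trans ?_
    refine (congrArg MonoidalClosed.uncurry h2).trans ?_
    refine (uncurry_post _ _).trans (congrArg (· ≫ _) ?_)
    exact MonoidalClosed.uncurry_curry _

theorem AxiomB2.exists_isLan {Φ : WeightClass.{u, w, a} V} (hK : AxiomB2 Φ K) :
    ∃ (N : EnrichedFunctor V B K) (η : GradedTrans (𝟙_ V) M (G.comp V N)), IsLan G M N η := by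
  obtain ⟨-, L, ⟨adj⟩, -⟩ := hK
  exact ⟨_, exists_isLan_lanPresheaf_comp M G adj⟩

/-- Left Kan extensions into `K` of `Φ`-continuous `V`-functors are `Φ`-continuous: such an extension is
the composite of two `Φ`-continuous `V`-functors, `lanPresheaf M G` and the left adjoint of the Yoneda
embedding. -/
theorem AxiomB2.isContinuous_of_isLan {Φ : WeightClass.{u, w, a} V} (hK : AxiomB2 Φ K)
    (hΦ : AxiomA Φ) (hA : IsComplete Φ A) (hB : IsComplete Φ B) {G : EnrichedFunctor V A B}
    {M : EnrichedFunctor V A K} (hM : IsContinuous Φ M) {N : EnrichedFunctor V B K}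
    {η : GradedTrans (𝟙_ V) M (G.comp V N)} (h : IsLan G M N η) : IsContinuous Φ N := by
  obtain ⟨hK', L, ⟨adj⟩, hL⟩ := hK
  obtain ⟨η', hη'⟩ := exists_isLan_lanPresheaf_comp M G adj
  exact hη'.isContinuous h ((hΦ.isContinuous_lanPresheaf G hA hB hK' hM).comp hL)

end PresheafLan

/-! ### The left adjoint of an algebraic functor -/

section Adjunction

variable {V : Type w} [Category.{u} V] [MonoidalCategory V] [SymmetricCategory V]
  [MonoidalClosed V]

section

variable {A : Type u₁} [EnrichedCategory V A] {B : Type u₂} [EnrichedCategory V B]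
  {D : Type u₄} [EnrichedCategory V D] {G : EnrichedFunctor V A B} {M : EnrichedFunctor V A D}
  {N : EnrichedFunctor V B D} {η : GradedTrans (𝟙_ V) M (G.comp V N)}

/-- The family induced by the universal property of a left Kan extension. -/
theorem IsLan.exists_desc (h : IsLan G M N η) (S : EnrichedFunctor V B D)
    [HasNatHom N S] [HasNatHom M (G.comp V S)] :
    ∃ f : natHom M (G.comp V S) ⟶ natHom N S, ∀ a,
      pre (η.at a) (f ≫ (natHomπ N S).app (G.obj a)) = (natHomπ M (G.comp V S)).at a := by
  obtain ⟨τ, hτ, -⟩ := h.existsUnique S (natHomπ M (G.comp V S))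
  exact ⟨natHomLift τ, fun a => (congrArg (pre (η.at a)) (natHomLift_π τ (G.obj a))).trans (hτ a)⟩

/-- Precomposition with `η : M ⟶ N G`, as a morphism `[B, D](N, S) ⟶ [A, D](M, S G)`. -/
def preUnit (η : GradedTrans (𝟙_ V) M (G.comp V N)) (S : EnrichedFunctor V B D)
    [HasNatHom N S] [HasNatHom M (G.comp V S)] : natHom N S ⟶ natHom M (G.comp V S) :=
  natHomLift ((GradedTrans.comp (G := G.comp V N) (H := G.comp V S) η
    ((natHomπ N S).whisker G)).precomp (λ_ _).inv)

theorem comp_preUnit_π (η : GradedTrans (𝟙_ V) M (G.comp V N)) (S : EnrichedFunctor V B D)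
    [HasNatHom N S] [HasNatHom M (G.comp V S)] {E : V} (f : E ⟶ natHom N S) (a : A) :
    (f ≫ preUnit η S) ≫ (natHomπ M (G.comp V S)).at a =
      pre (η.at a) (f ≫ (natHomπ N S).app (G.obj a)) := by
  refine (Category.assoc _ _ _).trans ((congrArg (f ≫ ·) (natHomLift_π _ a)).trans ?_)
  exact comp_pre f (η.at a) ((natHomπ N S).app (G.obj a))

theorem preUnit_π (η : GradedTrans (𝟙_ V) M (G.comp V N)) (S : EnrichedFunctor V B D)
    [HasNatHom N S] [HasNatHom M (G.comp V S)] (a : A) :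
    preUnit η S ≫ (natHomπ M (G.comp V S)).at a = pre (η.at a) ((natHomπ N S).app (G.obj a)) :=
  natHomLift_π _ a

/-- The isomorphism `[B, D](Lan_G M, S) ≅ [A, D](M, S G)`. -/
def IsLan.natHomIso (h : IsLan G M N η) (S : EnrichedFunctor V B D)
    [HasNatHom N S] [HasNatHom M (G.comp V S)] : natHom N S ≅ natHom M (G.comp V S) where
  hom := preUnit η S
  inv := (h.exists_desc S).choose
  hom_inv_id := h.natHom_ext fun a => by
    rw [Category.assoc, ← comp_pre, (h.exists_desc S).choose_spec, preUnit_π,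
      Category.id_comp]
  inv_hom_id := EnrichedLan.natHom_ext fun a =>
    (comp_preUnit_π η S _ a).trans
      (((h.exists_desc S).choose_spec a).trans (Category.id_comp _).symm)

end

variable [HasLimits V] {Φ : WeightClass.{u, w, a} V} {A : Type u} [EnrichedCategory V A]
  {B : Type u} [EnrichedCategory V B] {D : Type u₁} [EnrichedCategory V D]

theorem algebraicFunctor_map_π (G : EnrichedFunctor V A B) (hG : IsContinuous Φ G)
    (S S' : Model Φ B D) (a : A) :
    (algebraicFunctor D G hG).map S S' ≫
      (natHomπ (G.comp V S.functor) (G.comp V S'.functor)).app a =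
        (natHomπ S.functor S'.functor).app (G.obj a) :=
  natHomLift_π _ a

/-- If left Kan extensions of models along `G` exist and are models, they provide a left adjoint of
the algebraic functor of `G`. -/
theorem exists_adjunction_algebraicFunctor {G : EnrichedFunctor V A B} (hG : IsContinuous Φ G)
    (o : Model Φ A D → Model Φ B D)
    (η : ∀ M, GradedTrans (𝟙_ V) M.functor (G.comp V (o M).functor))
    (h : ∀ M, IsLan G M.functor (o M).functor (η M)) :
    ∃ (L : EnrichedFunctor V (Model Φ A D) (Model Φ B D))
      (adj : EnrichedAdjunction L (algebraicFunctor D G hG)),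
      ∀ M : Model Φ A D, IsLan G M.functor (L.obj M).functor (Model.trans (adj.unit M)) := by
  let L : EnrichedFunctor V (Model Φ A D) (Model Φ B D) := lanFunctor Model.functor Model.functor h
  have hL (X' X : Model Φ A D) (a : A) :
      pre ((η X').at a) (L.map X' X ≫ (natHomπ (o X').functor (o X).functor).app (G.obj a)) =
        post ((natHomπ X'.functor X.functor).app a) ((η X).at a) :=
    pre_lanTrans Model.functor Model.functor h X' X a
  have hcmp {T : Type u} [EnrichedCategory V T] {X Y Z : Model Φ T D} {E E' : V}
      (f : E ⟶ (X ⟶[V] Y)) (g : E' ⟶ (Y ⟶[V] Z)) (t : T) :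
      cmp f g ≫ (natHomπ X.functor Z.functor).app t =
        cmp (f ≫ (natHomπ X.functor Y.functor).app t)
          (g ≫ (natHomπ Y.functor Z.functor).app t) :=
    cmp_map (evalAt Model.functor t) f g
  let adj : EnrichedAdjunction L (algebraicFunctor D G hG) :=
    { homIso := fun X Y => (h X).natHomIso Y.functor
      naturality_left := fun X' X Y => natHom_ext fun a => by
        refine (comp_preUnit_π (η X') Y.functor (cmp (L.map X' X) (𝟙 (L.obj X ⟶[V] Y))) a).trans ?_
        refine (congrArg (pre _) (hcmp (L.map X' X) (𝟙 (L.obj X ⟶[V] Y)) (G.obj a))).trans ?_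
        refine Eq.trans ?_ (hcmp (𝟙 (X' ⟶[V] X)) (Z := (algebraicFunctor D G hG).obj Y)
          (preUnit (η X) Y.functor) a).symm
        refine (pre_cmp _ _ _).symm.trans ?_
        refine (congrArg (cmp · _) (hL X' X a)).trans ((post_cmp _ _ _).trans ?_)
        refine congrArg₂ cmp (Category.id_comp _).symm ?_
        refine (congrArg (pre _) (Category.id_comp _)).trans ?_
        exact (preUnit_π (η X) Y.functor a).symm
      naturality_right := fun X Y Y' => natHom_ext fun a => by
        refine (comp_preUnit_π (η X) Y'.functor (eComp V (L.obj X) Y Y') a).trans ?_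
        refine Eq.trans ?_ (hcmp (Y := (algebraicFunctor D G hG).obj Y)
          (Z := (algebraicFunctor D G hG).obj Y') (preUnit (η X) Y.functor)
          ((algebraicFunctor D G hG).map Y Y') a).symm
        refine Eq.trans ?_ (congrArg₂ cmp (preUnit_π (η X) Y.functor a)
          (algebraicFunctor_map_π G hG Y Y' a)).symm
        refine (congrArg (pre _) ?_).trans (pre_cmp _ _ _).symm
        exact natHomLift_π _ _ }
  refine ⟨L, adj, fun M => ?_⟩
  have e : Model.trans (adj.unit M) = η M := GradedTrans.ext_app fun a => by
    refine (comp_preUnit_π (η M) (L.obj M).functor (eId V (L.obj M)) a).trans ?_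
    refine (congrArg (pre _) (natHomLift_π (GradedTrans.id (o M).functor) (G.obj a))).trans ?_
    exact eId_pre ((η M).at a)
  rw [e]
  exact h M

end Adjunction

end

end EnrichedLan

theorem mainTheorem8
    {V : Type w} [Category.{u} V] [MonoidalCategory V] [SymmetricCategory V] [MonoidalClosed V]
    [HasLimits V] [HasColimits V]
    (Φ : EnrichedLan.WeightClass.{u, w, a} V) (hΦ : EnrichedLan.AxiomA Φ)
    (A : Type u) [EnrichedCategory V A] (hA : EnrichedLan.IsComplete Φ A)
    (B : Type u) [EnrichedCategory V B] (hB : EnrichedLan.IsComplete Φ B)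
    (G : EnrichedFunctor V A B)
    (K : Type k) [EnrichedCategory V K] (hK : EnrichedLan.AxiomB2 Φ K) :
    -- left Kan extension along `G` exists and preserves `Φ`-continuity, with values in `V`
    (∀ M : EnrichedFunctor V A V, EnrichedLan.IsContinuous Φ M →
      (∃ (N : EnrichedFunctor V B V) (η : EnrichedLan.GradedTrans (𝟙_ V) M (G.comp V N)),
        EnrichedLan.IsLan G M N η) ∧
      ∀ (N : EnrichedFunctor V B V) (η : EnrichedLan.GradedTrans (𝟙_ V) M (G.comp V N)),
        EnrichedLan.IsLan G M N η → EnrichedLan.IsContinuous Φ N) ∧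
    -- the same with values in `K`
    (∀ M : EnrichedFunctor V A K, EnrichedLan.IsContinuous Φ M →
      (∃ (N : EnrichedFunctor V B K) (η : EnrichedLan.GradedTrans (𝟙_ V) M (G.comp V N)),
        EnrichedLan.IsLan G M N η) ∧
      ∀ (N : EnrichedFunctor V B K) (η : EnrichedLan.GradedTrans (𝟙_ V) M (G.comp V N)),
        EnrichedLan.IsLan G M N η → EnrichedLan.IsContinuous Φ N) ∧
    -- algebraic functors between categories of models in `V` have a left adjoint `Lan_G`
    (∀ hG : EnrichedLan.IsContinuous Φ G,
      ∃ (L : EnrichedFunctor V (EnrichedLan.Model Φ A V) (EnrichedLan.Model Φ B V))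
        (adj : EnrichedLan.EnrichedAdjunction L (EnrichedLan.algebraicFunctor V G hG)),
        ∀ M : EnrichedLan.Model Φ A V,
          EnrichedLan.IsLan G M.functor (L.obj M).functor (EnrichedLan.Model.trans (adj.unit M))) ∧
    -- the same for models in `K`
    (∀ hG : EnrichedLan.IsContinuous Φ G,
      ∃ (L : EnrichedFunctor V (EnrichedLan.Model Φ A K) (EnrichedLan.Model Φ B K))
        (adj : EnrichedLan.EnrichedAdjunction L (EnrichedLan.algebraicFunctor K G hG)),
        ∀ M : EnrichedLan.Model Φ A K,
          EnrichedLan.IsLan G M.functor (L.obj M).functor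
            (EnrichedLan.Model.trans (adj.unit M))) := by
  refine ⟨fun M hM => ⟨EnrichedLan.exists_isLan_self G M,
      fun N η h => hΦ.isContinuous_of_isLan hA hB hM h⟩,
    fun M hM => ⟨hK.exists_isLan M G, fun N η h => hK.isContinuous_of_isLan hΦ hA hB hM h⟩,
    fun hG => ?_, fun hG => ?_⟩
  · choose N η h using fun M : EnrichedLan.Model Φ A V =>
      EnrichedLan.exists_isLan_self G M.functor
    exact EnrichedLan.exists_adjunction_algebraicFunctor hG
      (fun M => ⟨N M, hΦ.isContinuous_of_isLan hA hB M.continuous (h M)⟩) η h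
  · choose N η h using fun M : EnrichedLan.Model Φ A K => hK.exists_isLan M.functor G
    exact EnrichedLan.exists_adjunction_algebraicFunctor hG
      (fun M => ⟨N M, hK.isContinuous_of_isLan hΦ hA hB M.continuous (h M)⟩) η h
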